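/- **Conventions.** C*-algebras and *-morphisms are unital; $\mathscr S(A)$ is the state space of $A$, and $A_{sa}$ the set of self-adjoint elements. A seminorm given on a subspace is extended by $\infty$ off that subspace; its domain is then the set where it is finite. For a set $X$ with a $[0,\infty]$-valued distance $d$, let $\overrightarrow{\mathrm{Haus}}_d(S\to T)=\sup_{x\in S}\inf_{y\in T}d(x,y)$ and $\mathrm{Haus}_d(S,T)=\max\{\overrightarrow{\mathrm{Haus}}_d(S\to T),\overrightarrow{\mathrm{Haus}}_d(T\to S)\}$. Fix real numbers $F\ge1$, $K\ge0$, $G\ge1$, $H\ge2$. **Quantum compact metric spaces.** An $(F,K)$-quantum compact metric space $(A,L)$ is a unital C*-algebra $A$ with a seminorm $L$ on a dense subspace of $A_{sa}$ such that $L(1)=0$; the distance $\mathsf{mk}_L(\varphi,\psi)=\sup\{|\varphi(a)-\psi(a)|:L(a)\le1\}$ is a (finite) metric on $\mathscr S(A)$ inducing the weak* topology; $\max\{L(\Re(ab)),L(\Im(ab))\}\le F(L(a)\|b\|+\|a\|L(b))+KL(a)L(b)$ for $a,b$ in the domain of $L$; and $\{L\le1\}$ is closed in $A_{sa}$. **Metrical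 C*-correspondences.** An $(F,K,G,H)$-metrical C*-correspondence $(M,\mathsf D,A,L,B,S)$ consists of $(F,K)$-quantum compact metric spaces $(A,L)$, $(B,S)$, a right Hilbert $B$-module $M$ with a unital *-morphism from $A$ to its adjointable operators, and a norm $\mathsf D$ on a dense subspace of $M$ such that $\mathsf D(\omega)\ge\|\omega\|$; $\{\mathsf D\le1\}$ is norm-compact; $\mathsf D(a\omega)\le G(\|a\|+L(a))\mathsf D(\omega)$ for $a$ in the domain of $L$ and $\omega$ in that of $\mathsf D$; and $\max\{S(\Re\langle\omega,\eta\rangle),S(\Im\langle\omega,\eta\rangle)\}\le H\,\mathsf D(\omega)\mathsf D(\eta)$ for $\omega,\eta$ in the domain of $\mathsf D$. A modular quantum isometry from $(M,\mathsf D,A,L,B,S)$ to $(M',\mathsf D',A',L',B',S')$ is a triple $(\Pi,\pi,\theta)$ of a continuous linear map $\Pi:M\to M'$ and unital *-morphisms $\pi:A\to A'$, $\theta:B\to B'$ with $\Pi(a\omega)=\pi(a)\Pi(\omega)$, $\Pi(\omega b)=\Pi(\omega)\theta(b)$, $\theta(\langle\omega,\eta\rangle)=\langle\Pi\omega,\Pi\eta\rangle$,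 which map the domains of $L,S,\mathsf D$ into those of $L',S',\mathsf D'$ and for which $L',S',\mathsf D'$ are, on their domains, the quotients of $L,S,\mathsf D$ along $\pi,\theta,\Pi$ (for instance $\mathsf D'(\eta)=\inf\{\mathsf D(\omega):\Pi(\omega)=\eta\}$). **Metric spectral triples.** A spectral triple $(A,\mathscr H,D)$ is a nonzero unital C*-algebra $A$ represented unitally on a Hilbert space $\mathscr H$, with a self-adjoint operator $D$ on a dense domain such that $D+i$ has a compact inverse and $\{a\in A_{sa}: a\,\mathrm{dom}(D)\subseteq\mathrm{dom}(D),\ [D,a]\text{ bounded}\}$ is dense in $A_{sa}$. It is metric if $A$, with $L_D(a)=\|[D,a]\|$ on that set, is a $(1,0)$-quantum compact metric space (the inequality with $F=1,K=0$ always holds here). Write $\mathsf D_D(\xi)=\|\xi\|+\|D\xi\|$ for $\xi\in\mathrm{dom}(D)$ and $U^t=\exp(itD)$. Two spectral triples $(A_1,\mathscr H_1,D_1)$ and $(A_2,\mathscr H_2,D_2)$ are unitarily equivalent if there are a unitary $V:\mathscr H_1\to\mathscr H_2$ with $V\,\mathrm{dom}(D_1)=\mathrm{dom}(D_2)$ and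 $VD_1V^*=D_2$, and a *-isomorphism $\pi:A_1\to A_2$ with $\pi(a)=VaV^*$ as operators, for all $a\in A_1$. **Tunnels.** A tunnel $\tau$ from $(A_1,\mathscr H_1,D_1)$ to $(A_2,\mathscr H_2,D_2)$ is an $(F,K,G,H)$-metrical C*-correspondence $\mathbb P=(P,\mathsf T,\mathfrak D,L_{\mathfrak D},\mathfrak E,L_{\mathfrak E})$ with, for $j=1,2$, a modular quantum isometry $(\Pi_j,\pi_j,\theta_j)$ from $\mathbb P$ to $(\mathscr H_j,\mathsf D_{D_j},A_j,L_{D_j},\mathbb C,0)$. Its extent is $$\chi(\tau)=\max_{j=1,2}\max\Big\{\mathrm{Haus}_{\mathsf{mk}_{L_{\mathfrak D}}}\big(\{\varphi\circ\pi_j:\varphi\in\mathscr S(A_j)\},\mathscr S(\mathfrak D)\big),\ \mathrm{Haus}_{\mathsf{mk}_{L_{\mathfrak E}}}\big(\{\psi\circ\theta_j:\psi\in\mathscr S(\mathbb C)\},\mathscr S(\mathfrak E)\big)\Big\}.$$ For families $f=(f_t)_{t\in J}$, $g=(g_t)_{t\in J}$ of continuous linear functionals on $P$, put $d(f,g)=\sup_{t\in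 J}\sup_{\mathsf T(\omega)\le1}|f_t(\omega)-g_t(\omega)|$. For families $(a_t)_{t\in J}$, $(b_t)_{t\in J}$ of bounded operators on $\mathscr H_1$, $\mathscr H_2$, the dispersion $\mathrm{dis}(\tau|(a_t),(b_t))$ is the maximum of $\chi(\tau)$ and $$\mathrm{Haus}_d\Big(\big\{(\langle\xi,a_t\Pi_1(\cdot)\rangle)_{t\in J}:\mathsf D_{D_1}(\xi)\le1\big\},\ \big\{(\langle\eta,b_t\Pi_2(\cdot)\rangle)_{t\in J}:\mathsf D_{D_2}(\eta)\le1\big\}\Big).$$ **The spectral propinquity.** For $\varepsilon>0$, an $\varepsilon$-iso-iso is a pair of maps $\varsigma_1,\varsigma_2:[0,\infty)\to[0,\infty)$ with $\varsigma_1(0)=\varsigma_2(0)=0$ and $\big||\varsigma_j(x)+\varsigma_j(y)-z|-|x+y-\varsigma_k(z)|\big|<\varepsilon$ for all $x,y,z\in[0,1/\varepsilon]$ and $\{j,k\}=\{1,2\}$. The $\varepsilon$-magnitude $\mu(\tau,\varsigma_1,\varsigma_2|\varepsilon)$ is the maximum of $\chi(\tau)$ and of the two numbers, for $(j,k)=(1,2)$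 and $(j,k)=(2,1)$, $$\overrightarrow{\mathrm{Haus}}_d\Big(\big\{(\langle U_j^{-t}\xi,\Pi_j(\cdot)\rangle)_{t\in[0,1/\varepsilon]}:\mathsf D_{D_j}(\xi)\le1\big\}\to\big\{(\langle U_k^{-\varsigma_j(t)}\eta,\Pi_k(\cdot)\rangle)_{t\in[0,1/\varepsilon]}:\mathsf D_{D_k}(\eta)\le1\big\}\Big).$$ The spectral propinquity $\Lambda\big((A_1,\mathscr H_1,D_1),(A_2,\mathscr H_2,D_2)\big)$ is the infimum of the set consisting of $\frac{\sqrt2}{2}$ and of all $\varepsilon>0$ for which there are a tunnel $\tau$ from $(A_1,\mathscr H_1,D_1)$ to $(A_2,\mathscr H_2,D_2)$ and an $\varepsilon$-iso-iso $(\varsigma_1,\varsigma_2)$ with $\mu(\tau,\varsigma_1,\varsigma_2|\varepsilon)<\varepsilon$. **Theorem.** For metric spectral triples, let $$\Lambda^*\big((A_1,\mathscr H_1,D_1),(A_2,\mathscr H_2,D_2)\big)=\inf\Big(\Big\{\tfrac{\sqrt2}{2}\Big\}\cup\Big\{\varepsilon>0:\exists\text{ a tunnel }\tau\text{ from }(A_1,\mathscr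 H_1,D_1)\text{ to }(A_2,\mathscr H_2,D_2)\text{ with }\mathrm{dis}\big(\tau\big|(U_1^t)_{0\le t\le1/\varepsilon},(U_2^t)_{0\le t\le1/\varepsilon}\big)<\varepsilon\Big\}\Big).$$ Then $\Lambda^*$ is a distance on metric spectral triples up to unitary equivalence: it is nonnegative, symmetric, satisfies the triangle inequality, and $\Lambda^*(T_1,T_2)=0$ if and only if $T_1$ and $T_2$ are unitarily equivalent. Moreover, for any two metric spectral triples $T_1,T_2$, $$\Lambda(T_1,T_2)\le\Lambda^*(T_1,T_2)\le2\Lambda(T_1,T_2),$$ so that $\Lambda^*$ and $\Lambda$ are equivalent. -/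

import Mathlib

open scoped ENNReal NNReal Topology ComplexOrder ComplexStarModule

universe u v w u' v' w'

set_option linter.checkUnivs false

noncomputable section

/-! ### States, extended Lipschitz seminorms, Hausdorff distances -/

/-- The state space of a unital C⋆-algebra, inside the dual with its weak* topology. -/
def stateSpace (A : Type*) [CStarAlgebra A] : Set (WeakDual ℂ A) :=
  {φ | φ 1 = 1 ∧ ∀ a : A, 0 ≤ φ (star a * a)}

/-- The Monge-Kantorovich distance of a seminorm `lip` given on a subspace of the self-adjoint
elements and extended by `∞` off that subspace. -/
def mongeKantorovich {A : Type*} [CStarAlgebra A] (lip : selfAdjoint A → ℝ≥0∞)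
    (φ ψ : WeakDual ℂ A) : ℝ≥0∞ :=
  ⨆ (a : selfAdjoint A) (_ : lip a ≤ 1), ‖φ (a : A) - ψ (a : A)‖ₑ

/-- The one-sided Hausdorff distance `sup_{x ∈ S} inf_{y ∈ T} d x y`. -/
def hausdorffExcess {X : Type*} (d : X → X → ℝ≥0∞) (S T : Set X) : ℝ≥0∞ :=
  ⨆ x ∈ S, ⨅ y ∈ T, d x y

/-- The Hausdorff distance. -/
def hausdorffDistOf {X : Type*} (d : X → X → ℝ≥0∞) (S T : Set X) : ℝ≥0∞ :=
  max (hausdorffExcess d S T) (hausdorffExcess d T S)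

/-- `(A, lip)` is an `(F, K)`-quantum compact metric space. The seminorm is extended by `∞`
off its domain, so that its domain is `{a | lip a < ∞}`. -/
structure IsQuantumCompactMetricSpace (F K : ℝ) {A : Type*} [CStarAlgebra A]
    (lip : selfAdjoint A → ℝ≥0∞) : Prop where
  add_le : ∀ a b, lip (a + b) ≤ lip a + lip b
  smul_eq : ∀ (r : ℝ) (a), lip (r • a) = ‖r‖ₑ * lip a
  dense_dom : Dense {a | lip a < ∞}
  lip_one : lip 1 = 0
  /-- the Monge-Kantorovich distance is finite and separates states -/
  finite : ∀ φ ∈ stateSpace A, ∀ ψ ∈ stateSpace A, mongeKantorovich lip φ ψ < ∞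
  separates : ∀ φ ∈ stateSpace A, ∀ ψ ∈ stateSpace A, mongeKantorovich lip φ ψ = 0 → φ = ψ
  /-- its open balls are bases of neighbourhoods for the weak* topology of the state space -/
  weakStar : ∀ φ ∈ stateSpace A, (𝓝[stateSpace A] φ).HasBasis (fun r : ℝ≥0∞ => 0 < r)
    (fun r => {ψ | ψ ∈ stateSpace A ∧ mongeKantorovich lip φ ψ < r})
  leibniz : ∀ a b : selfAdjoint A, lip a < ∞ → lip b < ∞ →
    max (lip (ℜ ((a : A) * b))) (lip (ℑ ((a : A) * b))) ≤
      ENNReal.ofReal F * (lip a * ‖(b : A)‖ₑ + ‖(a : A)‖ₑ * lip b)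
        + ENNReal.ofReal K * lip a * lip b
  isClosed_ball : IsClosed {a | lip a ≤ 1}

/-! ### Metrical C⋆-correspondences -/

/-- A C⋆-correspondence `M` from a unital C⋆-algebra `A` to a unital C⋆-algebra `B`: a right
Hilbert `B`-module (`ract` is the right action of `B`, `ip` the `B`-valued inner product, linear in
its second variable) with a unital ⋆-morphism `lact` from `A` to its adjointable operators. -/
structure CStarCorrespondence where
  A : Type u
  M : Type v
  B : Type w
  [cstarA : CStarAlgebra A]
  [cstarB : CStarAlgebra B]
  [groupM : NormedAddCommGroup M]
  [spaceM : NormedSpace ℂ M]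
  [completeM : CompleteSpace M]
  ract : M → B → M
  ract_add : ∀ ω b c, ract ω (b + c) = ract ω b + ract ω c
  add_ract : ∀ ω η b, ract (ω + η) b = ract ω b + ract η b
  ract_mul : ∀ ω b c, ract ω (b * c) = ract (ract ω b) c
  ract_one : ∀ ω, ract ω 1 = ω
  ip : M → M → B
  ip_add_right : ∀ ω η ζ, ip ω (η + ζ) = ip ω η + ip ω ζ
  ip_smul_right : ∀ ω (z : ℂ) η, ip ω (z • η) = z • ip ω η
  ip_ract : ∀ ω η b, ip ω (ract η b) = ip ω η * b
  ip_star : ∀ ω η, ip ω η = star (ip η ω)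
  ip_nonneg : ∀ ω, ∃ b, ip ω ω = star b * b
  ip_self_eq_zero : ∀ ω, ip ω ω = 0 ↔ ω = 0
  norm_eq : ∀ ω, ‖ω‖ = √‖ip ω ω‖
  lact : A →ₐ[ℂ] (M →L[ℂ] M)
  lact_ract : ∀ a ω b, lact a (ract ω b) = ract (lact a ω) b
  lact_adjoint : ∀ a ω η, ip (lact a ω) η = ip ω (lact (star a) η)

attribute [instance] CStarCorrespondence.cstarA CStarCorrespondence.cstarB
  CStarCorrespondence.groupM CStarCorrespondence.spaceM CStarCorrespondence.completeM

/-- A C⋆-correspondence with a candidate L-seminorm on each of the two algebras and a candidate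
D-norm on the module, all of them extended by `∞` off their domains. -/
structure PreMetricalCorrespondence extends CStarCorrespondence.{u, v, w} where
  lipA : selfAdjoint A → ℝ≥0∞
  lipB : selfAdjoint B → ℝ≥0∞
  dnorm : M → ℝ≥0∞

/-- `P` is an `(F, K, G, H)`-metrical C⋆-correspondence. -/
structure PreMetricalCorrespondence.IsMetrical (F K G H : ℝ)
    (P : PreMetricalCorrespondence.{u, v, w}) : Prop where
  qcmsA : IsQuantumCompactMetricSpace F K P.lipA
  qcmsB : IsQuantumCompactMetricSpace F K P.lipB
  dnorm_add_le : ∀ ω η, P.dnorm (ω + η) ≤ P.dnorm ω + P.dnorm η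
  dnorm_smul : ∀ (z : ℂ) (ω), P.dnorm (z • ω) = ‖z‖ₑ * P.dnorm ω
  dense_dom : Dense {ω | P.dnorm ω < ∞}
  norm_le_dnorm : ∀ ω, ‖ω‖ₑ ≤ P.dnorm ω
  isCompact_ball : IsCompact {ω | P.dnorm ω ≤ 1}
  modular_leibniz : ∀ (a : selfAdjoint P.A) (ω), P.lipA a < ∞ → P.dnorm ω < ∞ →
    P.dnorm (P.lact (a : P.A) ω) ≤ ENNReal.ofReal G * (‖(a : P.A)‖ₑ + P.lipA a) * P.dnorm ω
  inner_leibniz : ∀ ω η, P.dnorm ω < ∞ → P.dnorm η < ∞ →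
    max (P.lipB (ℜ (P.ip ω η))) (P.lipB (ℑ (P.ip ω η))) ≤
      ENNReal.ofReal H * P.dnorm ω * P.dnorm η

/-- A modular quantum isometry `(Π, π, θ)` from `P` to `Q`. -/
structure ModularQuantumIsometry (P : PreMetricalCorrespondence.{u, v, w})
    (Q : PreMetricalCorrespondence.{u', v', w'}) where
  mapM : P.M →L[ℂ] Q.M
  mapA : P.A →⋆ₐ[ℂ] Q.A
  mapB : P.B →⋆ₐ[ℂ] Q.B
  map_lact : ∀ a ω, mapM (P.lact a ω) = Q.lact (mapA a) (mapM ω)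
  map_ract : ∀ ω b, mapM (P.ract ω b) = Q.ract (mapM ω) (mapB b)
  map_ip : ∀ ω η, mapB (P.ip ω η) = Q.ip (mapM ω) (mapM η)
  map_domA : ∀ (d : selfAdjoint P.A) (a : selfAdjoint Q.A), mapA d = a →
    P.lipA d < ∞ → Q.lipA a < ∞
  map_domB : ∀ (d : selfAdjoint P.B) (b : selfAdjoint Q.B), mapB d = b →
    P.lipB d < ∞ → Q.lipB b < ∞
  map_domM : ∀ ω, P.dnorm ω < ∞ → Q.dnorm (mapM ω) < ∞
  lipA_eq : ∀ a : selfAdjoint Q.A, Q.lipA a < ∞ →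
    Q.lipA a = ⨅ (d : selfAdjoint P.A) (_ : mapA d = a), P.lipA d
  lipB_eq : ∀ b : selfAdjoint Q.B, Q.lipB b < ∞ →
    Q.lipB b = ⨅ (d : selfAdjoint P.B) (_ : mapB d = b), P.lipB d
  dnorm_eq : ∀ η : Q.M, Q.dnorm η < ∞ →
    Q.dnorm η = ⨅ (ω : P.M) (_ : mapM ω = η), P.dnorm ω

/-- A metrical tunnel from `M₁` to `M₂`, in the class of `(F, K, G, H)`-metrical
C⋆-correspondences. -/
structure MetricalTunnel (F K G H : ℝ) (M₁ : PreMetricalCorrespondence.{u, v, w})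
    (M₂ : PreMetricalCorrespondence.{u, v, w}) where
  P : PreMetricalCorrespondence.{u, v, w}
  isMetrical : P.IsMetrical F K G H
  iso₁ : ModularQuantumIsometry P M₁
  iso₂ : ModularQuantumIsometry P M₂

namespace MetricalTunnel

variable {F K G H : ℝ} {M₁ M₂ : PreMetricalCorrespondence.{u, v, w}}

/-- The reversed tunnel. -/
def symm (τ : MetricalTunnel F K G H M₁ M₂) : MetricalTunnel F K G H M₂ M₁ :=
  ⟨τ.P, τ.isMetrical, τ.iso₂, τ.iso₁⟩

end MetricalTunnel

/-- `{φ ∘ π | φ a state of A}`, as a set of functionals on `D`. -/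
def pullbackStates {D A : Type*} [CStarAlgebra D] [CStarAlgebra A] (π : D →⋆ₐ[ℂ] A) :
    Set (WeakDual ℂ D) :=
  {χ | ∃ φ ∈ stateSpace A, ∀ d, χ d = φ (π d)}

/-- The part of the extent of a tunnel that comes from one of its two quantum isometries. -/
def ModularQuantumIsometry.extent {P : PreMetricalCorrespondence.{u, v, w}}
    {Q : PreMetricalCorrespondence.{u', v', w'}} (f : ModularQuantumIsometry P Q) : ℝ≥0∞ :=
  max (hausdorffDistOf (mongeKantorovich P.lipA) (pullbackStates f.mapA) (stateSpace P.A))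
    (hausdorffDistOf (mongeKantorovich P.lipB) (pullbackStates f.mapB) (stateSpace P.B))

namespace PreMetricalCorrespondence

variable (P : PreMetricalCorrespondence.{u, v, w})

/-- The pseudo-states `ξ ↦ μ (⟨ω, ξ⟩)` with `μ` a state of `B` and `dnorm ω ≤ 1`. -/
def pseudoStates : Set (P.M →L[ℂ] ℂ) :=
  {φ | ∃ μ ∈ stateSpace P.B, ∃ ω, P.dnorm ω ≤ 1 ∧ ∀ ξ, φ ξ = μ (P.ip ω ξ)}

/-- The Monge-Kantorovich distance of the D-norm. -/
def dualDist (φ ψ : P.M →L[ℂ] ℂ) : ℝ≥0∞ :=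
  ⨆ (ξ : P.M) (_ : P.dnorm ξ ≤ 1), ‖φ ξ - ψ ξ‖ₑ

/-- The Monge-Kantorovich distance between families of functionals. -/
def familyDist {J : Type*} (φ ψ : J → P.M →L[ℂ] ℂ) : ℝ≥0∞ :=
  ⨆ j, P.dualDist (φ j) (ψ j)

end PreMetricalCorrespondence

namespace MetricalTunnel

variable {F K G H : ℝ} {M₁ M₂ : PreMetricalCorrespondence.{u, v, w}}

/-- The extent of a tunnel. -/
def extent (τ : MetricalTunnel F K G H M₁ M₂) : ℝ≥0∞ :=
  max τ.iso₁.extent τ.iso₂.extent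

/-- The separation of two families of operators according to a tunnel. -/
def separation (τ : MetricalTunnel F K G H M₁ M₂) {J : Type*}
    (a : J → M₁.M →L[ℂ] M₁.M) (b : J → M₂.M →L[ℂ] M₂.M) : ℝ≥0∞ :=
  hausdorffDistOf τ.P.familyDist
    {χ | ∃ φ ∈ M₁.pseudoStates, χ = fun j => φ ∘L a j ∘L τ.iso₁.mapM}
    {χ | ∃ ψ ∈ M₂.pseudoStates, χ = fun j => ψ ∘L b j ∘L τ.iso₂.mapM}

/-- The dispersion of two families of operators according to a tunnel. -/
def dispersion (τ : MetricalTunnel F K G H M₁ M₂) {J : Type*}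
    (a : J → M₁.M →L[ℂ] M₁.M) (b : J → M₂.M →L[ℂ] M₂.M) : ℝ≥0∞ :=
  max τ.extent (τ.separation a b)

end MetricalTunnel

/-! ### Spectral triples -/

section Dirac

variable {H : Type*} [NormedAddCommGroup H] [InnerProductSpace ℂ H]

/-- The operator norm of `[D, a]` when `a` maps the domain of `D` to itself and `[D, a]` is
bounded there, and `∞` otherwise. -/
def commutatorNorm (D : H →ₗ.[ℂ] H) (a : H →L[ℂ] H) : ℝ≥0∞ :=
  ⨅ (C : ℝ≥0) (_ : ∀ ξ : D.domain, ∃ h : a ξ ∈ D.domain,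
    ‖D ⟨a ξ, h⟩ - a (D ξ)‖ ≤ C * ‖(ξ : H)‖), (C : ℝ≥0∞)

open scoped Classical in
/-- The graph norm `‖ξ‖ + ‖D ξ‖`, extended by `∞` off the domain of `D`. -/
def graphNorm (D : H →ₗ.[ℂ] H) (ξ : H) : ℝ≥0∞ :=
  if h : ξ ∈ D.domain then ‖ξ‖ₑ + ‖D ⟨ξ, h⟩‖ₑ else ∞

/-- The eigenspace of `D` for `s`: the vectors `ξ` in the domain of `D` with `D ξ = s ξ`. -/
def diracEigenspace (D : H →ₗ.[ℂ] H) (s : ℝ) : Submodule ℂ H :=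
  D.graph.comap (LinearMap.prod LinearMap.id ((s : ℂ) • LinearMap.id))

theorem mem_diracEigenspace {D : H →ₗ.[ℂ] H} {s : ℝ} {ξ : H} :
    ξ ∈ diracEigenspace D s ↔ ∃ h : ξ ∈ D.domain, D ⟨ξ, h⟩ = (s : ℂ) • ξ := by
  simp [diracEigenspace, LinearPMap.mem_graph_iff]

variable [CompleteSpace H]

theorem isClosed_diracEigenspace {D : H →ₗ.[ℂ] H} (hD : IsSelfAdjoint D) (s : ℝ) :
    IsClosed (diracEigenspace D s : Set H) := by
  have h : IsClosed (D.graph : Set (H × H)) := hD.isClosed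
  exact h.preimage (f := fun ξ : H => (ξ, (s : ℂ) • ξ)) (by fun_prop)

theorem orthogonalFamily_diracEigenspace {D : H →ₗ.[ℂ] H} (hD : IsSelfAdjoint D) :
    OrthogonalFamily ℂ (fun s : ℝ => diracEigenspace D s)
      (fun s => (diracEigenspace D s).subtypeₗᵢ) := by
  intro s t hst x y
  obtain ⟨hx, hx'⟩ := mem_diracEigenspace.1 x.2
  obtain ⟨hy, hy'⟩ := mem_diracEigenspace.1 y.2
  have key : inner ℂ (D ⟨x, hx⟩) (y : H) = inner ℂ (x : H) (D ⟨y, hy⟩) := by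
    have h := LinearPMap.adjoint_isFormalAdjoint hD.dense_domain
    rw [LinearPMap.isSelfAdjoint_def.1 hD] at h
    exact h ⟨x, hx⟩ ⟨y, hy⟩
  rw [hx', hy', inner_smul_left, inner_smul_right, Complex.conj_ofReal] at key
  have h0 : ((s : ℂ) - t) * inner ℂ (x : H) (y : H) = 0 := by rw [sub_mul, key, sub_self]
  rcases mul_eq_zero.1 h0 with h | h
  · exact absurd (by exact_mod_cast sub_eq_zero.1 h) hst
  · simpa using h

end Dirac

theorem norm_exp_I_mul (t s : ℝ) : ‖Complex.exp (Complex.I * t * s)‖ = 1 := by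
  rw [mul_assoc, mul_comm, ← Complex.ofReal_mul]
  exact Complex.norm_exp_ofReal_mul_I _

/-- Multiplication of the component of index `s` by `exp (i t s)` in a Hilbert sum. -/
def phaseRotation {E : ℝ → Type*} [∀ s, NormedAddCommGroup (E s)]
    [∀ s, InnerProductSpace ℂ (E s)] (t : ℝ) : lp E 2 →L[ℂ] lp E 2 :=
  LinearMap.mkContinuous
    { toFun := fun f => ⟨fun s => Complex.exp (Complex.I * t * s) • f s,
        (lp.memℓp f).mono' fun s => by rw [norm_smul, norm_exp_I_mul, one_mul]⟩
      map_add' := fun f g => lp.ext (funext fun s => smul_add _ (f s) (g s))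
      map_smul' := fun c f => lp.ext (funext fun s => smul_comm _ c (f s)) }
    1 (fun f => by
      rw [one_mul]
      refine lp.norm_mono (by norm_num) fun s => ?_
      change ‖Complex.exp (Complex.I * t * s) • f s‖ ≤ ‖f s‖
      rw [norm_smul, norm_exp_I_mul, one_mul])

/-- The unitary `exp (i t D)` of a self-adjoint operator `D` with compact resolvent. Such an
operator is `∑ s P_s`, with `P_s` the orthogonal projection onto the eigenspace of `D` for the real
number `s`, and `H` is the Hilbert sum of these eigenspaces; so `exp (i t D) = ∑ exp (i t s) P_s`.
Here the adjoint of the isometry `lp E 2 → H` sends `ξ` to the family of all `P_s ξ`. -/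
def diracGroup {H : Type*} [NormedAddCommGroup H] [InnerProductSpace ℂ H] [CompleteSpace H]
    (D : H →ₗ.[ℂ] H) (hD : IsSelfAdjoint D) (t : ℝ) : H →L[ℂ] H :=
  haveI : ∀ s : ℝ, CompleteSpace (diracEigenspace D s) := fun s =>
    (isClosed_diracEigenspace hD s).completeSpace_coe
  let V := (orthogonalFamily_diracEigenspace hD).linearIsometry.toContinuousLinearMap
  V ∘L phaseRotation t ∘L ContinuousLinearMap.adjoint V

/-- A spectral triple `(A, H, D)`: a self-adjoint operator `D` with compact resolvent on a Hilbert
space `H` carrying a unital representation `rep` of a unital C⋆-algebra `A`, such that the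
self-adjoint `a` that preserve the domain of `D` and have a bounded commutator with `D` are dense
among the self-adjoint elements of `A`. -/
structure SpectralTriple where
  A : Type u
  H : Type v
  [cstarA : CStarAlgebra A]
  [nontrivialA : Nontrivial A]
  [groupH : NormedAddCommGroup H]
  [innerH : InnerProductSpace ℂ H]
  [completeH : CompleteSpace H]
  rep : A →⋆ₐ[ℂ] (H →L[ℂ] H)
  D : H →ₗ.[ℂ] H
  isSelfAdjoint : IsSelfAdjoint D
  compact_resolvent : ∃ R : H →L[ℂ] H, IsCompactOperator R ∧
    (∀ ξ : D.domain, R (D ξ + Complex.I • (ξ : H)) = ξ) ∧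
    ∀ η : H, ∃ h : R η ∈ D.domain, D ⟨R η, h⟩ + Complex.I • R η = η
  dense_smooth : Dense {a : selfAdjoint A | commutatorNorm D (rep (a : A)) < ∞}

attribute [instance] SpectralTriple.cstarA SpectralTriple.nontrivialA SpectralTriple.groupH
  SpectralTriple.innerH SpectralTriple.completeH

namespace SpectralTriple

variable (T : SpectralTriple.{u, v})

/-- The seminorm `a ↦ ‖[D, a]‖`, extended by `∞`. -/
def lip (a : selfAdjoint T.A) : ℝ≥0∞ :=
  commutatorNorm T.D (T.rep (a : T.A))

/-- The unitary group `t ↦ exp (i t D)`. -/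
def U (t : ℝ) : T.H →L[ℂ] T.H :=
  diracGroup T.D T.isSelfAdjoint t

/-- `(H, graph norm of D, A, ‖[D, ·]‖, ℂ, 0)`. -/
def toMetrical : PreMetricalCorrespondence.{u, v, 0} where
  A := T.A
  M := T.H
  B := ℂ
  ract ξ z := z • ξ
  ract_add ω b c := add_smul b c ω
  add_ract ω η b := smul_add b ω η
  ract_mul ω b c := by rw [mul_comm, mul_smul]
  ract_one ω := one_smul ℂ ω
  ip ξ η := inner ℂ ξ η
  ip_add_right ω η ζ := inner_add_right ω η ζ
  ip_smul_right ω z η := by rw [inner_smul_right, smul_eq_mul]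
  ip_ract ω η b := by rw [inner_smul_right, mul_comm]
  ip_star ω η := (inner_conj_symm ω η).symm
  ip_nonneg ω := ⟨(‖ω‖ : ℂ), by
    rw [inner_self_eq_norm_sq_to_K, sq]
    simp⟩
  ip_self_eq_zero ω := inner_self_eq_zero
  norm_eq ω := by
    rw [inner_self_eq_norm_sq_to_K]
    simp
  lact := T.rep.toAlgHom
  lact_ract a ω b := map_smul (T.rep a) b ω
  lact_adjoint a ω η := by
    change inner ℂ (T.rep a ω) η = inner ℂ ω (T.rep (star a) η)
    rw [map_star, ContinuousLinearMap.star_eq_adjoint, ContinuousLinearMap.adjoint_inner_right]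
  lipA := T.lip
  lipB := 0
  dnorm := graphNorm T.D

/-- A spectral triple is metric when `(A, ‖[D, ·]‖)` is a quantum compact metric space. -/
def IsMetric : Prop :=
  IsQuantumCompactMetricSpace 1 0 T.lip

end SpectralTriple

/-- Unitary equivalence of spectral triples. -/
def SpectralTriple.UnitarilyEquivalent (T₁ T₂ : SpectralTriple.{u, v}) : Prop :=
  ∃ (V : T₁.H ≃ₗᵢ[ℂ] T₂.H) (π : T₁.A ≃⋆ₐ[ℂ] T₂.A),
    T₁.D.domain.map (V : T₁.H →ₗ[ℂ] T₂.H) = T₂.D.domain ∧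
    (∀ (ξ : T₁.D.domain) (η : T₂.D.domain), V ξ = η → V (T₁.D ξ) = T₂.D η) ∧
    ∀ a ξ, T₂.rep (π a) (V ξ) = V (T₁.rep a ξ)

/-- Metric spectral triples. -/
structure MetricSpectralTriple extends SpectralTriple.{u, v} where
  isMetric : toSpectralTriple.IsMetric

/-! ### The spectral propinquity and its variant without iso-isos -/

/-- A tunnel between two spectral triples. -/
abbrev SpectralTunnel (F K G H : ℝ) (T₁ T₂ : SpectralTriple.{u, v}) :=
  MetricalTunnel F K G H T₁.toMetrical T₂.toMetrical

/-- The interval `[0, 1/ε]`. -/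
def timeInterval (ε : ℝ) : Set ℝ≥0 := {t | (t : ℝ) ≤ 1 / ε}

/-- `(ς₁, ς₂)` is an `ε`-iso-iso of `[0, ∞)`. -/
structure IsIsoIso (ε : ℝ) (ς₁ ς₂ : ℝ≥0 → ℝ≥0) : Prop where
  map_zero₁ : ς₁ 0 = 0
  map_zero₂ : ς₂ 0 = 0
  dist_lt₁ : ∀ x ∈ timeInterval ε, ∀ y ∈ timeInterval ε, ∀ z ∈ timeInterval ε,
    |(|(ς₁ x + ς₁ y - z : ℝ)| - |(x + y - ς₂ z : ℝ)|)| < ε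
  dist_lt₂ : ∀ x ∈ timeInterval ε, ∀ y ∈ timeInterval ε, ∀ z ∈ timeInterval ε,
    |(|(ς₂ x + ς₂ y - z : ℝ)| - |(x + y - ς₁ z : ℝ)|)| < ε

section Propinquity

variable {F K G H : ℝ} {T₁ T₂ : SpectralTriple.{u, v}}

/-- For a time change `ς`, the one-sided Hausdorff distance from the set of all
`(⟨U₁^{-t} ξ, Π₁ ·⟩)_t` to the set of all `(⟨U₂^{-ς t} η, Π₂ ·⟩)_t`, with `t` in `[0, 1/ε]` and
`ξ`, `η` in the unit balls of the graph norms. -/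
def SpectralTunnel.halfReach (τ : SpectralTunnel F K G H T₁ T₂) (ε : ℝ) (ς : ℝ≥0 → ℝ≥0) :
    ℝ≥0∞ :=
  hausdorffExcess τ.P.familyDist
    {χ | ∃ ξ : T₁.H, graphNorm T₁.D ξ ≤ 1 ∧ χ = fun t : timeInterval ε =>
      innerSL ℂ (T₁.U (-(t : ℝ≥0)) ξ) ∘L (τ.iso₁.mapM : τ.P.M →L[ℂ] T₁.H)}
    {χ | ∃ η : T₂.H, graphNorm T₂.D η ≤ 1 ∧ χ = fun t : timeInterval ε =>
      innerSL ℂ (T₂.U (-(ς t)) η) ∘L (τ.iso₂.mapM : τ.P.M →L[ℂ] T₂.H)}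

/-- The `ε`-reach of a tunnel and a pair of time changes. -/
def SpectralTunnel.reach (τ : SpectralTunnel F K G H T₁ T₂) (ε : ℝ) (ς₁ ς₂ : ℝ≥0 → ℝ≥0) :
    ℝ≥0∞ :=
  max (SpectralTunnel.halfReach τ ε ς₁) (SpectralTunnel.halfReach (MetricalTunnel.symm τ) ε ς₂)

/-- The `ε`-magnitude of a tunnel and a pair of time changes. -/
def SpectralTunnel.magnitude (τ : SpectralTunnel F K G H T₁ T₂) (ε : ℝ) (ς₁ ς₂ : ℝ≥0 → ℝ≥0) :
    ℝ≥0∞ :=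
  max (MetricalTunnel.extent τ) (SpectralTunnel.reach τ ε ς₁ ς₂)

/-- The spectral propinquity `Λ`, for tunnels of type `(F, K, G, H)`. -/
def spectralPropinquity (F K G H : ℝ) (T₁ T₂ : MetricSpectralTriple.{u, v}) : ℝ :=
  sInf ({√2 / 2} ∪ {ε : ℝ | 0 < ε ∧
    ∃ (τ : SpectralTunnel F K G H T₁.toSpectralTriple T₂.toSpectralTriple) (ς₁ ς₂ : ℝ≥0 → ℝ≥0),
      IsIsoIso ε ς₁ ς₂ ∧ SpectralTunnel.magnitude τ ε ς₁ ς₂ < ENNReal.ofReal ε})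

/-- The variant `Λ*` of the spectral propinquity, defined by the dispersion of the unitary groups
on `[0, 1/ε]`, for tunnels of type `(F, K, G, H)`. -/
def spectralPropinquityStar (F K G H : ℝ) (T₁ T₂ : MetricSpectralTriple.{u, v}) : ℝ :=
  sInf ({√2 / 2} ∪ {ε : ℝ | 0 < ε ∧
    ∃ τ : SpectralTunnel F K G H T₁.toSpectralTriple T₂.toSpectralTriple,
      MetricalTunnel.dispersion τ (fun t : timeInterval ε => T₁.U (t : ℝ≥0))
        (fun t : timeInterval ε => T₂.U (t : ℝ≥0)) < ENNReal.ofReal ε})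

end Propinquity

end

/-! ### States -/

section States

variable {A : Type*} [CStarAlgebra A]

/-! Every part of the theorem is read off from the data of `DispersionWithin`. The states that
factor through either end of a tunnel are `r`-dense, and every vector `ξ` of graph norm at most one
at one end has a partner `η` at the other end such that `⟨ξ, U₁^t Π₁ ·⟩` and `⟨η, U₂^t Π₂ ·⟩` differ
by at most `r` on the unit D-ball. The partner is the same for all times `t` of the interval.

Comparison with `Λ`. Since `⟨U^{-t} ξ, ·⟩ = ⟨ξ, U^t ·⟩`, the identity used as iso-iso turns
dispersion into magnitude, whence `Λ ≤ Λ*`. Conversely an `ε`-iso-iso stays within `ε` of the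
identity on `[0, 1/ε]` (`IsIsoIso.abs_sub_le`), and `t ↦ U^t η` is 1-Lipschitz when `η` has graph
norm at most one (`norm_diracGroup_sub_le`). Dropping the time change therefore costs at most `ε`,
which gives the factor two.

Triangle inequality. Two tunnels with a common end are glued on the direct product, with `max (L₁,
L₂, ε⁻¹ ‖π₁ d₁ - π₂ d₂‖)` as seminorm and the analogous D-norm. The coupling term is a difference of
morphisms, so it satisfies Leibniz inequalities with constants 1, 1 and 2, within the allowed `F`,
`G`, `H`. Rieffel's criterion `of_isCompact` shows that the glued seminorm is again a Lipschitz
seminorm. Extents and dispersions add up to the arbitrarily small gluing parameter, and the interval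
for `ε₁ + ε₂` lies in those for `ε₁` and `ε₂`.

Distance zero. A unitary equivalence is itself a tunnel of dispersion zero. Conversely, take tunnels
with dispersion tending to zero and an ultrafilter on the indices. The limits of the pairs `(Π₁ ωₙ,
Π₂ ωₙ)` with bounded D-norms form a linear relation (`limitRelation`). It preserves norms because
the two characters of the base algebra given by the ends become equal in the limit, and it is dense
on both sides because the graph norm balls are compact; so it lies in the graph of a unitary `V`.
Lifting Lipschitz elements to the tunnels, and using compactness at the other end, shows that `V`
intertwines the algebras, whose representations are faithful when the Hilbert spaces are nonzero.
Limits of partner vectors show that `V` intertwines the unitary groups, first at `t = 0`, which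
identifies the partner of `ξ` with `V ξ`, and then for every `t ≥ 0`.

The groups are defined by eigenspaces, so all of this rests on the totality of the eigenvectors of a
self-adjoint operator with compact resolvent (`orthogonal_iSup_diracEigenspace`). -/

theorem exists_star_mul_self_eq_norm_add (a : selfAdjoint A) :
    ∃ b : A, ((‖(a : A)‖ : ℂ) • (1 : A)) + a = star b * b := by
  let := CStarAlgebra.spectralOrder A
  have := CStarAlgebra.spectralOrderedRing A
  have h := IsSelfAdjoint.neg_algebraMap_norm_le_self (a := (a : A)) a.2
  rw [neg_le_iff_add_nonneg', CStarAlgebra.nonneg_iff_eq_star_mul_self] at h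
  obtain ⟨b, hb⟩ := h
  refine ⟨b, ?_⟩
  rw [← hb, Algebra.algebraMap_eq_smul_one, Complex.coe_smul]

theorem stateSpace_nonneg_norm_add {φ : WeakDual ℂ A} (hφ : φ ∈ stateSpace A)
    (a : selfAdjoint A) : 0 ≤ (‖(a : A)‖ : ℂ) + φ (a : A) := by
  obtain ⟨b, hb⟩ := exists_star_mul_self_eq_norm_add a
  have := hφ.2 b
  rwa [← hb, map_add, map_smul, hφ.1, smul_eq_mul, mul_one] at this

/-- In the order of `ℂ` a nonnegative number is real, so positivity of `‖a‖ + φ a` already removes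
the imaginary part. -/
theorem stateSpace_apply_im {φ : WeakDual ℂ A} (hφ : φ ∈ stateSpace A)
    (a : selfAdjoint A) : (φ (a : A)).im = 0 := by
  have h := stateSpace_nonneg_norm_add hφ a
  rw [Complex.nonneg_iff] at h
  simpa using h.2.symm

theorem stateSpace_norm_apply_le {φ : WeakDual ℂ A} (hφ : φ ∈ stateSpace A)
    (a : selfAdjoint A) : ‖φ (a : A)‖ ≤ ‖(a : A)‖ := by
  have h1 := stateSpace_nonneg_norm_add hφ a
  have h2 := stateSpace_nonneg_norm_add hφ (-a)
  have h3 := stateSpace_apply_im hφ a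
  rw [Complex.nonneg_iff] at h1 h2
  have h4 : φ (a : A) = ((φ (a : A)).re : ℂ) := by
    apply Complex.ext <;> simp [h3]
  rw [h4, Complex.norm_real, Real.norm_eq_abs, abs_le]
  simp at h1 h2
  constructor <;> linarith [h1.1, h2.1]

theorem stateSpace_apply_decomp (φ : WeakDual ℂ A) (x : A) :
    φ x = φ (ℜ x : A) + Complex.I * φ (ℑ x : A) := by
  conv_lhs => rw [← realPart_add_I_smul_imaginaryPart x]
  rw [map_add, map_smul, smul_eq_mul]

/-- The crude constant 2 comes from real and imaginary parts; any constant would place the states in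
a ball, as Banach-Alaoglu requires. -/
theorem stateSpace_norm_apply_le_two {φ : WeakDual ℂ A} (hφ : φ ∈ stateSpace A) (x : A) :
    ‖φ x‖ ≤ 2 * ‖x‖ := by
  rw [stateSpace_apply_decomp]
  refine (norm_add_le _ _).trans ?_
  rw [norm_mul, Complex.norm_I, one_mul, two_mul]
  exact add_le_add ((stateSpace_norm_apply_le hφ _).trans (realPart.norm_le x))
    ((stateSpace_norm_apply_le hφ _).trans (imaginaryPart.norm_le x))

theorem stateSpace_ext_selfAdjoint {φ ψ : WeakDual ℂ A}
    (h : ∀ a : selfAdjoint A, φ (a : A) = ψ (a : A)) : φ = ψ := by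
  refine DFunLike.ext _ _ fun x => ?_
  rw [stateSpace_apply_decomp, stateSpace_apply_decomp ψ, h, h]

theorem isClosed_stateSpace : IsClosed (stateSpace A) := by
  have : stateSpace A = {φ : WeakDual ℂ A | φ 1 = 1} ∩ ⋂ a : A, {φ | 0 ≤ φ (star a * a)} := by
    ext φ; simp [stateSpace]
  rw [this]
  refine (isClosed_eq (WeakDual.eval_continuous _) continuous_const).inter
    (isClosed_iInter fun a => ?_)
  exact isClosed_le continuous_const (WeakDual.eval_continuous _)

theorem isCompact_stateSpace : IsCompact (stateSpace A) := by
  refine (WeakDual.isCompact_closedBall (𝕜 := ℂ) (E := A) 0 2).of_isClosed_subset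
    isClosed_stateSpace fun φ hφ => ?_
  simp only [Set.mem_preimage, mem_closedBall_zero_iff]
  exact ContinuousLinearMap.opNorm_le_bound _ (by norm_num) (stateSpace_norm_apply_le_two hφ)

/-- An element of a C⋆-algebra that is not positive is negative in some state. -/
theorem exists_state_re_neg (a : selfAdjoint A) (ha : ¬ ∃ b : A, (a : A) = star b * b) :
    ∃ φ ∈ stateSpace A, (φ (a : A)).re < 0 := by
  let := CStarAlgebra.spectralOrder A
  have := CStarAlgebra.spectralOrderedRing A
  have ha' : ¬ 0 ≤ (a : A) := fun h => ha (CStarAlgebra.nonneg_iff_eq_star_mul_self.1 h)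
  let C : ProperCone ℝ (selfAdjoint A) :=
    { carrier := {x | 0 ≤ (x : A)}
      add_mem' := fun {x y} hx hy => by
        change 0 ≤ ((x + y : selfAdjoint A) : A)
        exact add_nonneg hx hy
      zero_mem' := le_refl (0 : A)
      smul_mem' := fun r x hx => by
        change 0 ≤ (((r : ℝ) • x : selfAdjoint A) : A)
        exact smul_nonneg r.2 hx
      isClosed' := CStarAlgebra.isClosed_nonneg.preimage continuous_subtype_val }
  -- A functional that is nonnegative on the closed cone of positive elements and negative at `a`;
  -- once normalized it is the required state.
  obtain ⟨f, hf, hfa⟩ := C.hyperplane_separation_point (x₀ := a) ha'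
  -- As `‖a‖ + a` is positive and `f a < 0`, the number `‖a‖ * f 1` is positive.
  have hf1 : 0 < f 1 := by
    obtain ⟨b, hb⟩ := exists_star_mul_self_eq_norm_add a
    have h1 : (‖(a : A)‖ • (1 : selfAdjoint A) + a) ∈ C := by
      change 0 ≤ ((‖(a : A)‖ • (1 : selfAdjoint A) + a : selfAdjoint A) : A)
      rw [CStarAlgebra.nonneg_iff_eq_star_mul_self]
      exact ⟨b, by rw [← hb, Complex.coe_smul]; rfl⟩
    have h2 := hf _ h1
    rw [map_add, map_smul, smul_eq_mul] at h2
    have h3 : 0 < ‖(a : A)‖ * f 1 := by linarith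
    exact pos_of_mul_pos_right h3 (norm_nonneg _)
  -- The real functional on self-adjoint elements is composed with the real part and then
  -- complexified.
  let re : A →L[ℝ] selfAdjoint A := LinearMap.mkContinuous realPart 1
    (fun x => by rw [one_mul]; exact realPart.norm_le x)
  let g : A →L[ℝ] ℝ := (f 1)⁻¹ • (f ∘L re)
  let φ : WeakDual ℂ A := StrongDual.toWeakDual (StrongDual.extendRCLike (𝕜 := ℂ) g)
  have hφ : ∀ x : selfAdjoint A, φ (x : A) = (((f 1)⁻¹ * f x : ℝ) : ℂ) := by
    intro x
    have e1 : g (x : A) = (f 1)⁻¹ * f x := by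
      change (f 1)⁻¹ * f (ℜ (x : A)) = _
      congr 2
      exact Subtype.ext (IsSelfAdjoint.coe_realPart x.2)
    have e2 : g (Complex.I • (x : A)) = 0 := by
      change (f 1)⁻¹ * f (ℜ (Complex.I • (x : A))) = _
      rw [realPart_I_smul, IsSelfAdjoint.imaginaryPart x.2]; simp
    change StrongDual.extendRCLike (𝕜 := ℂ) g (x : A) = _
    rw [StrongDual.extendRCLike_apply]
    have e2' : g ((RCLike.I : ℂ) • (x : A)) = 0 := e2
    rw [e2', e1]; simp
  refine ⟨φ, ⟨?_, fun b => ?_⟩, ?_⟩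
  · have := hφ 1
    rw [inv_mul_cancel₀ hf1.ne'] at this
    simpa using this
  · have h0 : (⟨star b * b, IsSelfAdjoint.star_mul_self b⟩ : selfAdjoint A) ∈ C :=
      star_mul_self_nonneg b
    have h1 := hf _ h0
    have h2 := hφ ⟨star b * b, IsSelfAdjoint.star_mul_self b⟩
    simp only at h2
    rw [h2]
    exact_mod_cast mul_nonneg (inv_nonneg.2 hf1.le) h1
  · rw [hφ, Complex.ofReal_re]
    exact mul_neg_of_pos_of_neg (inv_pos.2 hf1) hfa

/-- The norm of a self-adjoint element is determined by its values in states. -/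
theorem norm_le_of_forall_state {a : selfAdjoint A} {r : ℝ} (hr : 0 ≤ r)
    (h : ∀ φ ∈ stateSpace A, ‖φ (a : A)‖ ≤ r) : ‖(a : A)‖ ≤ r := by
  let := CStarAlgebra.spectralOrder A
  have := CStarAlgebra.spectralOrderedRing A
  -- In the zero algebra the spectrum is empty, so the spectral argument below needs a nonzero
  -- algebra.
  rcases subsingleton_or_nontrivial A with hA | hA
  · rw [Subsingleton.elim (a : A) 0, norm_zero]; exact hr
  have key : ∀ b : selfAdjoint A, (∀ φ ∈ stateSpace A, ‖φ (b : A)‖ ≤ r) →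
      algebraMap ℝ A (-r) ≤ b := by
    intro b hb
    by_contra hlt
    have hneg : ¬ ∃ c : A, ((r • (1 : selfAdjoint A) + b : selfAdjoint A) : A) = star c * c := by
      rw [← CStarAlgebra.nonneg_iff_eq_star_mul_self]
      intro h0
      apply hlt
      rw [map_neg, neg_le_iff_add_nonneg', Algebra.algebraMap_eq_smul_one]
      exact h0
    obtain ⟨φ, hφ, h1⟩ := exists_state_re_neg _ hneg
    have e : φ ((r • (1 : selfAdjoint A) + b : selfAdjoint A) : A) = (r : ℂ) + φ (b : A) := by
      have : ((r • (1 : selfAdjoint A) + b : selfAdjoint A) : A) = (r : ℂ) • (1 : A) + b := by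
        rw [Complex.coe_smul]; rfl
      rw [this, map_add, map_smul, hφ.1, smul_eq_mul, mul_one]
    rw [e, Complex.add_re, Complex.ofReal_re] at h1
    have h2 := (Complex.abs_re_le_norm _).trans (hb φ hφ)
    linarith [(abs_le.1 h2).1]
  have h1 := key a h
  have h2 := key (-a) (fun φ hφ => by
    have e : φ ((-a : selfAdjoint A) : A) = -φ (a : A) := map_neg φ _
    rw [e, norm_neg]; exact h φ hφ)
  have h3 : (a : A) ≤ algebraMap ℝ A r := by
    rw [← neg_le_neg_iff, ← map_neg]; exact h2
  -- One of `‖a‖` and `-‖a‖` lies in the spectrum, which is now confined to `[-r, r]`.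
  rcases CStarAlgebra.norm_or_neg_norm_mem_spectrum (a := (a : A)) a.2 with h4 | h4
  · exact (le_algebraMap_iff_spectrum_le (ha := a.2)).1 h3 _ h4
  · linarith [(algebraMap_le_iff_le_spectrum (ha := a.2)).1 h1 _ h4]

/-- Without states, the preceding bound would give `‖1‖ ≤ 0`. -/
theorem stateSpace_nonempty [Nontrivial A] : (stateSpace A).Nonempty := by
  by_contra h
  rw [Set.not_nonempty_iff_eq_empty] at h
  have := norm_le_of_forall_state (a := (1 : selfAdjoint A)) le_rfl (by simp [h])
  norm_num at this

/-- The state `φ ∘ π`. -/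
noncomputable def pullbackState {B : Type*} [CStarAlgebra B] (π : A →⋆ₐ[ℂ] B) (φ : WeakDual ℂ B) :
    WeakDual ℂ A :=
  StrongDual.toWeakDual ((WeakDual.toStrongDual φ) ∘L
    (LinearMap.mkContinuous ((π : A →ₐ[ℂ] B) : A →ₗ[ℂ] B) 1
      (fun x => by rw [one_mul]; exact NonUnitalStarAlgHom.norm_apply_le π x)))

@[simp]
theorem pullbackState_apply {B : Type*} [CStarAlgebra B] (π : A →⋆ₐ[ℂ] B) (φ : WeakDual ℂ B)
    (a : A) : pullbackState π φ a = φ (π a) := rfl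

theorem pullbackState_mem {B : Type*} [CStarAlgebra B] (π : A →⋆ₐ[ℂ] B) {φ : WeakDual ℂ B}
    (hφ : φ ∈ stateSpace B) : pullbackState π φ ∈ stateSpace A := by
  refine ⟨by rw [pullbackState_apply, map_one, hφ.1], fun a => ?_⟩
  rw [pullbackState_apply, map_mul, map_star]
  exact hφ.2 _

theorem pullbackStates_eq {B : Type*} [CStarAlgebra B] (π : A →⋆ₐ[ℂ] B) :
    pullbackStates π = pullbackState π '' stateSpace B := by
  ext χ
  constructor
  · rintro ⟨φ, hφ, h⟩
    exact ⟨φ, hφ, DFunLike.ext _ _ fun d => (h d).symm⟩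
  · rintro ⟨φ, hφ, rfl⟩
    exact ⟨φ, hφ, fun d => rfl⟩

theorem stateSpace_complex {φ : WeakDual ℂ ℂ} (hφ : φ ∈ stateSpace ℂ) (z : ℂ) : φ z = z := by
  have := map_smul φ z 1
  rwa [smul_eq_mul, mul_one, hφ.1, smul_eq_mul, mul_one] at this

end States

/-! ### Quantum compact metric spaces -/

section MongeKantorovich

variable {A : Type*} [CStarAlgebra A] {lip : selfAdjoint A → ℝ≥0∞}

theorem mongeKantorovich_comm (φ ψ : WeakDual ℂ A) :
    mongeKantorovich lip φ ψ = mongeKantorovich lip ψ φ := by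
  simp only [mongeKantorovich, ← enorm_neg (φ _ - ψ _), neg_sub]

theorem mongeKantorovich_triangle (φ ψ χ : WeakDual ℂ A) :
    mongeKantorovich lip φ χ ≤ mongeKantorovich lip φ ψ + mongeKantorovich lip ψ χ := by
  refine iSup₂_le fun a ha => ?_
  rw [← sub_add_sub_cancel (φ (a : A)) (ψ (a : A)) (χ (a : A))]
  exact (enorm_add_le _ _).trans
    (add_le_add (le_iSup₂_of_le a ha le_rfl) (le_iSup₂_of_le a ha le_rfl))

theorem mongeKantorovich_self (φ : WeakDual ℂ A) : mongeKantorovich lip φ φ = 0 := by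
  simp [mongeKantorovich]

/-- Homogeneity. Using a positive upper bound `l` in place of `lip a` avoids dividing by a seminorm
that may vanish. -/
theorem enorm_sub_le_mul_mongeKantorovich
    (hsmul : ∀ (r : ℝ) (a), lip (r • a) = ‖r‖ₑ * lip a) {l : ℝ} (hl : 0 < l)
    {a : selfAdjoint A} (ha : lip a ≤ ENNReal.ofReal l) (φ ψ : WeakDual ℂ A) :
    ‖φ (a : A) - ψ (a : A)‖ₑ ≤ ENNReal.ofReal l * mongeKantorovich lip φ ψ := by
  have h1 : lip (l⁻¹ • a) ≤ 1 := by
    rw [hsmul, Real.enorm_eq_ofReal (inv_nonneg.2 hl.le)]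
    calc _ ≤ ENNReal.ofReal l⁻¹ * ENNReal.ofReal l := by gcongr
      _ = 1 := by rw [← ENNReal.ofReal_mul (inv_nonneg.2 hl.le), inv_mul_cancel₀ hl.ne',
                    ENNReal.ofReal_one]
  have h2 : ‖φ ((l⁻¹ • a : selfAdjoint A) : A) - ψ ((l⁻¹ • a : selfAdjoint A) : A)‖ₑ
      ≤ mongeKantorovich lip φ ψ := le_iSup₂_of_le _ h1 le_rfl
  have e : (a : A) = (l : ℂ) • ((l⁻¹ • a : selfAdjoint A) : A) := by
    rw [Complex.coe_smul]
    change _ = l • l⁻¹ • (a : A)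
    rw [smul_smul, mul_inv_cancel₀ hl.ne', one_smul]
  rw [e, map_smul, map_smul, ← smul_sub, enorm_smul]
  have : ‖(l : ℂ)‖ₑ = ENNReal.ofReal l := by
    rw [← ofReal_norm, Complex.norm_real, Real.norm_of_nonneg hl.le]
  rw [this]
  gcongr

theorem enorm_le_ofReal_iff {E : Type*} [SeminormedAddCommGroup E] {x : E} {r : ℝ}
    (hr : 0 ≤ r) : ‖x‖ₑ ≤ ENNReal.ofReal r ↔ ‖x‖ ≤ r := by
  rw [← ofReal_norm, ENNReal.ofReal_le_ofReal_iff hr]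

theorem apply_sub_smul_one {φ : WeakDual ℂ A} (hφ : φ ∈ stateSpace A) (a : selfAdjoint A)
    (r : ℝ) : φ ((a - r • 1 : selfAdjoint A) : A) = φ (a : A) - r := by
  have : ((a - r • 1 : selfAdjoint A) : A) = (a : A) - (r : ℂ) • (1 : A) := by
    rw [Complex.coe_smul]; rfl
  rw [this, map_sub, map_smul, hφ.1, smul_eq_mul, mul_one]

end MongeKantorovich

namespace IsQuantumCompactMetricSpace

variable {A : Type*} [CStarAlgebra A] {lip : selfAdjoint A → ℝ≥0∞} {F K : ℝ}

theorem lip_neg (h : IsQuantumCompactMetricSpace F K lip) (a : selfAdjoint A) :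
    lip (-a) = lip a := by
  simpa using h.smul_eq (-1) a

theorem lip_sub_le (h : IsQuantumCompactMetricSpace F K lip) (a b : selfAdjoint A) :
    lip (a - b) ≤ lip a + lip b := by
  rw [sub_eq_add_neg, ← h.lip_neg b]
  exact h.add_le _ _

theorem lip_smul_one (h : IsQuantumCompactMetricSpace F K lip) (r : ℝ) : lip (r • 1) = 0 := by
  rw [h.smul_eq, h.lip_one, mul_zero]

theorem lip_sub_smul_one_le (h : IsQuantumCompactMetricSpace F K lip) (a : selfAdjoint A)
    (r : ℝ) : lip (a - r • 1) ≤ lip a := by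
  simpa [h.lip_smul_one] using h.lip_sub_le a (r • 1)

theorem isClosed_lip_le (h : IsQuantumCompactMetricSpace F K lip) {l : ℝ} (hl : 0 < l) :
    IsClosed {a | lip a ≤ ENNReal.ofReal l} := by
  have : {a | lip a ≤ ENNReal.ofReal l} = (fun a => l⁻¹ • a) ⁻¹' {a | lip a ≤ 1} := by
    ext a
    simp only [Set.mem_ofPred_eq, Set.mem_preimage]
    rw [h.smul_eq, Real.enorm_eq_ofReal (inv_nonneg.2 hl.le), ENNReal.ofReal_inv_of_pos hl,
      mul_comm, ← div_eq_mul_inv, ENNReal.div_le_iff (by simpa using hl) ENNReal.ofReal_ne_top,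
      one_mul]
  rw [this]
  exact h.isClosed_ball.preimage (continuous_const_smul _)

/-- The state space has finite diameter. -/
theorem exists_norm_sub_le (h : IsQuantumCompactMetricSpace F K lip) :
    ∃ R : ℝ, 0 < R ∧ ∀ a, lip a ≤ 1 → ∃ r : ℝ, ‖((a - r • 1 : selfAdjoint A) : A)‖ ≤ R := by
  -- The zero algebra has no states, and all its elements have norm zero.
  rcases (stateSpace A).eq_empty_or_nonempty with h0 | ⟨φ₀, hφ₀⟩
  · refine ⟨1, one_pos, fun a _ => ⟨0, ?_⟩⟩
    exact norm_le_of_forall_state zero_le_one (by simp [h0])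
  -- Unit balls of the Monge-Kantorovich distance are weak* neighbourhoods, so finitely many cover
  -- the compact state space. One plus the sum of the distances from `φ₀` to their centres bounds
  -- all distances to `φ₀`.
  obtain ⟨t, htS, ht⟩ := isCompact_stateSpace.elim_nhdsWithin_subcover
    (fun φ => {ψ | ψ ∈ stateSpace A ∧ mongeKantorovich lip φ ψ < 1})
    (fun φ hφ => (h.weakStar φ hφ).mem_of_mem one_pos)
  let M : ℝ≥0∞ := 1 + ∑ φ ∈ t, mongeKantorovich lip φ₀ φ
  have hM : M < ∞ := ENNReal.add_lt_top.2 ⟨ENNReal.one_lt_top,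
    ENNReal.sum_lt_top.2 fun φ hφ => h.finite _ hφ₀ _ (htS φ hφ)⟩
  have hM1 : 1 ≤ M.toReal := by
    rw [← ENNReal.toReal_one]
    exact ENNReal.toReal_mono hM.ne le_self_add
  have hmk : ∀ ψ ∈ stateSpace A, mongeKantorovich lip ψ φ₀ ≤ M := by
    intro ψ hψ
    obtain ⟨φ, hφ, hφψ⟩ := Set.mem_iUnion₂.1 (ht hψ)
    rw [mongeKantorovich_comm]
    refine (mongeKantorovich_triangle _ φ _).trans ?_
    rw [add_comm]
    exact add_le_add hφψ.2.le
      (Finset.single_le_sum (f := fun φ => mongeKantorovich lip φ₀ φ) (fun _ _ => zero_le) hφ)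
  refine ⟨M.toReal, by linarith, fun a ha => ⟨(φ₀ (a : A)).re, ?_⟩⟩
  refine norm_le_of_forall_state (by linarith) fun ψ hψ => ?_
  rw [apply_sub_smul_one hψ]
  have e : (((φ₀ (a : A)).re : ℝ) : ℂ) = φ₀ (a : A) :=
    Complex.ext (by simp) (by simp [stateSpace_apply_im hφ₀ a])
  rw [e, ← enorm_le_ofReal_iff (by linarith), ENNReal.ofReal_toReal hM.ne]
  exact (le_iSup₂_of_le a ha le_rfl).trans (hmk ψ hψ)

/-- Arzelà-Ascoli on the compact state space. Evaluation embeds self-adjoint elements isometrically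
into continuous functions, and a common Lipschitz bound makes them equicontinuous because the
Monge-Kantorovich distance induces the weak* topology. -/
theorem isCompact_lip_norm_le (h : IsQuantumCompactMetricSpace F K lip) {l : ℝ} (hl : 0 < l)
    (R : ℝ) : IsCompact {a : selfAdjoint A | lip a ≤ ENNReal.ofReal l ∧ ‖(a : A)‖ ≤ R} := by
  set B := {a : selfAdjoint A | lip a ≤ ENNReal.ofReal l ∧ ‖(a : A)‖ ≤ R} with hB
  have hclosed : IsClosed B :=
    (h.isClosed_lip_le hl).inter (isClosed_le (continuous_norm.comp continuous_subtype_val)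
      continuous_const)
  have : CompactSpace (stateSpace A) := isCompact_iff_compactSpace.1 isCompact_stateSpace
  let ev : selfAdjoint A → BoundedContinuousFunction (stateSpace A) ℂ := fun a =>
    BoundedContinuousFunction.mkOfCompact
      ⟨fun φ => (φ : WeakDual ℂ A) (a : A),
        (WeakDual.eval_continuous (a : A)).comp continuous_subtype_val⟩
  have hev : Isometry ev := by
    refine Isometry.of_dist_eq fun a b => ?_
    have hab : dist a b = ‖((a - b : selfAdjoint A) : A)‖ := by
      rw [dist_eq_norm]; rfl
    apply le_antisymm
    · rw [BoundedContinuousFunction.dist_le dist_nonneg]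
      intro φ
      rw [hab, dist_eq_norm]
      have : (ev a φ - ev b φ) = (φ : WeakDual ℂ A) ((a - b : selfAdjoint A) : A) :=
        (map_sub (φ : WeakDual ℂ A) (a : A) (b : A)).symm
      rw [this]
      exact stateSpace_norm_apply_le φ.2 _
    · rw [hab]
      refine norm_le_of_forall_state dist_nonneg fun φ hφ => ?_
      have := BoundedContinuousFunction.dist_coe_le_dist (f := ev a) (g := ev b) ⟨φ, hφ⟩
      rw [dist_eq_norm] at this
      have e : (ev a ⟨φ, hφ⟩ - ev b ⟨φ, hφ⟩) = φ ((a - b : selfAdjoint A) : A) :=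
        (map_sub φ (a : A) (b : A)).symm
      rwa [e] at this
  have hcomp : IsCompact (closure (ev '' B)) := by
    refine BoundedContinuousFunction.arzela_ascoli (Metric.closedBall 0 R)
      (isCompact_closedBall _ _) _ ?_ ?_
    · rintro _ φ ⟨a, ha, rfl⟩
      rw [mem_closedBall_zero_iff]
      exact (stateSpace_norm_apply_le φ.2 a).trans ha.2
    · intro φ
      rw [Metric.equicontinuousAt_iff_right]
      intro ε hε
      have hr : 0 < ENNReal.ofReal (ε / l) := by simpa using div_pos hε hl
      have h1 := (h.weakStar φ φ.2).mem_of_mem hr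
      filter_upwards [preimage_coe_mem_nhds_subtype.2 h1] with ψ hψ
      rintro ⟨_, a, ha, rfl⟩
      have h2 := (enorm_sub_le_mul_mongeKantorovich h.smul_eq hl ha.1 (φ : WeakDual ℂ A) ψ)
      have h3 : ‖(φ : WeakDual ℂ A) (a : A) - (ψ : WeakDual ℂ A) (a : A)‖ₑ < ENNReal.ofReal ε := by
        refine h2.trans_lt ?_
        have : ENNReal.ofReal ε = ENNReal.ofReal l * ENNReal.ofReal (ε / l) := by
          rw [← ENNReal.ofReal_mul hl.le, mul_div_cancel₀ _ hl.ne']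
        rw [this]
        exact ENNReal.mul_lt_mul_right (by simpa using hl) ENNReal.ofReal_ne_top hψ.2
      rw [← ofReal_norm, ENNReal.ofReal_lt_ofReal_iff hε] at h3
      rw [dist_eq_norm]
      exact h3
  have htb : TotallyBounded (ev '' B) := hcomp.totallyBounded.subset subset_closure
  have htb' : TotallyBounded B :=
    (totallyBounded_image_iff hev.isUniformInducing).1 htb
  have : CompleteSpace (selfAdjoint A) :=
    (isClosed_eq continuous_star continuous_id : IsClosed {x : A | star x = x}).completeSpace_coe
  exact htb'.isCompact_of_isClosed hclosed

/-- Rieffel's criterion. -/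
theorem of_isCompact (add_le : ∀ a b, lip (a + b) ≤ lip a + lip b)
    (smul_eq : ∀ (r : ℝ) (a), lip (r • a) = ‖r‖ₑ * lip a)
    (dense_dom : Dense {a | lip a < ∞}) (lip_one : lip 1 = 0)
    (leibniz : ∀ a b : selfAdjoint A, lip a < ∞ → lip b < ∞ →
      max (lip (ℜ ((a : A) * b))) (lip (ℑ ((a : A) * b))) ≤
        ENNReal.ofReal F * (lip a * ‖(b : A)‖ₑ + ‖(a : A)‖ₑ * lip b)
          + ENNReal.ofReal K * lip a * lip b)
    (isClosed_ball : IsClosed {a | lip a ≤ 1}) {C : Set (selfAdjoint A)} (hC : IsCompact C)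
    (hlC : ∀ a, lip a ≤ 1 → ∃ r : ℝ, a - r • 1 ∈ C) :
    IsQuantumCompactMetricSpace F K lip := by
  -- Approximating `a` within `δ / 2` by an element of the domain: the distance of states controls
  -- their values at every `a`, up to an error `δ`.
  have hdom : ∀ φ ∈ stateSpace A, ∀ a : selfAdjoint A, ∀ δ > 0, ∃ b : selfAdjoint A, ∃ l : ℝ,
      0 < l ∧ lip b ≤ ENNReal.ofReal l ∧ ∀ ψ ∈ stateSpace A,
        ‖φ (a : A) - ψ (a : A)‖ₑ ≤ ENNReal.ofReal δ +
          ENNReal.ofReal l * mongeKantorovich lip φ ψ := by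
    intro φ hφ a δ hδ
    obtain ⟨b, hb, hab⟩ := Metric.dense_iff.1 dense_dom a (δ / 2) (by positivity)
    have hab' : ‖((a - b : selfAdjoint A) : A)‖ < δ / 2 := by
      rw [Metric.mem_ball, dist_comm, dist_eq_norm] at hb
      exact hb
    have hl : lip b ≤ ENNReal.ofReal ((lip b).toReal + 1) := by
      rw [← ENNReal.ofReal_toReal (show lip b ≠ ∞ from ne_of_lt hab)]
      refine ENNReal.ofReal_le_ofReal ?_
      rw [ENNReal.toReal_ofReal ENNReal.toReal_nonneg]; linarith
    refine ⟨b, (lip b).toReal + 1, by positivity, hl, fun ψ hψ => ?_⟩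
    have e : φ (a : A) - ψ (a : A) = (φ ((a - b : selfAdjoint A) : A)
        - ψ ((a - b : selfAdjoint A) : A)) + (φ (b : A) - ψ (b : A)) := by
      have h1 : ∀ χ : WeakDual ℂ A, χ ((a - b : selfAdjoint A) : A) = χ (a : A) - χ (b : A) :=
        fun χ => map_sub χ _ _
      rw [h1, h1]; ring
    rw [e]
    refine (enorm_add_le _ _).trans (add_le_add ?_
      (enorm_sub_le_mul_mongeKantorovich smul_eq (by positivity) hl φ ψ))
    rw [enorm_le_ofReal_iff hδ.le]
    refine (norm_sub_le _ _).trans ?_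
    linarith [stateSpace_norm_apply_le hφ (a - b), stateSpace_norm_apply_le hψ (a - b)]
  refine ⟨add_le, smul_eq, dense_dom, lip_one, fun φ hφ ψ hψ => ?_, fun φ hφ ψ hψ h0 => ?_,
    fun φ hφ => ?_, leibniz, isClosed_ball⟩
  · obtain ⟨R, hR⟩ := hC.isBounded.exists_norm_le
    have : mongeKantorovich lip φ ψ ≤ ENNReal.ofReal (R + R) := by
      refine iSup₂_le fun a ha => ?_
      obtain ⟨r, hr⟩ := hlC a ha
      have h1 : ‖((a - r • 1 : selfAdjoint A) : A)‖ ≤ R := hR _ hr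
      have hR0 : 0 ≤ R := (norm_nonneg _).trans h1
      rw [enorm_le_ofReal_iff (by linarith)]
      have e : φ (a : A) - ψ (a : A) =
          φ ((a - r • 1 : selfAdjoint A) : A) - ψ ((a - r • 1 : selfAdjoint A) : A) := by
        rw [apply_sub_smul_one hφ, apply_sub_smul_one hψ]; ring
      rw [e]
      refine (norm_sub_le _ _).trans (add_le_add ((stateSpace_norm_apply_le hφ _).trans h1)
        ((stateSpace_norm_apply_le hψ _).trans h1))
    exact this.trans_lt ENNReal.ofReal_lt_top
  · refine stateSpace_ext_selfAdjoint fun a => ?_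
    rw [← sub_eq_zero, ← norm_le_zero_iff]
    refine le_of_forall_pos_le_add fun δ hδ => ?_
    obtain ⟨b, l, hl, hb, hbψ⟩ := hdom φ hφ a δ hδ
    have := hbψ ψ hψ
    rwa [h0, mul_zero, add_zero, enorm_le_ofReal_iff hδ.le, ← zero_add δ] at this
  -- The two topologies agree once the neighbourhood filters do. One inclusion uses compactness of
  -- `C`, the other density of the domain.
  · have key : 𝓝[stateSpace A] φ =
        (𝓝 0).comap (mongeKantorovich lip φ) ⊓ Filter.principal (stateSpace A) := by
      apply le_antisymm
      · refine le_inf ?_ inf_le_right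
        rw [← Filter.tendsto_iff_comap, ENNReal.tendsto_nhds_zero]
        intro r hr
        obtain ⟨δ, hδ, hδr⟩ : ∃ δ : ℝ, 0 < δ ∧ ENNReal.ofReal (δ + δ + δ) ≤ r := by
          rcases eq_or_ne r ∞ with rfl | hr'
          · exact ⟨1, one_pos, le_top⟩
          · refine ⟨r.toReal / 3, div_pos (ENNReal.toReal_pos hr.ne' hr') (by norm_num), ?_⟩
            rw [← ENNReal.ofReal_toReal hr']
            refine ENNReal.ofReal_le_ofReal ?_
            rw [ENNReal.toReal_ofReal ENNReal.toReal_nonneg]; linarith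
        -- A finite `δ`-net of `C` reduces closeness on the whole Lipschitz ball to finitely many
        -- weak* conditions. Passing to the net costs `δ` for each of the two states, and the net
        -- points a third `δ`.
        obtain ⟨t, htC, hct⟩ := hC.elim_nhds_subcover (fun k => Metric.ball k δ)
          (fun k _ => Metric.ball_mem_nhds k hδ)
        have hev : ∀ᶠ ψ in 𝓝[stateSpace A] φ, ∀ k ∈ t, ‖φ (k : A) - ψ (k : A)‖ < δ := by
          refine (Filter.eventually_all_finset t).2 fun k _ => ?_
          refine Filter.Eventually.filter_mono nhdsWithin_le_nhds ?_
          have hc : Continuous fun ψ : WeakDual ℂ A => ‖φ (k : A) - ψ (k : A)‖ :=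
            (continuous_const.sub (WeakDual.eval_continuous (k : A))).norm
          exact hc.continuousAt.eventually_lt continuousAt_const (by simpa using hδ)
        filter_upwards [hev, self_mem_nhdsWithin] with ψ hψ hψS
        refine le_trans (iSup₂_le fun a ha => ?_) hδr
        rw [enorm_le_ofReal_iff (by linarith)]
        obtain ⟨s, hs⟩ := hlC a ha
        obtain ⟨k, hk, hsk⟩ := Set.mem_iUnion₂.1 (hct hs)
        rw [Metric.mem_ball, dist_eq_norm] at hsk
        have hsk' : ‖((a - s • 1 - k : selfAdjoint A) : A)‖ < δ := hsk
        have e : φ (a : A) - ψ (a : A) = φ ((a - s • 1 - k : selfAdjoint A) : A)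
            - ψ ((a - s • 1 - k : selfAdjoint A) : A) + (φ (k : A) - ψ (k : A)) := by
          have h1 : ∀ χ ∈ stateSpace A, χ ((a - s • 1 - k : selfAdjoint A) : A)
              = χ (a : A) - s - χ (k : A) := fun χ hχ => by
            rw [← apply_sub_smul_one hχ]; exact map_sub χ _ _
          rw [h1 _ hφ, h1 _ hψS]; ring
        rw [e]
        refine (norm_add_le _ _).trans (add_le_add ((norm_sub_le _ _).trans (add_le_add ?_ ?_))
          (hψ k hk).le)
        · exact (stateSpace_norm_apply_le hφ _).trans hsk'.le
        · exact (stateSpace_norm_apply_le hψS _).trans hsk'.le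
      · refine le_inf ?_ inf_le_right
        have hsa : ∀ a : selfAdjoint A, Filter.Tendsto (fun ψ : WeakDual ℂ A => ψ (a : A))
            ((𝓝 0).comap (mongeKantorovich lip φ) ⊓ Filter.principal (stateSpace A))
            (𝓝 (φ (a : A))) := by
          intro a
          rw [Metric.tendsto_nhds]
          intro ε hε
          obtain ⟨b, l, hl, -, hb⟩ := hdom φ hφ a (ε / 2) (by positivity)
          have h1 : ∀ᶠ ψ in (𝓝 0).comap (mongeKantorovich lip φ),
              mongeKantorovich lip φ ψ < ENNReal.ofReal (ε / 2 / l) :=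
            Filter.tendsto_comap.eventually (gt_mem_nhds (by
              rw [ENNReal.ofReal_pos]; positivity))
          filter_upwards [Filter.mem_inf_of_left h1,
            Filter.mem_inf_of_right (Filter.mem_principal_self _)] with ψ hψ hψS
          have h2 := hb ψ hψS
          rw [dist_comm, dist_eq_norm]
          have h3 : ‖φ (a : A) - ψ (a : A)‖ₑ < ENNReal.ofReal ε := by
            refine h2.trans_lt ?_
            have : ENNReal.ofReal ε = ENNReal.ofReal (ε / 2)
                + ENNReal.ofReal l * ENNReal.ofReal (ε / 2 / l) := by
              rw [← ENNReal.ofReal_mul hl.le, ← ENNReal.ofReal_add (by positivity)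
                (by positivity)]
              congr 1; field_simp; ring
            rw [this]
            refine ENNReal.add_lt_add_left ENNReal.ofReal_ne_top ?_
            exact ENNReal.mul_lt_mul_right (by simpa using hl) ENNReal.ofReal_ne_top hψ
          rwa [← ofReal_norm, ENNReal.ofReal_lt_ofReal_iff hε] at h3
        have := (WeakBilin.tendsto_iff_forall_eval_tendsto (f := id) (x := φ)
          (B := topDualPairing ℂ A)
          (l := (𝓝 0).comap (mongeKantorovich lip φ) ⊓ Filter.principal (stateSpace A))
          ContinuousLinearMap.coe_injective).2 (fun x => by
            change Filter.Tendsto (fun ψ : WeakDual ℂ A => ψ x) _ (𝓝 (φ x))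
            simp_rw [stateSpace_apply_decomp _ x]
            exact (hsa _).add ((hsa _).const_mul _))
        exact this
    rw [key]
    have hb := (ENNReal.nhds_zero_basis.comap (mongeKantorovich lip φ)).inf_principal
      (stateSpace A)
    refine hb.congr (fun _ => Iff.rfl) fun r _ => ?_
    ext ψ
    exact and_comm

theorem complex_zero (F K : ℝ) :
    IsQuantumCompactMetricSpace F K (0 : selfAdjoint ℂ → ℝ≥0∞) := by
  refine of_isCompact (by simp) (by simp) (by simp) rfl (by simp) (by simp)
    (isCompact_singleton (x := 0)) fun a _ => ⟨((a : ℂ)).re, ?_⟩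
  rw [Set.mem_singleton_iff, sub_eq_zero]
  refine Subtype.ext ?_
  change (a : ℂ) = (a : ℂ).re • (1 : ℂ)
  have h : (starRingEnd ℂ) (a : ℂ) = a := a.2
  rw [Complex.real_smul, mul_one, Complex.conj_eq_iff_re.1 h]

theorem mono {F' K' : ℝ} (h : IsQuantumCompactMetricSpace F K lip) (hF : F ≤ F') (hK : K ≤ K') :
    IsQuantumCompactMetricSpace F' K' lip :=
  { h with
    leibniz := fun a b ha hb => (h.leibniz a b ha hb).trans (by gcongr) }

end IsQuantumCompactMetricSpace

/-! ### Self-adjoint operators with compact resolvent -/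

section Resolvent

variable {H : Type*} [NormedAddCommGroup H] [InnerProductSpace ℂ H]

/-- `R` is the inverse of `D + i`. -/
structure IsResolvent (D : H →ₗ.[ℂ] H) (R : H →L[ℂ] H) : Prop where
  left : ∀ ξ : D.domain, R (D ξ + Complex.I • (ξ : H)) = ξ
  right : ∀ η : H, ∃ h : R η ∈ D.domain, D ⟨R η, h⟩ + Complex.I • R η = η

namespace IsResolvent

variable {D : H →ₗ.[ℂ] H} {R : H →L[ℂ] H}

theorem mem (hR : IsResolvent D R) (η : H) : R η ∈ D.domain := (hR.right η).1

theorem apply_eq (hR : IsResolvent D R) (η : H) :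
    D ⟨R η, hR.mem η⟩ = η - Complex.I • R η :=
  eq_sub_of_add_eq (hR.right η).2

theorem exists_apply_eq (hR : IsResolvent D R) {ξ : H} (hξ : ξ ∈ D.domain) :
    ∃ η, R η = ξ := ⟨_, hR.left ⟨ξ, hξ⟩⟩

/-- `D` and its resolvent have the same eigenvectors, the eigenvalue `s` corresponding to `(s +
i)⁻¹`. -/
theorem smul_apply_of_mem_diracEigenspace (hR : IsResolvent D R) {s : ℝ} {ξ : H}
    (hξ : ξ ∈ diracEigenspace D s) : ((s : ℂ) + Complex.I) • R ξ = ξ := by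
  obtain ⟨h, e⟩ := mem_diracEigenspace.1 hξ
  have := hR.left ⟨ξ, h⟩
  rw [e, ← add_smul, map_smul] at this
  exact this

theorem mem_diracEigenspace_of_smul_apply (hR : IsResolvent D R) {s : ℝ} {ξ : H}
    (h : ((s : ℂ) + Complex.I) • R ξ = ξ) : ξ ∈ diracEigenspace D s := by
  have hm : ξ ∈ D.domain := by rw [← h]; exact D.domain.smul_mem _ (hR.mem ξ)
  refine mem_diracEigenspace.2 ⟨hm, ?_⟩
  have e : (⟨ξ, hm⟩ : D.domain) = ((s : ℂ) + Complex.I) • ⟨R ξ, hR.mem ξ⟩ := Subtype.ext h.symm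
  rw [e, D.map_smul, hR.apply_eq, smul_sub, smul_comm, h, add_smul, add_sub_cancel_right]

end IsResolvent

theorem ofReal_add_I_ne_zero (s : ℝ) : (s : ℂ) + Complex.I ≠ 0 := by
  intro h
  have := congrArg Complex.im h
  simp at this

variable [CompleteSpace H] {D : H →ₗ.[ℂ] H}

theorem dirac_inner_eq (hD : IsSelfAdjoint D) (x y : D.domain) :
    inner ℂ (D x) (y : H) = inner ℂ (x : H) (D y) := by
  have h := LinearPMap.adjoint_isFormalAdjoint hD.dense_domain
  rw [LinearPMap.isSelfAdjoint_def.1 hD] at h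
  exact h x y

/-- Weak solutions are strong: the identity puts `y` in the domain of the adjoint, and `D` equals
its adjoint, domain included. -/
theorem exists_dirac_eq (hD : IsSelfAdjoint D) {y w : H}
    (h : ∀ x : D.domain, inner ℂ w (x : H) = inner ℂ y (D x)) :
    ∃ hy : y ∈ D.domain, D ⟨y, hy⟩ = w := by
  have hd := hD.dense_domain
  have hy : y ∈ D.adjoint.domain := LinearPMap.mem_adjoint_domain_of_exists y ⟨w, h⟩
  have e : D.adjoint ⟨y, hy⟩ = w := LinearPMap.adjoint_apply_eq hd ⟨y, hy⟩ h
  have hg : (y, w) ∈ D.adjoint.graph := by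
    rw [LinearPMap.mem_graph_iff]; exact ⟨⟨y, hy⟩, rfl, e⟩
  rw [LinearPMap.isSelfAdjoint_def.1 hD, LinearPMap.mem_graph_iff] at hg
  obtain ⟨z, hz1, hz2⟩ := hg
  simp only at hz1 hz2
  subst hz1
  exact ⟨z.2, hz2⟩

namespace IsResolvent

variable {R : H →L[ℂ] H}

/-- The adjoint of the inverse of `D + i` is the inverse of `D - i`; together with `adjoint_left`
this makes `R` a normal operator. -/
theorem adjoint_right (hR : IsResolvent D R) (hD : IsSelfAdjoint D) (η : H) :
    ∃ h : R.adjoint η ∈ D.domain, D ⟨R.adjoint η, h⟩ = η + Complex.I • R.adjoint η := by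
  refine exists_dirac_eq hD fun x => ?_
  have h1 : D x = (D x + Complex.I • (x : H)) - Complex.I • (x : H) := by abel
  rw [h1, inner_sub_right, ContinuousLinearMap.adjoint_inner_left, hR.left, inner_add_left,
    inner_smul_left, inner_smul_right, Complex.conj_I]
  ring

theorem adjoint_left (hR : IsResolvent D R) (hD : IsSelfAdjoint D) (x : D.domain) :
    R.adjoint (D x - Complex.I • (x : H)) = x := by
  refine ext_inner_right ℂ fun z => ?_
  rw [ContinuousLinearMap.adjoint_inner_left, inner_sub_left, inner_smul_left,
    dirac_inner_eq hD x ⟨R z, hR.mem z⟩, hR.apply_eq, inner_sub_right, inner_smul_right,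
    Complex.conj_I]
  ring

/-- Both products occur in resolvent identities with the same other terms: `R* = R + 2i R* R` and
`R* = R + 2i R R*`. -/
theorem adjoint_comm (hR : IsResolvent D R) (hD : IsSelfAdjoint D) (η : H) :
    R.adjoint (R η) = R (R.adjoint η) := by
  have h1 : R.adjoint η = R η + (2 * Complex.I) • R.adjoint (R η) := by
    have := hR.adjoint_left hD ⟨R η, hR.mem η⟩
    rw [hR.apply_eq] at this
    simp only [map_sub, map_smul] at this
    rw [mul_smul, two_smul]
    rwa [sub_sub, sub_eq_iff_eq_add] at this
  have h2 : R η + (2 * Complex.I) • R (R.adjoint η) = R.adjoint η := by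
    obtain ⟨h, e⟩ := hR.adjoint_right hD η
    have := hR.left ⟨R.adjoint η, h⟩
    rw [e] at this
    simp only [map_add, map_smul] at this
    rwa [mul_smul, two_smul, ← add_assoc]
  rw [← h2] at h1
  have h3 := add_left_cancel h1
  exact (smul_right_injective H (show (2 * Complex.I : ℂ) ≠ 0 by simp) h3).symm

theorem apply_adjoint_eq_zero (hR : IsResolvent D R) (hD : IsSelfAdjoint D) {ξ : H}
    (h : R (R.adjoint ξ) = 0) : ξ = 0 := by
  have h0 : R.adjoint ξ = 0 := by
    rw [← inner_self_eq_zero (𝕜 := ℂ), ContinuousLinearMap.adjoint_inner_left, h,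
      inner_zero_right]
  obtain ⟨h1, e⟩ := hR.adjoint_right hD ξ
  have h2 : (⟨R.adjoint ξ, h1⟩ : D.domain) = 0 := Subtype.ext h0
  rw [h2, D.map_zero, h0, smul_zero, add_zero] at e
  exact e.symm

/-- The eigenvectors of a self-adjoint operator with compact resolvent are total. -/
theorem orthogonal_iSup_diracEigenspace (hR : IsResolvent D R) (hD : IsSelfAdjoint D)
    (hc : IsCompactOperator R) : (⨆ s, diracEigenspace D s)ᗮ = ⊥ := by
  -- `R` itself is not self-adjoint, but `R R*` is compact, self-adjoint and injective. Its
  -- eigenvectors are total, and it remains to split each of its eigenspaces into eigenspaces of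
  -- `D`.
  let S : H →L[ℂ] H := R ∘L R.adjoint
  have hS : IsCompactOperator S := hc.comp_clm R.adjoint
  have hsymm : (S : H →ₗ[ℂ] H).IsSymmetric := fun x y => by
    change inner ℂ (R (R.adjoint x)) y = inner ℂ x (R (R.adjoint y))
    rw [← ContinuousLinearMap.adjoint_inner_right, ContinuousLinearMap.adjoint_inner_left]
  have hE := ContinuousLinearMap.orthogonalComplement_iSup_eigenspaces_eq_bot hS hsymm
  rw [eq_bot_iff, ← hE]
  refine Submodule.orthogonal_le (iSup_le fun μ => ?_)
  rcases eq_or_ne μ 0 with rfl | hμ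
  · intro ξ hξ
    rw [Module.End.mem_eigenspace_iff, zero_smul] at hξ
    rw [hR.apply_adjoint_eq_zero hD hξ]
    exact Submodule.zero_mem _
  have hfin := ContinuousLinearMap.finite_dimensional_eigenspace hS μ hμ
  set E := Module.End.eigenspace (S : H →ₗ[ℂ] H) μ with hEdef
  have hEmem : ∀ ξ ∈ E, R (R.adjoint ξ) = μ • ξ := fun ξ hξ =>
    Module.End.mem_eigenspace_iff.1 hξ
  -- On the eigenspace of `R R*` for `μ ≠ 0` one has `ξ = μ⁻¹ R (R* ξ)`, so `D` acts there as `μ⁻¹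
  -- R* - i`. Normality of `R` keeps the eigenspace invariant.
  let B : H →ₗ[ℂ] H := μ⁻¹ • (R.adjoint : H →ₗ[ℂ] H) - Complex.I • LinearMap.id
  have hBapp : ∀ ξ, B ξ = μ⁻¹ • R.adjoint ξ - Complex.I • ξ := fun ξ => rfl
  have hBinv : ∀ ξ ∈ E, B ξ ∈ E := by
    intro ξ hξ
    refine Submodule.sub_mem _ (Submodule.smul_mem _ _ ?_) (Submodule.smul_mem _ _ hξ)
    refine Module.End.mem_eigenspace_iff.2 ?_
    change R (R.adjoint (R.adjoint ξ)) = μ • R.adjoint ξ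
    rw [← hR.adjoint_comm hD, hEmem ξ hξ, map_smul]
  have hBD : ∀ ξ ∈ E, ∃ h : ξ ∈ D.domain, D ⟨ξ, h⟩ = B ξ := by
    intro ξ hξ
    have e := hEmem ξ hξ
    have e' : ξ = μ⁻¹ • R (R.adjoint ξ) := by rw [e, smul_smul, inv_mul_cancel₀ hμ, one_smul]
    have hm : ξ ∈ D.domain := by rw [e']; exact D.domain.smul_mem _ (hR.mem _)
    refine ⟨hm, ?_⟩
    have e2 : (⟨ξ, hm⟩ : D.domain) = μ⁻¹ • ⟨R (R.adjoint ξ), hR.mem _⟩ := Subtype.ext e'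
    rw [e2, D.map_smul, hR.apply_eq, smul_sub, smul_comm, ← e']
    rfl
  let BE : E →ₗ[ℂ] E := B.restrict hBinv
  have hBE : BE.IsSymmetric := fun x y => by
    obtain ⟨hx, ex⟩ := hBD x x.2
    obtain ⟨hy, ey⟩ := hBD y y.2
    change inner ℂ (B x) (y : H) = inner ℂ (x : H) (B y)
    rw [← ex, ← ey]
    exact dirac_inner_eq hD ⟨x, hx⟩ ⟨y, hy⟩
  -- The eigenspace is finite dimensional, so the symmetric operator `D` is diagonalizable on it.
  have htop : (⨆ ν, Module.End.eigenspace BE ν) = ⊤ := by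
    rw [← Submodule.orthogonal_eq_bot_iff]
    exact hBE.orthogonalComplement_iSup_eigenspaces_eq_bot
  have hmap : E = (⨆ ν, Module.End.eigenspace BE ν).map E.subtype := by
    rw [htop, Submodule.map_subtype_top]
  rw [hmap, Submodule.map_iSup]
  refine iSup_le fun ν => ?_
  rintro _ ⟨ξ, hξ, rfl⟩
  rcases eq_or_ne ξ 0 with rfl | hξ0
  · exact Submodule.zero_mem _
  have hν := hBE.conj_eigenvalue_eq_self
    (Module.End.hasEigenvalue_of_hasEigenvector ⟨hξ, hξ0⟩)
  obtain ⟨hm, hDξ⟩ := hBD ξ ξ.2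
  have hBξ : B ξ = ν • (ξ : H) := congrArg Subtype.val (Module.End.mem_eigenspace_iff.1 hξ)
  refine Submodule.mem_iSup_of_mem ν.re (mem_diracEigenspace.2 ⟨hm, ?_⟩)
  rw [Complex.conj_eq_iff_re.1 hν]
  exact hDξ.trans hBξ

theorem dense_iSup_diracEigenspace (hR : IsResolvent D R) (hD : IsSelfAdjoint D)
    (hc : IsCompactOperator R) : Dense ((⨆ s, diracEigenspace D s : Submodule ℂ H) : Set H) := by
  rw [Submodule.dense_iff_topologicalClosure_eq_top,
    Submodule.topologicalClosure_eq_top_iff]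
  exact hR.orthogonal_iSup_diracEigenspace hD hc

/-- Totality of the eigenvectors in the form used below: bounded operators are compared on
eigenvectors only. -/
theorem clm_ext (hR : IsResolvent D R) (hD : IsSelfAdjoint D)
    (hc : IsCompactOperator R) {F : Type*} [NormedAddCommGroup F] [NormedSpace ℂ F]
    {f g : H →L[ℂ] F} (h : ∀ s, ∀ ξ ∈ diracEigenspace D s, f ξ = g ξ) : f = g := by
  refine ContinuousLinearMap.ext fun ξ => ?_
  have hle : (⨆ s, diracEigenspace D s) ≤ LinearMap.eqLocus (f : H →ₗ[ℂ] F) g :=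
    iSup_le fun s ξ hξ => h s ξ hξ
  exact congrFun (Continuous.ext_on (hR.dense_iSup_diracEigenspace hD hc) f.continuous
    g.continuous fun x hx => hle hx) ξ

end IsResolvent

/-! ### The unitary group -/

theorem lp_phaseRotation_apply {E : ℝ → Type*} [∀ s, NormedAddCommGroup (E s)]
    [∀ s, InnerProductSpace ℂ (E s)] (t : ℝ) (f : lp E 2) (s : ℝ) :
    (phaseRotation t f : lp E 2) s = Complex.exp (Complex.I * t * s) • f s := rfl

theorem norm_phaseRotation_le {E : ℝ → Type*} [∀ s, NormedAddCommGroup (E s)]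
    [∀ s, InnerProductSpace ℂ (E s)] (t : ℝ) : ‖(phaseRotation t : lp E 2 →L[ℂ] lp E 2)‖ ≤ 1 :=
  LinearMap.mkContinuous_norm_le _ zero_le_one _

theorem diracGroup_apply_of_mem (hD : IsSelfAdjoint D) (t : ℝ) {s : ℝ} {ξ : H}
    (hξ : ξ ∈ diracEigenspace D s) :
    diracGroup D hD t ξ = Complex.exp (Complex.I * t * s) • ξ := by
  classical
  have : ∀ s : ℝ, CompleteSpace (diracEigenspace D s) := fun s =>
    (isClosed_diracEigenspace hD s).completeSpace_coe
  let W := (orthogonalFamily_diracEigenspace hD).linearIsometry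
  let V := W.toContinuousLinearMap
  let f : lp (fun s => diracEigenspace D s) 2 := lp.single 2 s ⟨ξ, hξ⟩
  have hV : V f = ξ := OrthogonalFamily.linearIsometry_apply_single
    (orthogonalFamily_diracEigenspace hD) (i := s) ⟨ξ, hξ⟩
  have hadj : V.adjoint ξ = f := by
    refine ext_inner_right ℂ fun g => ?_
    rw [ContinuousLinearMap.adjoint_inner_left, ← hV]
    exact W.inner_map_map f g
  have hph : phaseRotation t f = Complex.exp (Complex.I * t * s) • f := by
    refine lp.ext (funext fun a => ?_)
    rw [lp_phaseRotation_apply, lp.coeFn_smul, Pi.smul_apply]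
    rcases eq_or_ne a s with rfl | ha
    · rfl
    · have : f a = 0 := lp.single_apply_ne 2 s _ ha
      rw [this, smul_zero, smul_zero]
  change V (phaseRotation t (V.adjoint ξ)) = _
  rw [hadj, hph, map_smul, hV]

theorem norm_diracGroup_le (hD : IsSelfAdjoint D) (t : ℝ) : ‖diracGroup D hD t‖ ≤ 1 := by
  have : ∀ s : ℝ, CompleteSpace (diracEigenspace D s) := fun s =>
    (isClosed_diracEigenspace hD s).completeSpace_coe
  let W := (orthogonalFamily_diracEigenspace hD).linearIsometry
  let V := W.toContinuousLinearMap
  have hV : ‖V‖ ≤ 1 := W.norm_toContinuousLinearMap_le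
  have hV' : ‖V.adjoint‖ ≤ 1 := by rw [LinearIsometryEquiv.norm_map]; exact hV
  change ‖V ∘L phaseRotation t ∘L V.adjoint‖ ≤ 1
  refine (ContinuousLinearMap.opNorm_comp_le _ _).trans ?_
  refine mul_le_one₀ hV (norm_nonneg _) ((ContinuousLinearMap.opNorm_comp_le _ _).trans ?_)
  exact mul_le_one₀ (norm_phaseRotation_le t) (norm_nonneg _) hV'

theorem norm_exp_sub_exp_le (s t a : ℝ) :
    ‖Complex.exp (Complex.I * s * a) - Complex.exp (Complex.I * t * a)‖ ≤ |s - t| * |a| := by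
  have e : Complex.exp (Complex.I * s * a) - Complex.exp (Complex.I * t * a) =
      Complex.exp (Complex.I * t * a) * (Complex.exp (Complex.I * ((s - t) * a : ℝ)) - 1) := by
    rw [mul_sub, ← Complex.exp_add, mul_one]
    congr 2
    push_cast; ring
  rw [e, norm_mul, norm_exp_I_mul, one_mul, ← abs_mul]
  exact Real.norm_exp_I_mul_ofReal_sub_one_le

theorem norm_phaseRotation_sub_le {E : ℝ → Type*} [∀ s, NormedAddCommGroup (E s)]
    [∀ s, InnerProductSpace ℂ (E s)] (s t : ℝ) {f g : lp E 2}
    (h : ∀ a : ℝ, g a = (a : ℂ) • f a) :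
    ‖phaseRotation s f - phaseRotation t f‖ ≤ |s - t| * ‖g‖ := by
  have h1 : ‖phaseRotation s f - phaseRotation t f‖ ≤ ‖((|s - t| : ℝ) : ℂ) • g‖ := by
    refine lp.norm_mono (by norm_num) fun a => ?_
    change ‖Complex.exp (Complex.I * s * a) • f a - Complex.exp (Complex.I * t * a) • f a‖
      ≤ ‖((|s - t| : ℝ) : ℂ) • g a‖
    rw [h, ← sub_smul, norm_smul, norm_smul, norm_smul, Complex.norm_real, Complex.norm_real,
      Real.norm_eq_abs, Real.norm_eq_abs, abs_abs, ← mul_assoc]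
    exact mul_le_mul_of_nonneg_right (norm_exp_sub_exp_le s t a) (norm_nonneg _)
  rwa [norm_smul, Complex.norm_real, Real.norm_eq_abs, abs_abs] at h1

/-- The component of `D η` in the eigenspace for `a` is `a` times that of `η`, and `|exp (isa) - exp
(ita)| ≤ |s - t| |a|`. Summing the squares gives the bound; passing to components is a contraction.
-/
theorem norm_diracGroup_sub_le (hD : IsSelfAdjoint D) (s t : ℝ) (η : D.domain) :
    ‖diracGroup D hD s (η : H) - diracGroup D hD t (η : H)‖ ≤ |s - t| * ‖D η‖ := by
  classical
  have : ∀ s : ℝ, CompleteSpace (diracEigenspace D s) := fun s =>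
    (isClosed_diracEigenspace hD s).completeSpace_coe
  let W := (orthogonalFamily_diracEigenspace hD).linearIsometry
  let V := W.toContinuousLinearMap
  have hV' : ‖V.adjoint‖ ≤ 1 := by
    rw [LinearIsometryEquiv.norm_map]; exact W.norm_toContinuousLinearMap_le
  have hcoord : ∀ (ξ : H) (a : ℝ) (v : diracEigenspace D a),
      inner ℂ v (V.adjoint ξ a) = inner ℂ (v : H) ξ := by
    intro ξ a v
    have h1 : V (lp.single 2 a v) = v := OrthogonalFamily.linearIsometry_apply_single
      (orthogonalFamily_diracEigenspace hD) (i := a) v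
    rw [← h1, ← ContinuousLinearMap.adjoint_inner_right, lp.inner_single_left]
  have hfg : ∀ a : ℝ, V.adjoint (D η) a = (a : ℂ) • V.adjoint (η : H) a := by
    intro a
    refine ext_inner_left ℂ fun v => ?_
    obtain ⟨hv, ev⟩ := mem_diracEigenspace.1 v.2
    rw [hcoord, inner_smul_right, hcoord, ← dirac_inner_eq hD ⟨v, hv⟩ η, ev, inner_smul_left,
      Complex.conj_ofReal]
  change ‖W (phaseRotation s (V.adjoint (η : H))) - W (phaseRotation t (V.adjoint (η : H)))‖ ≤ _
  rw [← map_sub, W.norm_map]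
  refine (norm_phaseRotation_sub_le s t hfg).trans ?_
  gcongr
  exact (ContinuousLinearMap.le_of_opNorm_le _ hV' _).trans (one_mul _).le

namespace IsResolvent

variable {R : H →L[ℂ] H}

theorem diracGroup_comp (hR : IsResolvent D R) (hD : IsSelfAdjoint D) (hc : IsCompactOperator R)
    (s t : ℝ) : diracGroup D hD s ∘L diracGroup D hD t = diracGroup D hD (s + t) := by
  refine hR.clm_ext hD hc fun a ξ hξ => ?_
  rw [ContinuousLinearMap.comp_apply, diracGroup_apply_of_mem hD t hξ, map_smul,
    diracGroup_apply_of_mem hD s hξ, diracGroup_apply_of_mem hD _ hξ, smul_smul,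
    ← Complex.exp_add]
  congr 2
  push_cast; ring

theorem diracGroup_zero (hR : IsResolvent D R) (hD : IsSelfAdjoint D)
    (hc : IsCompactOperator R) : diracGroup D hD 0 = ContinuousLinearMap.id ℂ H := by
  refine hR.clm_ext hD hc fun a ξ hξ => ?_
  rw [diracGroup_apply_of_mem hD 0 hξ]
  simp

/-- Each operator of the group is a contraction whose inverse is also one, hence isometric, and its
inverse is then its adjoint. -/
theorem diracGroup_inner (hR : IsResolvent D R) (hD : IsSelfAdjoint D)
    (hc : IsCompactOperator R) (t : ℝ) (ξ η : H) :
    inner ℂ (diracGroup D hD (-t) ξ) η = inner ℂ ξ (diracGroup D hD t η) := by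
  have hinv : ∀ s ζ, diracGroup D hD s (diracGroup D hD (-s) ζ) = ζ := fun s ζ => by
    have := hR.diracGroup_comp hD hc s (-s)
    rw [add_neg_cancel, hR.diracGroup_zero hD hc] at this
    exact DFunLike.congr_fun this ζ
  have hle : ∀ s ζ, ‖diracGroup D hD s ζ‖ ≤ ‖ζ‖ := fun s ζ =>
    (ContinuousLinearMap.le_of_opNorm_le _ (norm_diracGroup_le hD s) _).trans (one_mul _).le
  let W : H →ₗᵢ[ℂ] H := ⟨diracGroup D hD (-t), fun ζ => by
    refine le_antisymm (hle _ _) ?_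
    have := hle t (diracGroup D hD (-t) ζ)
    rwa [hinv] at this⟩
  have h1 := W.inner_map_map ξ (diracGroup D hD t η)
  have h2 : W (diracGroup D hD t η) = η := by
    have := hinv (-t) η
    rwa [neg_neg] at this
  rw [h2] at h1
  exact h1

/-- An eigenvector of the unitary group is an eigenvector of its generator. -/
theorem mem_diracEigenspace_of_diracGroup (hR : IsResolvent D R) (hD : IsSelfAdjoint D)
    (hc : IsCompactOperator R) {s : ℝ} {ζ : H}
    (h : ∀ t : ℝ, 0 ≤ t → diracGroup D hD t ζ = Complex.exp (Complex.I * t * s) • ζ) :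
    ζ ∈ diracEigenspace D s := by
  -- The vector `ζ` is orthogonal to every other eigenspace, since the group multiplies the two by
  -- different phases.
  have horth : ∀ a, a ≠ s → ∀ v ∈ diracEigenspace D a, inner ℂ v ζ = 0 := by
    intro a ha v hv
    have hd : 0 < |a - s| := abs_pos.2 (sub_ne_zero.2 ha)
    have key : ∀ t : ℝ, 0 ≤ t → (Complex.exp (Complex.I * t * a)
        - Complex.exp (Complex.I * t * s)) * inner ℂ v ζ = 0 := by
      intro t ht
      have h1 := hR.diracGroup_inner hD hc t v ζ
      rw [h t ht, diracGroup_apply_of_mem hD _ hv, inner_smul_left, inner_smul_right,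
        ← Complex.exp_conj] at h1
      rw [sub_mul, sub_eq_zero, ← h1]
      congr 2
      simp
    -- At the time `π / |a - s|` the two phases are opposite; equality would make `π` an integer
    -- multiple of `2π`.
    have h2 := key (Real.pi / |a - s|) (by positivity)
    refine (mul_eq_zero.1 h2).resolve_left fun h3 => ?_
    rw [sub_eq_zero, Complex.exp_eq_exp_iff_exists_int] at h3
    obtain ⟨n, hn⟩ := h3
    have h4 : (Real.pi / |a - s|) * (a - s) = n * (2 * Real.pi) := by
      have := congrArg Complex.im hn
      simp at this
      linarith
    have h5 : Real.pi / |a - s| * |a - s| = |(n : ℝ)| * (2 * Real.pi) := by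
      have := congrArg abs h4
      rwa [abs_mul, abs_mul, abs_of_pos (by positivity : 0 < Real.pi / |a - s|),
        abs_of_pos (by positivity : 0 < 2 * Real.pi)] at this
    rw [div_mul_cancel₀ _ hd.ne'] at h5
    have h6 : |(n : ℝ)| * 2 = 1 := by
      have := Real.pi_pos
      apply mul_right_cancel₀ this.ne'
      linarith
    have h7 : |n| * 2 = 1 := by exact_mod_cast h6
    omega
  refine hR.mem_diracEigenspace_of_smul_apply ?_
  rw [← sub_eq_zero]
  -- Against eigenvectors for `a ≠ s` the vector vanishes because `ζ` is orthogonal to them, and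
  -- against those for `s` because the resolvent acts there as `(s + i)⁻¹`. Totality then makes it
  -- zero.
  have hw : ((s : ℂ) + Complex.I) • R ζ - ζ ∈ (⨆ s, diracEigenspace D s)ᗮ := by
    rw [← Submodule.iInf_orthogonal, Submodule.mem_iInf]
    intro a v hv
    have hRv : inner ℂ v (R ζ) = ((a : ℂ) + Complex.I)⁻¹ * inner ℂ v ζ := by
      rw [← ContinuousLinearMap.adjoint_inner_left]
      obtain ⟨hm, e⟩ := mem_diracEigenspace.1 hv
      have h1 := hR.adjoint_left hD ⟨v, hm⟩
      rw [e, ← sub_smul, map_smul] at h1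
      change _ = v at h1
      conv_rhs => rw [← h1, inner_smul_left, ← mul_assoc]
      have : (starRingEnd ℂ) ((a : ℂ) - Complex.I) = (a : ℂ) + Complex.I := by simp
      rw [this, inv_mul_cancel₀ (ofReal_add_I_ne_zero a), one_mul]
    rw [inner_sub_right, inner_smul_right, hRv]
    rcases eq_or_ne a s with rfl | ha
    · rw [mul_inv_cancel_left₀ (ofReal_add_I_ne_zero a), sub_self]
    · rw [horth a ha v hv]; simp
  rw [hR.orthogonal_iSup_diracEigenspace hD hc] at hw
  exact hw

end IsResolvent

end Resolvent

/-! ### The graph norm and the commutator seminorm -/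

section GraphNorm

variable {H : Type*} [NormedAddCommGroup H] [InnerProductSpace ℂ H] {D : H →ₗ.[ℂ] H}

theorem graphNorm_of_mem {ξ : H} (h : ξ ∈ D.domain) :
    graphNorm D ξ = ‖ξ‖ₑ + ‖D ⟨ξ, h⟩‖ₑ := dif_pos h

theorem graphNorm_of_notMem {ξ : H} (h : ξ ∉ D.domain) : graphNorm D ξ = ∞ := dif_neg h

theorem graphNorm_lt_top_iff {ξ : H} : graphNorm D ξ < ∞ ↔ ξ ∈ D.domain := by
  by_cases h : ξ ∈ D.domain
  · simp [graphNorm_of_mem h, h]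
  · simp [graphNorm_of_notMem h, h]

theorem graphNorm_add_le (ξ η : H) : graphNorm D (ξ + η) ≤ graphNorm D ξ + graphNorm D η := by
  by_cases hξ : ξ ∈ D.domain
  · by_cases hη : η ∈ D.domain
    · rw [graphNorm_of_mem hξ, graphNorm_of_mem hη, graphNorm_of_mem (D.domain.add_mem hξ hη)]
      have e : D ⟨ξ + η, D.domain.add_mem hξ hη⟩ = D ⟨ξ, hξ⟩ + D ⟨η, hη⟩ :=
        D.map_add ⟨ξ, hξ⟩ ⟨η, hη⟩
      rw [e, add_add_add_comm]
      exact add_le_add (enorm_add_le _ _) (enorm_add_le _ _)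
    · rw [graphNorm_of_notMem hη, add_top]; exact le_top
  · rw [graphNorm_of_notMem hξ, top_add]; exact le_top

theorem graphNorm_smul (z : ℂ) (ξ : H) : graphNorm D (z • ξ) = ‖z‖ₑ * graphNorm D ξ := by
  rcases eq_or_ne z 0 with rfl | hz
  · have h0 : (0 : ℂ) • ξ ∈ D.domain := by rw [zero_smul]; exact D.domain.zero_mem
    rw [graphNorm_of_mem h0]
    have e : (⟨(0 : ℂ) • ξ, h0⟩ : D.domain) = 0 := Subtype.ext (zero_smul ℂ ξ)
    rw [e, D.map_zero]
    simp
  by_cases hξ : ξ ∈ D.domain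
  · rw [graphNorm_of_mem hξ, graphNorm_of_mem (D.domain.smul_mem z hξ)]
    have e : D ⟨z • ξ, D.domain.smul_mem z hξ⟩ = z • D ⟨ξ, hξ⟩ := D.map_smul z ⟨ξ, hξ⟩
    rw [e, enorm_smul, enorm_smul, mul_add]
  · have : z • ξ ∉ D.domain := fun h => hξ ((Submodule.smul_mem_iff _ hz).1 h)
    rw [graphNorm_of_notMem hξ, graphNorm_of_notMem this, ENNReal.mul_top (by simpa using hz)]

theorem enorm_le_graphNorm (ξ : H) : ‖ξ‖ₑ ≤ graphNorm D ξ := by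
  by_cases hξ : ξ ∈ D.domain
  · rw [graphNorm_of_mem hξ]; exact le_self_add
  · rw [graphNorm_of_notMem hξ]; exact le_top

theorem graphNorm_le_one_iff {ξ : H} :
    graphNorm D ξ ≤ 1 ↔ ∃ h : ξ ∈ D.domain, ‖ξ‖ + ‖D ⟨ξ, h⟩‖ ≤ 1 := by
  by_cases hξ : ξ ∈ D.domain
  · rw [graphNorm_of_mem hξ, ← ofReal_norm, ← ofReal_norm, ← ENNReal.ofReal_add (norm_nonneg _)
      (norm_nonneg _), ENNReal.ofReal_le_one]
    simp [hξ]
  · simp [graphNorm_of_notMem hξ, hξ]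

/-- The infimum over admissible constants is itself admissible: for `ξ ≠ 0` divide by `‖ξ‖` before
taking the infimum. -/
theorem commutatorNorm_spec {a : H →L[ℂ] H} (h : commutatorNorm D a < ∞) (ξ : D.domain) :
    ∃ hm : a ξ ∈ D.domain,
      ‖D ⟨a ξ, hm⟩ - a (D ξ)‖ₑ ≤ commutatorNorm D a * ‖(ξ : H)‖ₑ := by
  simp only [commutatorNorm, iInf_lt_iff] at h
  obtain ⟨C, hC, -⟩ := h
  refine ⟨(hC ξ).1, ?_⟩
  rcases eq_or_ne (ξ : H) 0 with h0 | h0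
  · obtain ⟨hm, e⟩ := hC ξ
    have h00 : ‖(ξ : H)‖ = 0 := by rw [h0, norm_zero]
    rw [enorm_eq_zero.2 (norm_le_zero_iff.1 (e.trans_eq (by rw [h00, mul_zero])))]
    exact zero_le
  have h1 : ‖(ξ : H)‖ₑ ≠ 0 := by simpa using h0
  rw [← ENNReal.div_le_iff h1 enorm_ne_top]
  refine le_iInf₂ fun C hC => ?_
  rw [ENNReal.div_le_iff h1 enorm_ne_top]
  obtain ⟨hm, e⟩ := hC ξ
  rw [enorm_eq_nnnorm, enorm_eq_nnnorm]
  exact_mod_cast e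

/-- From `D a ξ = [D, a] ξ + a D ξ`. The term added in the computation only makes the bound factor.
-/
theorem graphNorm_apply_le {a : H →L[ℂ] H} {r : ℝ≥0∞} (hr : ‖a‖ₑ ≤ r)
    (h : commutatorNorm D a < ∞) {ξ : H} (hξ : graphNorm D ξ < ∞) :
    graphNorm D (a ξ) ≤ (r + commutatorNorm D a) * graphNorm D ξ := by
  have hm := graphNorm_lt_top_iff.1 hξ
  obtain ⟨ham, hle⟩ := commutatorNorm_spec h ⟨ξ, hm⟩
  have ha : ∀ η, ‖a η‖ₑ ≤ r * ‖η‖ₑ := fun η => (a.le_opENorm η).trans (by gcongr)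
  rw [graphNorm_of_mem ham, graphNorm_of_mem hm]
  calc ‖a ξ‖ₑ + ‖D ⟨a ξ, ham⟩‖ₑ
      ≤ r * ‖ξ‖ₑ + (commutatorNorm D a * ‖ξ‖ₑ + r * ‖D ⟨ξ, hm⟩‖ₑ) := by
        refine add_le_add (ha ξ) ?_
        rw [← sub_add_cancel (D ⟨a ξ, ham⟩) (a (D ⟨ξ, hm⟩))]
        exact (enorm_add_le _ _).trans (add_le_add hle (ha _))
    _ ≤ r * ‖ξ‖ₑ + (commutatorNorm D a * ‖ξ‖ₑ + r * ‖D ⟨ξ, hm⟩‖ₑ)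
        + commutatorNorm D a * ‖D ⟨ξ, hm⟩‖ₑ := le_self_add
    _ = _ := by ring

variable [CompleteSpace H]

/-- Testing against the domain replaces `‖D ξ‖ ≤ 1 - ‖ξ‖` by `|⟨ξ, D x⟩| ≤ (1 - ‖ξ‖) ‖x‖`, which is
closed in `ξ`. Self-adjointness recovers both `ξ ∈ dom D` and the bound. -/
theorem isClosed_graphNorm_le_one (hD : IsSelfAdjoint D) : IsClosed {ξ | graphNorm D ξ ≤ 1} := by
  have : {ξ | graphNorm D ξ ≤ 1} = ⋂ x : D.domain,
      {ξ | ‖inner ℂ ξ (D x)‖ + ‖ξ‖ * ‖(x : H)‖ ≤ ‖(x : H)‖} ∩ {ξ | ‖ξ‖ ≤ 1} := by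
    ext ξ
    simp only [Set.mem_ofPred_eq, Set.mem_iInter, Set.mem_inter_iff]
    rw [graphNorm_le_one_iff]
    constructor
    · rintro ⟨hξ, h⟩ x
      refine ⟨?_, by linarith [norm_nonneg (D ⟨ξ, hξ⟩)]⟩
      have h1 : ‖inner ℂ ξ (D x)‖ ≤ ‖D ⟨ξ, hξ⟩‖ * ‖(x : H)‖ := by
        rw [← dirac_inner_eq hD ⟨ξ, hξ⟩ x]
        exact norm_inner_le_norm _ _
      nlinarith [norm_nonneg (x : H)]
    · intro h
      have h0 : ‖ξ‖ ≤ 1 := (h 0).2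
      have hm : ξ ∈ D.adjoint.domain := by
        rw [LinearPMap.mem_adjoint_domain_iff]
        refine AddMonoidHomClass.continuous_of_bound
          ((innerₛₗ ℂ ξ).comp D.toFun) 1 fun x => ?_
        have := (h x).1
        change ‖inner ℂ ξ (D x)‖ ≤ 1 * ‖(x : H)‖
        nlinarith [mul_nonneg (norm_nonneg ξ) (norm_nonneg (x : H))]
      have hm' : ξ ∈ D.domain := by
        rwa [LinearPMap.isSelfAdjoint_def.1 hD] at hm
      refine ⟨hm', ?_⟩
      have hb : ‖D ⟨ξ, hm'⟩‖ ≤ 1 - ‖ξ‖ := by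
        have hle : ∀ x : H, ‖innerSL ℂ (D ⟨ξ, hm'⟩) x‖ ≤ (1 - ‖ξ‖) * ‖x‖ := by
          have hcl : IsClosed {x : H | ‖innerSL ℂ (D ⟨ξ, hm'⟩) x‖ ≤ (1 - ‖ξ‖) * ‖x‖} :=
            isClosed_le (by fun_prop) (by fun_prop)
          intro x
          refine hcl.closure_subset_iff.2 ?_ (hD.dense_domain x)
          intro x hx
          have h1 := (h ⟨x, hx⟩).1
          rw [← dirac_inner_eq hD ⟨ξ, hm'⟩ ⟨x, hx⟩] at h1
          change ‖inner ℂ (D ⟨ξ, hm'⟩) x‖ ≤ _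
          simp only at h1
          linarith
        rw [← innerSL_apply_norm (𝕜 := ℂ)]
        exact ContinuousLinearMap.opNorm_le_bound _ (by linarith) hle
      linarith
  rw [this]
  refine isClosed_iInter fun x => (isClosed_le (by fun_prop) (by fun_prop)).inter
    (isClosed_le (by fun_prop) (by fun_prop))

/-- Such a `ξ` is `R (D ξ + i ξ)` with `‖D ξ + i ξ‖ ≤ 1`, so the set is a closed part of a
relatively compact image. -/
theorem isCompact_graphNorm_le_one (hD : IsSelfAdjoint D) {R : H →L[ℂ] H}
    (hR : IsResolvent D R) (hc : IsCompactOperator R) : IsCompact {ξ | graphNorm D ξ ≤ 1} := by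
  refine (hc.isCompact_closure_image_closedBall 1).of_isClosed_subset
    (isClosed_graphNorm_le_one hD) fun ξ hξ => subset_closure ?_
  obtain ⟨hm, h⟩ := graphNorm_le_one_iff.1 hξ
  refine ⟨D ⟨ξ, hm⟩ + Complex.I • ξ, ?_, hR.left ⟨ξ, hm⟩⟩
  rw [mem_closedBall_zero_iff]
  refine (norm_add_le _ _).trans ?_
  rw [norm_smul, Complex.norm_I, one_mul]
  linarith

end GraphNorm

/-! ### Metric spectral triples as metrical C⋆-correspondences -/

namespace SpectralTriple

variable (T : SpectralTriple.{u, v})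

theorem exists_isResolvent : ∃ R : T.H →L[ℂ] T.H, IsResolvent T.D R ∧ IsCompactOperator R := by
  obtain ⟨R, h1, h2, h3⟩ := T.compact_resolvent
  exact ⟨R, ⟨h2, h3⟩, h1⟩

theorem U_zero : T.U 0 = ContinuousLinearMap.id ℂ T.H := by
  obtain ⟨R, hR, hc⟩ := T.exists_isResolvent
  exact hR.diracGroup_zero T.isSelfAdjoint hc

theorem U_inner (t : ℝ) (ξ η : T.H) : inner ℂ (T.U (-t) ξ) η = inner ℂ ξ (T.U t η) := by
  obtain ⟨R, hR, hc⟩ := T.exists_isResolvent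
  exact hR.diracGroup_inner T.isSelfAdjoint hc t ξ η

theorem norm_U_le (t : ℝ) (ξ : T.H) : ‖T.U t ξ‖ ≤ ‖ξ‖ :=
  (ContinuousLinearMap.le_of_opNorm_le _ (norm_diracGroup_le T.isSelfAdjoint t) _).trans
    (one_mul _).le

theorem norm_U_sub_le (s t : ℝ) {ξ : T.H} (hξ : graphNorm T.D ξ ≤ 1) :
    ‖T.U s ξ - T.U t ξ‖ ≤ |s - t| := by
  obtain ⟨hm, h⟩ := graphNorm_le_one_iff.1 hξ
  refine (norm_diracGroup_sub_le T.isSelfAdjoint s t ⟨ξ, hm⟩).trans ?_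
  exact mul_le_of_le_one_right (abs_nonneg _) (by linarith [norm_nonneg ξ])

theorem enorm_rep_le (a : T.A) : ‖T.rep a‖ₑ ≤ ‖a‖ₑ := by
  rw [← ofReal_norm, ← ofReal_norm]
  exact ENNReal.ofReal_le_ofReal (NonUnitalStarAlgHom.norm_apply_le T.rep a)

theorem graphNorm_rep_le {G : ℝ} (hG : 1 ≤ G) (a : selfAdjoint T.A) (ξ : T.H)
    (ha : T.lip a < ∞) (hξ : graphNorm T.D ξ < ∞) : graphNorm T.D (T.rep (a : T.A) ξ) ≤
      ENNReal.ofReal G * (‖(a : T.A)‖ₑ + T.lip a) * graphNorm T.D ξ := by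
  refine (graphNorm_apply_le (T.enorm_rep_le (a : T.A)) ha hξ).trans ?_
  have : 1 ≤ ENNReal.ofReal G := by simpa using hG
  calc _ = 1 * (‖(a : T.A)‖ₑ + T.lip a) * graphNorm T.D ξ := by rw [one_mul]; rfl
    _ ≤ ENNReal.ofReal G * (‖(a : T.A)‖ₑ + T.lip a) * graphNorm T.D ξ := by gcongr

theorem dense_graphNorm_lt_top : Dense {ξ : T.H | graphNorm T.D ξ < ∞} := by
  simp_rw [graphNorm_lt_top_iff]
  exact T.isSelfAdjoint.dense_domain

theorem isCompact_ball : IsCompact {ξ : T.H | graphNorm T.D ξ ≤ 1} := by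
  obtain ⟨R, hR, hc⟩ := T.exists_isResolvent
  exact isCompact_graphNorm_le_one T.isSelfAdjoint hR hc

theorem isMetrical_toMetrical (hT : T.IsMetric) {F K G H : ℝ} (hF : 1 ≤ F) (hK : 0 ≤ K)
    (hG : 1 ≤ G) : T.toMetrical.IsMetrical F K G H where
  qcmsA := IsQuantumCompactMetricSpace.mono hT hF hK
  qcmsB := IsQuantumCompactMetricSpace.complex_zero F K
  dnorm_add_le := graphNorm_add_le (D := T.D)
  dnorm_smul := graphNorm_smul (D := T.D)
  dense_dom := T.dense_graphNorm_lt_top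
  norm_le_dnorm := enorm_le_graphNorm (D := T.D)
  isCompact_ball := T.isCompact_ball
  modular_leibniz := T.graphNorm_rep_le hG
  inner_leibniz ω η _ _ := by
    change max (0 : ℝ≥0∞) 0 ≤ _
    rw [max_self]
    exact zero_le

end SpectralTriple

/-! ### Hausdorff distances and separations -/

section Hausdorff

variable {X : Type*} {d : X → X → ℝ≥0∞} {S T : Set X} {r : ℝ≥0∞}

theorem hausdorffExcess_le (h : ∀ x ∈ S, ∃ y ∈ T, d x y ≤ r) : hausdorffExcess d S T ≤ r :=
  iSup₂_le fun x hx => by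
    obtain ⟨y, hy, hxy⟩ := h x hx
    exact iInf₂_le_of_le y hy hxy

theorem exists_lt_of_hausdorffExcess_lt (h : hausdorffExcess d S T < r) {x : X} (hx : x ∈ S) :
    ∃ y ∈ T, d x y < r := by
  have h1 : ⨅ y ∈ T, d x y < r := (le_iSup₂ (f := fun x (_ : x ∈ S) => ⨅ y ∈ T, d x y) x hx).trans_lt h
  simp only [iInf_lt_iff] at h1
  obtain ⟨y, hy, h2⟩ := h1
  exact ⟨y, hy, h2⟩

theorem hausdorffExcess_eq_zero_of_subset (hd : ∀ x, d x x = 0) (h : S ⊆ T) :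
    hausdorffExcess d S T = 0 :=
  nonpos_iff_eq_zero.1 (hausdorffExcess_le fun x hx => ⟨x, h hx, (hd x).le⟩)

end Hausdorff

/-! ### The extent of a tunnel -/

section Extent

theorem pullbackStates_subset {A B : Type*} [CStarAlgebra A] [CStarAlgebra B]
    (π : A →⋆ₐ[ℂ] B) : pullbackStates π ⊆ stateSpace A := by
  rw [pullbackStates_eq]
  rintro _ ⟨φ, hφ, rfl⟩
  exact pullbackState_mem π hφ

/-- Pulled-back states are states, so one of the two excesses vanishes. -/
theorem hausdorffDistOf_pullbackStates {A B : Type*} [CStarAlgebra A] [CStarAlgebra B]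
    (lip : selfAdjoint A → ℝ≥0∞) (π : A →⋆ₐ[ℂ] B) :
    hausdorffDistOf (mongeKantorovich lip) (pullbackStates π) (stateSpace A) =
      hausdorffExcess (mongeKantorovich lip) (stateSpace A) (pullbackStates π) := by
  rw [hausdorffDistOf, hausdorffExcess_eq_zero_of_subset mongeKantorovich_self
    (pullbackStates_subset π)]
  exact max_eq_right zero_le

/-- Every state of `A` is at distance at most `r` from a state that factors through `π`. -/
def StatesWithin {A B : Type*} [CStarAlgebra A] [CStarAlgebra B]
    (lip : selfAdjoint A → ℝ≥0∞) (π : A →⋆ₐ[ℂ] B) (r : ℝ≥0∞) : Prop :=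
  ∀ φ ∈ stateSpace A, ∃ ψ ∈ stateSpace B, mongeKantorovich lip φ (pullbackState π ψ) ≤ r

theorem hausdorffDistOf_pullbackStates_le {A B : Type*} [CStarAlgebra A] [CStarAlgebra B]
    {lip : selfAdjoint A → ℝ≥0∞} {π : A →⋆ₐ[ℂ] B} {r : ℝ≥0∞} (h : StatesWithin lip π r) :
    hausdorffDistOf (mongeKantorovich lip) (pullbackStates π) (stateSpace A) ≤ r := by
  rw [hausdorffDistOf_pullbackStates, pullbackStates_eq]
  refine hausdorffExcess_le fun φ hφ => ?_
  obtain ⟨ψ, hψ, h1⟩ := h φ hφ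
  exact ⟨_, ⟨ψ, hψ, rfl⟩, h1⟩

theorem statesWithin_of_lt {A B : Type*} [CStarAlgebra A] [CStarAlgebra B]
    {lip : selfAdjoint A → ℝ≥0∞} {π : A →⋆ₐ[ℂ] B} {r : ℝ≥0∞}
    (h : hausdorffDistOf (mongeKantorovich lip) (pullbackStates π) (stateSpace A) < r) :
    StatesWithin lip π r := by
  rw [hausdorffDistOf_pullbackStates, pullbackStates_eq] at h
  intro φ hφ
  obtain ⟨_, ⟨ψ, hψ, rfl⟩, h1⟩ := exists_lt_of_hausdorffExcess_lt h hφ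
  exact ⟨ψ, hψ, h1.le⟩

variable {F K G H : ℝ} {M₁ M₂ : PreMetricalCorrespondence.{u, v, w}}

/-- All four conditions that bound the extent of a tunnel by `r`. -/
structure MetricalTunnel.ExtentWithin (τ : MetricalTunnel F K G H M₁ M₂) (r : ℝ≥0∞) : Prop where
  A₁ : StatesWithin τ.P.lipA τ.iso₁.mapA r
  A₂ : StatesWithin τ.P.lipA τ.iso₂.mapA r
  B₁ : StatesWithin τ.P.lipB τ.iso₁.mapB r
  B₂ : StatesWithin τ.P.lipB τ.iso₂.mapB r

theorem MetricalTunnel.ExtentWithin.extent_le {τ : MetricalTunnel F K G H M₁ M₂} {r : ℝ≥0∞}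
    (h : τ.ExtentWithin r) : τ.extent ≤ r :=
  max_le (max_le (hausdorffDistOf_pullbackStates_le h.A₁) (hausdorffDistOf_pullbackStates_le h.B₁))
    (max_le (hausdorffDistOf_pullbackStates_le h.A₂) (hausdorffDistOf_pullbackStates_le h.B₂))

theorem MetricalTunnel.extentWithin_of_lt {τ : MetricalTunnel F K G H M₁ M₂} {r : ℝ≥0∞}
    (h : τ.extent < r) : τ.ExtentWithin r := by
  rw [extent, max_lt_iff, ModularQuantumIsometry.extent, ModularQuantumIsometry.extent,
    max_lt_iff, max_lt_iff] at h
  exact ⟨statesWithin_of_lt h.1.1, statesWithin_of_lt h.2.1, statesWithin_of_lt h.1.2,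
    statesWithin_of_lt h.2.2⟩

end Extent

/-! ### Separation and dispersion for spectral triples -/

section Separation

variable {F K G H : ℝ} {T₁ T₂ : SpectralTriple.{u, v}}

/-- The identity is the only state of `ℂ`, so pseudo-states are plain inner products. -/
theorem SpectralTriple.mem_pseudoStates {T : SpectralTriple.{u, v}} {φ : T.H →L[ℂ] ℂ} :
    φ ∈ T.toMetrical.pseudoStates ↔ ∃ ξ : T.H, graphNorm T.D ξ ≤ 1 ∧ φ = innerSL ℂ ξ := by
  constructor
  · rintro ⟨μ, hμ, ω, hω, h⟩
    exact ⟨ω, hω, ContinuousLinearMap.ext fun ξ => (h ξ).trans (stateSpace_complex hμ _)⟩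
  · rintro ⟨ξ, hξ, rfl⟩
    obtain ⟨μ, hμ⟩ := stateSpace_nonempty (A := ℂ)
    exact ⟨μ, hμ, ξ, hξ, fun η => (stateSpace_complex hμ _).symm⟩

namespace SpectralTunnel

/-- The left module map of a tunnel. -/
def map₁ (τ : SpectralTunnel F K G H T₁ T₂) : τ.P.M →L[ℂ] T₁.H := τ.iso₁.mapM

/-- The right module map of a tunnel. -/
def map₂ (τ : SpectralTunnel F K G H T₁ T₂) : τ.P.M →L[ℂ] T₂.H := τ.iso₂.mapM

/-- The functionals `⟨ξ, a j (Π₁ ·)⟩` and `⟨η, b j (Π₂ ·)⟩` are at distance at most `r`. -/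
def FunctionalsWithin (τ : SpectralTunnel F K G H T₁ T₂) {J : Type*}
    (a : J → T₁.H →L[ℂ] T₁.H) (b : J → T₂.H →L[ℂ] T₂.H) (r : ℝ≥0∞) (ξ : T₁.H) (η : T₂.H) : Prop :=
  ∀ j ω, τ.P.dnorm ω ≤ 1 →
    ‖(inner ℂ ξ (a j (τ.map₁ ω)) : ℂ) - inner ℂ η (b j (τ.map₂ ω))‖ₑ ≤ r

variable {τ : SpectralTunnel F K G H T₁ T₂} {J : Type*}
  {a : J → T₁.H →L[ℂ] T₁.H} {b : J → T₂.H →L[ℂ] T₂.H} {r : ℝ≥0∞}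

theorem familyDist_le_iff {ξ : T₁.H} {η : T₂.H} :
    τ.P.familyDist (fun j => innerSL ℂ ξ ∘L a j ∘L τ.map₁) (fun j => innerSL ℂ η ∘L b j ∘L τ.map₂)
      ≤ r ↔ τ.FunctionalsWithin a b r ξ η := by
  simp only [PreMetricalCorrespondence.familyDist, PreMetricalCorrespondence.dualDist, iSup_le_iff]
  rfl

theorem familyDist_comm {P : PreMetricalCorrespondence.{u, v, w}} (φ ψ : J → P.M →L[ℂ] ℂ) :
    P.familyDist φ ψ = P.familyDist ψ φ := by
  simp only [PreMetricalCorrespondence.familyDist, PreMetricalCorrespondence.dualDist,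
    ← enorm_neg (φ _ _ - ψ _ _), neg_sub]

theorem separation_le
    (h₁ : ∀ ξ, graphNorm T₁.D ξ ≤ 1 → ∃ η, graphNorm T₂.D η ≤ 1 ∧ τ.FunctionalsWithin a b r ξ η)
    (h₂ : ∀ η, graphNorm T₂.D η ≤ 1 → ∃ ξ, graphNorm T₁.D ξ ≤ 1 ∧
      τ.FunctionalsWithin a b r ξ η) :
    MetricalTunnel.separation τ a b ≤ r := by
  refine max_le (hausdorffExcess_le ?_) (hausdorffExcess_le ?_)
  · rintro _ ⟨φ, hφ, rfl⟩
    obtain ⟨ξ, hξ, rfl⟩ := SpectralTriple.mem_pseudoStates.1 hφ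
    obtain ⟨η, hη, h⟩ := h₁ ξ hξ
    have hm := SpectralTriple.mem_pseudoStates.2 ⟨η, hη, rfl⟩
    exact ⟨_, ⟨_, hm, rfl⟩, familyDist_le_iff.2 h⟩
  · rintro _ ⟨φ, hφ, rfl⟩
    obtain ⟨η, hη, rfl⟩ := SpectralTriple.mem_pseudoStates.1 hφ
    obtain ⟨ξ, hξ, h⟩ := h₂ η hη
    have hm := SpectralTriple.mem_pseudoStates.2 ⟨ξ, hξ, rfl⟩
    exact ⟨_, ⟨_, hm, rfl⟩, (familyDist_comm _ _).trans_le (familyDist_le_iff.2 h)⟩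

theorem exists_of_separation_lt_left (h : MetricalTunnel.separation τ a b < r) {ξ : T₁.H}
    (hξ : graphNorm T₁.D ξ ≤ 1) :
    ∃ η, graphNorm T₂.D η ≤ 1 ∧ τ.FunctionalsWithin a b r ξ η := by
  have hm := SpectralTriple.mem_pseudoStates.2 ⟨ξ, hξ, rfl⟩
  obtain ⟨_, ⟨ψ, hψ, rfl⟩, h1⟩ := exists_lt_of_hausdorffExcess_lt ((le_max_left _ _).trans_lt h)
    ⟨_, hm, rfl⟩
  obtain ⟨η, hη, rfl⟩ := SpectralTriple.mem_pseudoStates.1 hψ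
  exact ⟨η, hη, familyDist_le_iff.1 h1.le⟩

theorem exists_of_separation_lt_right (h : MetricalTunnel.separation τ a b < r) {η : T₂.H}
    (hη : graphNorm T₂.D η ≤ 1) :
    ∃ ξ, graphNorm T₁.D ξ ≤ 1 ∧ τ.FunctionalsWithin a b r ξ η := by
  have hm := SpectralTriple.mem_pseudoStates.2 ⟨η, hη, rfl⟩
  obtain ⟨_, ⟨ψ, hψ, rfl⟩, h1⟩ := exists_lt_of_hausdorffExcess_lt ((le_max_right _ _).trans_lt h)
    ⟨_, hm, rfl⟩
  obtain ⟨ξ, hξ, rfl⟩ := SpectralTriple.mem_pseudoStates.1 hψ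
  exact ⟨ξ, hξ, familyDist_le_iff.1 ((familyDist_comm _ _).trans_le h1.le)⟩

theorem FunctionalsWithin.symm {ξ : T₁.H} {η : T₂.H} (h : τ.FunctionalsWithin a b r ξ η) :
    SpectralTunnel.FunctionalsWithin (MetricalTunnel.symm τ) b a r η ξ := by
  intro j ω hω
  rw [← enorm_neg, neg_sub]
  exact h j ω hω

theorem ExtentWithin.symm (h : MetricalTunnel.ExtentWithin τ r) :
    (MetricalTunnel.symm τ).ExtentWithin r := ⟨h.A₂, h.A₁, h.B₂, h.B₁⟩

/-- The data of a tunnel with dispersion less than `r`. -/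
structure DispersionWithin (τ : SpectralTunnel F K G H T₁ T₂) {J : Type*}
    (a : J → T₁.H →L[ℂ] T₁.H) (b : J → T₂.H →L[ℂ] T₂.H) (r : ℝ≥0∞) : Prop where
  extent : MetricalTunnel.ExtentWithin τ r
  left : ∀ ξ, graphNorm T₁.D ξ ≤ 1 →
    ∃ η, graphNorm T₂.D η ≤ 1 ∧ τ.FunctionalsWithin a b r ξ η
  right : ∀ η, graphNorm T₂.D η ≤ 1 →
    ∃ ξ, graphNorm T₁.D ξ ≤ 1 ∧ τ.FunctionalsWithin a b r ξ η

theorem dispersionWithin_of_lt (h : MetricalTunnel.dispersion τ a b < r) :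
    DispersionWithin τ a b r := by
  have h' := max_lt_iff.1 h
  exact ⟨MetricalTunnel.extentWithin_of_lt h'.1,
    fun ξ hξ => exists_of_separation_lt_left h'.2 hξ,
    fun η hη => exists_of_separation_lt_right h'.2 hη⟩

theorem DispersionWithin.dispersion_le (h : DispersionWithin τ a b r) :
    MetricalTunnel.dispersion τ a b ≤ r :=
  max_le h.extent.extent_le (separation_le h.left h.right)

theorem DispersionWithin.symm (h : DispersionWithin τ a b r) :
    DispersionWithin (MetricalTunnel.symm τ) b a r where
  extent := ExtentWithin.symm h.extent
  left η hη := by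
    obtain ⟨ξ, hξ, h⟩ := h.right η hη
    exact ⟨ξ, hξ, h.symm⟩
  right ξ hξ := by
    obtain ⟨η, hη, h⟩ := h.left ξ hξ
    exact ⟨η, hη, h.symm⟩

theorem dispersion_symm :
    MetricalTunnel.dispersion (MetricalTunnel.symm τ) b a = MetricalTunnel.dispersion τ a b := by
  have key : ∀ {T₁ T₂ : SpectralTriple.{u, v}} {τ : SpectralTunnel F K G H T₁ T₂}
      {a : J → T₁.H →L[ℂ] T₁.H} {b : J → T₂.H →L[ℂ] T₂.H},
      MetricalTunnel.dispersion (MetricalTunnel.symm τ) b a ≤ MetricalTunnel.dispersion τ a b := by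
    intro T₁ T₂ τ a b
    refine le_of_forall_gt fun r hr => ?_
    obtain ⟨s, h1, h2⟩ := exists_between hr
    exact (dispersionWithin_of_lt h1).symm.dispersion_le.trans_lt h2
  exact le_antisymm key (key (τ := MetricalTunnel.symm τ))

end SpectralTunnel

end Separation

/-! ### Unitary equivalences -/

namespace SpectralTriple

/-- `(V, π)` is a unitary equivalence. -/
structure IsUnitaryEquivalence (T₁ T₂ : SpectralTriple.{u, v}) (V : T₁.H ≃ₗᵢ[ℂ] T₂.H)
    (π : T₁.A ≃⋆ₐ[ℂ] T₂.A) : Prop where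
  mem_domain : ∀ ξ, V ξ ∈ T₂.D.domain ↔ ξ ∈ T₁.D.domain
  map_dirac : ∀ ξ (h : ξ ∈ T₁.D.domain) (h' : V ξ ∈ T₂.D.domain),
    T₂.D ⟨V ξ, h'⟩ = V (T₁.D ⟨ξ, h⟩)
  map_rep : ∀ a ξ, T₂.rep (π a) (V ξ) = V (T₁.rep a ξ)

theorem unitarilyEquivalent_iff {T₁ T₂ : SpectralTriple.{u, v}} :
    T₁.UnitarilyEquivalent T₂ ↔ ∃ V π, IsUnitaryEquivalence T₁ T₂ V π := by
  constructor
  · rintro ⟨V, π, h1, h2, h3⟩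
    refine ⟨V, π, fun ξ => ?_, fun ξ h h' => (h2 ⟨ξ, h⟩ ⟨V ξ, h'⟩ rfl).symm, h3⟩
    rw [← h1]
    constructor
    · rintro ⟨ζ, hζ, e⟩
      rwa [← V.injective e]
    · exact fun h => ⟨ξ, h, rfl⟩
  · rintro ⟨V, π, h⟩
    refine ⟨V, π, ?_, fun ξ η e => ?_, h.map_rep⟩
    · ext η
      constructor
      · rintro ⟨ξ, hξ, rfl⟩
        exact (h.mem_domain ξ).2 hξ
      · intro hη
        refine ⟨V.symm η, (h.mem_domain _).1 ?_, V.apply_symm_apply η⟩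
        rwa [V.apply_symm_apply]
    · have h' : V ξ ∈ T₂.D.domain := (h.mem_domain ξ).2 ξ.2
      have := h.map_dirac ξ ξ.2 h'
      rw [← this]
      congr 1
      exact Subtype.ext e

namespace IsUnitaryEquivalence

variable {T₁ T₂ : SpectralTriple.{u, v}} {V : T₁.H ≃ₗᵢ[ℂ] T₂.H} {π : T₁.A ≃⋆ₐ[ℂ] T₂.A}

theorem refl (T : SpectralTriple.{u, v}) :
    IsUnitaryEquivalence T T (LinearIsometryEquiv.refl ℂ T.H) (StarAlgEquiv.refl ℂ T.A) :=
  ⟨fun _ => Iff.rfl, fun _ _ _ => rfl, fun _ _ => rfl⟩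

theorem symm (h : IsUnitaryEquivalence T₁ T₂ V π) :
    IsUnitaryEquivalence T₂ T₁ V.symm π.symm := by
  refine ⟨fun ξ => ?_, fun ξ hξ hξ' => ?_, fun a ξ => ?_⟩
  · rw [← h.mem_domain, V.apply_symm_apply]
  · apply V.injective
    have e := V.apply_symm_apply ξ
    have hm : V (V.symm ξ) ∈ T₂.D.domain := by rwa [e]
    rw [← h.map_dirac _ hξ' hm]
    exact (congrArg (fun x : T₂.D.domain => T₂.D x) (Subtype.ext e)).trans
      (V.apply_symm_apply _).symm
  · apply V.injective
    rw [← h.map_rep, V.apply_symm_apply, V.apply_symm_apply, π.apply_symm_apply]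

theorem graphNorm_eq (h : IsUnitaryEquivalence T₁ T₂ V π) (ξ : T₁.H) :
    graphNorm T₂.D (V ξ) = graphNorm T₁.D ξ := by
  by_cases hξ : ξ ∈ T₁.D.domain
  · have hξ' := (h.mem_domain ξ).2 hξ
    rw [graphNorm_of_mem hξ, graphNorm_of_mem hξ', h.map_dirac ξ hξ, ← ofReal_norm, ← ofReal_norm,
      V.norm_map, V.norm_map, ofReal_norm, ofReal_norm]
  · rw [graphNorm_of_notMem hξ, graphNorm_of_notMem (fun h' => hξ ((h.mem_domain ξ).1 h'))]

theorem commutatorNorm_le (h : IsUnitaryEquivalence T₁ T₂ V π) (a : T₁.A) :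
    commutatorNorm T₂.D (T₂.rep (π a)) ≤ commutatorNorm T₁.D (T₁.rep a) := by
  refine le_iInf₂ fun C hC => iInf₂_le C fun η => ?_
  obtain ⟨ξ, hξ⟩ := V.surjective η
  have hη : V ξ ∈ T₂.D.domain := by rw [hξ]; exact η.2
  obtain rfl : (⟨V ξ, hη⟩ : T₂.D.domain) = η := Subtype.ext hξ
  have hξm := (h.mem_domain ξ).1 hη
  obtain ⟨hm, hle⟩ := hC ⟨ξ, hξm⟩
  have hm' := (h.mem_domain _).2 hm
  have e : T₂.rep (π a) (V ξ) = V (T₁.rep a ξ) := h.map_rep a ξ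
  have hm2 : T₂.rep (π a) (V ξ) ∈ T₂.D.domain := by rw [e]; exact hm'
  refine ⟨hm2, ?_⟩
  have e1 : (⟨T₂.rep (π a) (V ξ), hm2⟩ : T₂.D.domain) = ⟨V (T₁.rep a ξ), hm'⟩ := Subtype.ext e
  rw [e1, h.map_dirac _ hm, h.map_dirac _ hξm, h.map_rep, ← map_sub, V.norm_map]
  exact hle.trans_eq (by rw [V.norm_map])

theorem commutatorNorm_eq (h : IsUnitaryEquivalence T₁ T₂ V π) (a : T₁.A) :
    commutatorNorm T₂.D (T₂.rep (π a)) = commutatorNorm T₁.D (T₁.rep a) := by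
  refine le_antisymm (h.commutatorNorm_le a) ?_
  have := h.symm.commutatorNorm_le (π a)
  rwa [π.symm_apply_apply] at this

/-- `V` carries eigenvectors to eigenvectors with the same eigenvalue, hence with the same phases;
totality does the rest. -/
theorem U_apply (h : IsUnitaryEquivalence T₁ T₂ V π) (t : ℝ) (ξ : T₁.H) :
    T₂.U t (V ξ) = V (T₁.U t ξ) := by
  obtain ⟨R, hR, hc⟩ := T₁.exists_isResolvent
  have : T₂.U t ∘L (V.toContinuousLinearEquiv : T₁.H →L[ℂ] T₂.H) =
      (V.toContinuousLinearEquiv : T₁.H →L[ℂ] T₂.H) ∘L T₁.U t := by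
    refine hR.clm_ext T₁.isSelfAdjoint hc fun s ζ hζ => ?_
    obtain ⟨hm, e⟩ := mem_diracEigenspace.1 hζ
    have hm' := (h.mem_domain ζ).2 hm
    have hVζ : V ζ ∈ diracEigenspace T₂.D s :=
      mem_diracEigenspace.2 ⟨hm', by rw [h.map_dirac ζ hm hm', e, map_smul]⟩
    change diracGroup T₂.D T₂.isSelfAdjoint t (V ζ) = V (diracGroup T₁.D T₁.isSelfAdjoint t ζ)
    rw [diracGroup_apply_of_mem _ t hVζ, diracGroup_apply_of_mem _ t hζ, map_smul]
  exact DFunLike.congr_fun this ξ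

theorem lip_eq (h : IsUnitaryEquivalence T₁ T₂ V π) {d : selfAdjoint T₁.A}
    {a : selfAdjoint T₂.A} (e : π (d : T₁.A) = a) : T₂.lip a = T₁.lip d := by
  change commutatorNorm T₂.D (T₂.rep (a : T₂.A)) = commutatorNorm T₁.D (T₁.rep (d : T₁.A))
  rw [← e, h.commutatorNorm_eq]

theorem lip_eq_iInf (h : IsUnitaryEquivalence T₁ T₂ V π) (a : selfAdjoint T₂.A) :
    T₂.lip a = ⨅ (d : selfAdjoint T₁.A) (_ : π (d : T₁.A) = a), T₁.lip d := by
  refine le_antisymm (le_iInf₂ fun d e => (h.lip_eq e).le) ?_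
  have hs : IsSelfAdjoint (π.symm (a : T₂.A)) := by
    rw [IsSelfAdjoint, ← map_star]
    exact congrArg _ a.2
  exact iInf₂_le_of_le (⟨π.symm (a : T₂.A), hs⟩ : selfAdjoint T₁.A)
    (π.apply_symm_apply (a : T₂.A)) (h.lip_eq (π.apply_symm_apply (a : T₂.A))).ge

theorem graphNorm_eq_iInf (h : IsUnitaryEquivalence T₁ T₂ V π) (η : T₂.H) :
    graphNorm T₂.D η = ⨅ (ω : T₁.H) (_ : V ω = η), graphNorm T₁.D ω := by
  refine le_antisymm (le_iInf₂ fun ω e => ?_) ?_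
  · rw [← e, h.graphNorm_eq]
  · exact iInf₂_le_of_le (V.symm η) (V.apply_symm_apply η) (h.symm.graphNorm_eq η).le

/-- The quantum isometry of a unitary equivalence. -/
noncomputable def quantumIsometry (h : IsUnitaryEquivalence T₁ T₂ V π) :
    ModularQuantumIsometry T₁.toMetrical T₂.toMetrical where
  mapM := (V.toContinuousLinearEquiv : T₁.H →L[ℂ] T₂.H)
  mapA := (π : T₁.A →⋆ₐ[ℂ] T₂.A)
  mapB := StarAlgHom.id ℂ ℂ
  map_lact a ω := (h.map_rep a ω).symm
  map_ract ω b := V.toContinuousLinearEquiv.map_smul (b : ℂ) ω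
  map_ip ω η := (V.inner_map_map ω η).symm
  map_domA _ _ e hd := (h.lip_eq e).trans_lt hd
  map_domB _ _ _ _ := ENNReal.zero_lt_top
  map_domM ω hω := (h.graphNorm_eq ω).trans_lt hω
  lipA_eq a _ := h.lip_eq_iInf a
  lipB_eq b _ := le_antisymm zero_le (iInf₂_le_of_le b rfl le_rfl)
  dnorm_eq η _ := h.graphNorm_eq_iInf η

theorem statesWithin_mapA (T₁ T₂ : SpectralTriple.{u, v}) (π : T₁.A ≃⋆ₐ[ℂ] T₂.A) :
    StatesWithin T₁.lip (π : T₁.A →⋆ₐ[ℂ] T₂.A) 0 := by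
  intro φ hφ
  refine ⟨pullbackState (π.symm : T₂.A →⋆ₐ[ℂ] T₁.A) φ, pullbackState_mem _ hφ, ?_⟩
  have : pullbackState (π : T₁.A →⋆ₐ[ℂ] T₂.A)
      (pullbackState (π.symm : T₂.A →⋆ₐ[ℂ] T₁.A) φ) = φ := by
    refine DFunLike.ext _ _ fun a => ?_
    rw [pullbackState_apply, pullbackState_apply]
    exact congrArg φ (π.symm_apply_apply a)
  rw [this, mongeKantorovich_self]

theorem statesWithin_mapB : StatesWithin (0 : selfAdjoint ℂ → ℝ≥0∞) (StarAlgHom.id ℂ ℂ) 0 :=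
  fun φ hφ => ⟨φ, hφ, (mongeKantorovich_self (lip := 0) φ).le⟩

/-- The tunnel of a unitary equivalence. -/
noncomputable def tunnel (h : IsUnitaryEquivalence T₁ T₂ V π) (hT : T₁.IsMetric) {F K G H : ℝ}
    (hF : 1 ≤ F) (hK : 0 ≤ K) (hG : 1 ≤ G) : SpectralTunnel F K G H T₁ T₂ :=
  ⟨T₁.toMetrical, T₁.isMetrical_toMetrical hT hF hK hG, (refl T₁).quantumIsometry,
    h.quantumIsometry⟩

/-- The partner of `ξ` is `V ξ`, and the corresponding functionals coincide exactly because `V`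
intertwines the groups. -/
theorem dispersion_tunnel (h : IsUnitaryEquivalence T₁ T₂ V π) (hT : T₁.IsMetric) {F K G H : ℝ}
    (hF : 1 ≤ F) (hK : 0 ≤ K) (hG : 1 ≤ G) {J : Type*} (t : J → ℝ) :
    MetricalTunnel.dispersion (h.tunnel hT hF hK hG : SpectralTunnel F K G H T₁ T₂)
      (fun j => T₁.U (t j)) (fun j => T₂.U (t j)) = 0 := by
  have hw : ∀ ξ, SpectralTunnel.FunctionalsWithin
      (h.tunnel hT hF hK hG : SpectralTunnel F K G H T₁ T₂)
      (fun j => T₁.U (t j)) (fun j => T₂.U (t j)) 0 ξ (V ξ) := by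
    intro ξ j (ω : T₁.H) _
    change ‖(inner ℂ ξ (T₁.U (t j) ω) : ℂ) - inner ℂ (V ξ) (T₂.U (t j) (V ω))‖ₑ ≤ 0
    rw [h.U_apply, V.inner_map_map, sub_self, enorm_zero]
  refine nonpos_iff_eq_zero.1 (SpectralTunnel.DispersionWithin.dispersion_le
    ⟨⟨statesWithin_mapA T₁ T₁ (StarAlgEquiv.refl ℂ T₁.A), statesWithin_mapA T₁ T₂ π, statesWithin_mapB, statesWithin_mapB⟩,
      fun ξ hξ => ⟨V ξ, by rwa [h.graphNorm_eq], hw ξ⟩, fun η hη => ⟨V.symm η, ?_, ?_⟩⟩)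
  · rwa [h.symm.graphNorm_eq]
  · have := hw (V.symm η)
    rwa [V.apply_symm_apply] at this

end IsUnitaryEquivalence

end SpectralTriple

/-! ### Comparison of the two propinquities -/

/-- The squared norm of the image is `‖θ ⟨ω, ω⟩‖`, and ⋆-morphisms are contractive. -/
theorem ModularQuantumIsometry.norm_mapM_le {P : PreMetricalCorrespondence.{u, v, w}}
    {Q : PreMetricalCorrespondence.{u', v', w'}} (f : ModularQuantumIsometry P Q) (ω : P.M) :
    ‖f.mapM ω‖ ≤ ‖ω‖ := by
  rw [Q.norm_eq, P.norm_eq, ← f.map_ip]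
  exact Real.sqrt_le_sqrt (NonUnitalStarAlgHom.norm_apply_le f.mapB _)

namespace SpectralTunnel

variable {F K G H : ℝ} {T₁ T₂ : SpectralTriple.{u, v}} {τ : SpectralTunnel F K G H T₁ T₂}

theorem norm_map₂_le (ω : τ.P.M) : ‖τ.map₂ ω‖ ≤ ‖ω‖ := τ.iso₂.norm_mapM_le ω

theorem norm_le_one_of_dnorm_le_one {ω : τ.P.M} (h : τ.P.dnorm ω ≤ 1) : ‖ω‖ ≤ 1 := by
  have := (τ.isMetrical.norm_le_dnorm ω).trans h
  rwa [← ofReal_norm, ENNReal.ofReal_le_one] at this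

/-- The functionals `⟨U₁^{-t} ξ, Π₁ ·⟩` and `⟨U₂^{-ς t} η, Π₂ ·⟩`, for `t` in `[0, 1/ε]`, are
at distance at most `r`. -/
def OrbitsWithin (τ : SpectralTunnel F K G H T₁ T₂) (ε : ℝ) (ς : ℝ≥0 → ℝ≥0) (r : ℝ≥0∞) (ξ : T₁.H)
    (η : T₂.H) : Prop :=
  ∀ (t : timeInterval ε) (ω : τ.P.M), τ.P.dnorm ω ≤ 1 →
    ‖(inner ℂ (T₁.U (-(t : ℝ≥0)) ξ) (τ.map₁ ω) : ℂ) - inner ℂ (T₂.U (-(ς t)) η) (τ.map₂ ω)‖ₑ ≤ r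

variable {ε : ℝ} {ς : ℝ≥0 → ℝ≥0} {r : ℝ≥0∞}

theorem orbit_familyDist_le_iff {ξ : T₁.H} {η : T₂.H} :
    τ.P.familyDist (fun t : timeInterval ε => innerSL ℂ (T₁.U (-(t : ℝ≥0)) ξ) ∘L τ.map₁)
      (fun t : timeInterval ε => innerSL ℂ (T₂.U (-(ς t)) η) ∘L τ.map₂) ≤ r ↔
      τ.OrbitsWithin ε ς r ξ η := by
  simp only [PreMetricalCorrespondence.familyDist, PreMetricalCorrespondence.dualDist, iSup_le_iff]
  rfl

theorem halfReach_le (h : ∀ ξ, graphNorm T₁.D ξ ≤ 1 → ∃ η, graphNorm T₂.D η ≤ 1 ∧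
    τ.OrbitsWithin ε ς r ξ η) : τ.halfReach ε ς ≤ r := by
  refine hausdorffExcess_le ?_
  rintro _ ⟨ξ, hξ, rfl⟩
  obtain ⟨η, hη, h⟩ := h ξ hξ
  exact ⟨_, ⟨η, hη, rfl⟩, orbit_familyDist_le_iff.2 h⟩

theorem exists_of_halfReach_lt (h : τ.halfReach ε ς < r) {ξ : T₁.H} (hξ : graphNorm T₁.D ξ ≤ 1) :
    ∃ η, graphNorm T₂.D η ≤ 1 ∧ τ.OrbitsWithin ε ς r ξ η := by
  obtain ⟨_, ⟨η, hη, rfl⟩, h1⟩ := exists_lt_of_hausdorffExcess_lt h ⟨ξ, hξ, rfl⟩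
  exact ⟨η, hη, orbit_familyDist_le_iff.1 h1.le⟩

theorem FunctionalsWithin.orbitsWithin {ξ : T₁.H} {η : T₂.H}
    (h : τ.FunctionalsWithin (fun t : timeInterval ε => T₁.U (t : ℝ≥0))
      (fun t : timeInterval ε => T₂.U (t : ℝ≥0)) r ξ η) : τ.OrbitsWithin ε id r ξ η := by
  intro t ω hω
  rw [T₁.U_inner, id, T₂.U_inner]
  exact h t ω hω

theorem isIsoIso_id (hε : 0 < ε) : IsIsoIso ε id id :=
  ⟨rfl, rfl, fun x _ y _ z _ => by simpa using hε, fun x _ y _ z _ => by simpa using hε⟩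

theorem magnitude_le_of_dispersionWithin
    (h : DispersionWithin τ (fun t : timeInterval ε => T₁.U (t : ℝ≥0))
      (fun t : timeInterval ε => T₂.U (t : ℝ≥0)) r) : τ.magnitude ε id id ≤ r := by
  refine max_le h.extent.extent_le (max_le (halfReach_le fun ξ hξ => ?_)
    (halfReach_le fun ξ hξ => ?_))
  · obtain ⟨η, hη, h1⟩ := h.left ξ hξ
    exact ⟨η, hη, h1.orbitsWithin⟩
  · obtain ⟨η, hη, h1⟩ := h.symm.left ξ hξ
    exact ⟨η, hη, h1.orbitsWithin⟩

/-- A time change that stays within `ε` of the identity costs at most `ε`. -/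
theorem OrbitsWithin.functionalsWithin {ξ : T₁.H} {η : T₂.H} {δ : ℝ}
    (hδ : 0 < δ) (hς : ∀ t ∈ timeInterval ε, |(t : ℝ) - ς t| ≤ δ) (hη : graphNorm T₂.D η ≤ 1)
    {ε' : ℝ} (hε' : timeInterval ε' ⊆ timeInterval ε)
    (h : τ.OrbitsWithin ε ς r ξ η) : τ.FunctionalsWithin (fun t : timeInterval ε' => T₁.U (t : ℝ≥0))
      (fun t : timeInterval ε' => T₂.U (t : ℝ≥0)) (r + ENNReal.ofReal δ) ξ η := by
  intro t ω hω
  have ht := hε' t.2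
  change ‖(inner ℂ ξ (T₁.U (t : ℝ≥0) (τ.map₁ ω)) : ℂ)
    - inner ℂ η (T₂.U (t : ℝ≥0) (τ.map₂ ω))‖ₑ ≤ _
  rw [← T₁.U_inner, ← T₂.U_inner, ← sub_add_sub_cancel _
    (inner ℂ (T₂.U (-(ς t)) η) (τ.map₂ ω) : ℂ) _]
  refine (enorm_add_le _ _).trans (add_le_add (h ⟨t, ht⟩ ω hω) ?_)
  rw [← inner_sub_left, enorm_le_ofReal_iff hδ.le]
  refine (norm_inner_le_norm _ _).trans ?_
  have h1 : ‖T₂.U (-(ς t : ℝ)) η - T₂.U (-((t : ℝ≥0) : ℝ)) η‖ ≤ δ := by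
    refine (T₂.norm_U_sub_le _ _ hη).trans ?_
    rw [neg_sub_neg]
    exact hς t ht
  have h2 : ‖τ.map₂ ω‖ ≤ 1 := (norm_map₂_le ω).trans (norm_le_one_of_dnorm_le_one hω)
  calc _ ≤ δ * 1 := mul_le_mul h1 h2 (norm_nonneg _) hδ.le
    _ = δ := mul_one δ

end SpectralTunnel

theorem IsIsoIso.symm {ε : ℝ} {ς₁ ς₂ : ℝ≥0 → ℝ≥0} (h : IsIsoIso ε ς₁ ς₂) : IsIsoIso ε ς₂ ς₁ :=
  ⟨h.map_zero₂, h.map_zero₁, h.dist_lt₂, h.dist_lt₁⟩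

theorem IsIsoIso.abs_sub_le {ε : ℝ} (hε : 0 < ε) {ς₁ ς₂ : ℝ≥0 → ℝ≥0} (h : IsIsoIso ε ς₁ ς₂)
    {t : ℝ≥0} (ht : t ∈ timeInterval ε) : |(t : ℝ) - ς₁ t| ≤ ε := by
  have h0 : (0 : ℝ≥0) ∈ timeInterval ε := by
    change ((0 : ℝ≥0) : ℝ) ≤ 1 / ε
    simpa using hε.le
  -- With `y = z = 0`, both fixed at zero by the iso-iso, its defining inequality reads `|ς₁ t - t|
  -- < ε`.
  have := h.dist_lt₁ t ht 0 h0 0 h0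
  rw [h.map_zero₁, h.map_zero₂] at this
  simp only [NNReal.coe_zero, add_zero, sub_zero, NNReal.abs_eq] at this
  rw [abs_sub_comm]
  exact this.le

section Propinquity

variable {F K G H : ℝ}

theorem sInf_insert_nonneg {S : Set ℝ} (hS : ∀ ε ∈ S, 0 < ε) : 0 ≤ sInf ({√2 / 2} ∪ S) := by
  refine Real.sInf_nonneg ?_
  rintro ε (rfl | h)
  · positivity
  · exact (hS ε h).le

theorem sInf_insert_le {S : Set ℝ} (hS : ∀ ε ∈ S, 0 < ε) {ε : ℝ} (h : ε ∈ ({√2 / 2} ∪ S : Set ℝ)) :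
    sInf ({√2 / 2} ∪ S) ≤ ε := by
  refine csInf_le ⟨0, ?_⟩ h
  rintro ε (rfl | h)
  · positivity
  · exact (hS ε h).le

variable (T₁ T₂ : MetricSpectralTriple.{u, v})

theorem spectralPropinquityStar_nonneg : 0 ≤ spectralPropinquityStar F K G H T₁ T₂ :=
  sInf_insert_nonneg fun _ h => h.1

theorem spectralPropinquityStar_le_sqrt : spectralPropinquityStar F K G H T₁ T₂ ≤ √2 / 2 :=
  sInf_insert_le (fun _ h => h.1) (Or.inl rfl)

variable {T₁ T₂}

theorem spectralPropinquityStar_le {ε : ℝ} (hε : 0 < ε)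
    (τ : SpectralTunnel F K G H T₁.toSpectralTriple T₂.toSpectralTriple)
    (h : MetricalTunnel.dispersion τ (fun t : timeInterval ε => T₁.U (t : ℝ≥0))
        (fun t : timeInterval ε => T₂.U (t : ℝ≥0)) < ENNReal.ofReal ε) :
    spectralPropinquityStar F K G H T₁ T₂ ≤ ε :=
  sInf_insert_le (fun _ h => h.1) (Or.inr ⟨hε, τ, h⟩)

theorem spectralPropinquityStar_comm :
    spectralPropinquityStar F K G H T₁ T₂ = spectralPropinquityStar F K G H T₂ T₁ := by
  have key : ∀ {T₁ T₂ : MetricSpectralTriple.{u, v}},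
      spectralPropinquityStar F K G H T₁ T₂ ≤ spectralPropinquityStar F K G H T₂ T₁ := by
    intro T₁ T₂
    refine le_csInf ⟨_, Or.inl rfl⟩ ?_
    rintro ε (rfl | ⟨hε, τ, hτ⟩)
    · exact spectralPropinquityStar_le_sqrt T₁ T₂
    · exact spectralPropinquityStar_le hε (MetricalTunnel.symm τ)
        (SpectralTunnel.dispersion_symm.trans_lt hτ)
  exact le_antisymm key key

theorem spectralPropinquity_le_spectralPropinquityStar :
    spectralPropinquity F K G H T₁ T₂ ≤ spectralPropinquityStar F K G H T₁ T₂ := by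
  refine le_csInf ⟨_, Or.inl rfl⟩ ?_
  rintro ε (rfl | ⟨hε, τ, hτ⟩)
  · exact sInf_insert_le (fun _ h => h.1) (Or.inl rfl)
  · obtain ⟨r, h1, h2⟩ := exists_between hτ
    exact sInf_insert_le (fun _ h => h.1) (Or.inr ⟨hε, τ, id, id, SpectralTunnel.isIsoIso_id hε,
      (SpectralTunnel.magnitude_le_of_dispersionWithin
        (SpectralTunnel.dispersionWithin_of_lt h1)).trans_lt h2⟩)

/-- Replacing both time changes of an `ε`-iso-iso by the identity adds at most `ε` to a magnitude
below `ε`; the total stays below `2ε`, on the shorter interval `[0, 1/(2ε)]`. -/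
theorem spectralPropinquityStar_le_two_mul :
    spectralPropinquityStar F K G H T₁ T₂ ≤ 2 * spectralPropinquity F K G H T₁ T₂ := by
  rw [← div_le_iff₀' two_pos]
  refine le_csInf ⟨_, Or.inl rfl⟩ ?_
  rintro ε (rfl | ⟨hε, τ, ς₁, ς₂, hς, hτ⟩)
  · have h1 := spectralPropinquityStar_le_sqrt (F := F) (K := K) (G := G) (H := H) T₁ T₂
    have h2 := spectralPropinquityStar_nonneg (F := F) (K := K) (G := G) (H := H) T₁ T₂
    linarith
  rw [div_le_iff₀' two_pos]
  obtain ⟨r, h1, h2⟩ := exists_between hτ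
  have h3 := max_lt_iff.1 h1
  have h4 := max_lt_iff.1 h3.2
  have hsub : timeInterval (2 * ε) ⊆ timeInterval ε := fun t ht => by
    refine le_trans (show (t : ℝ) ≤ 1 / (2 * ε) from ht) ?_
    exact one_div_le_one_div_of_le hε (by linarith)
  refine spectralPropinquityStar_le (by positivity) τ ?_
  refine (SpectralTunnel.DispersionWithin.dispersion_le (r := r + ENNReal.ofReal ε)
    ⟨?_, fun ξ hξ => ?_, fun η hη => ?_⟩).trans_lt ?_
  · exact MetricalTunnel.extentWithin_of_lt (h3.1.trans_le le_self_add)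
  · obtain ⟨η, hη, h⟩ := SpectralTunnel.exists_of_halfReach_lt h4.1 hξ
    exact ⟨η, hη, h.functionalsWithin hε (fun t ht => hς.abs_sub_le hε ht) hη hsub⟩
  -- The second half of the reach concerns the reversed tunnel, with the roles of the two time
  -- changes exchanged.
  · obtain ⟨ξ, hξ, h⟩ := SpectralTunnel.exists_of_halfReach_lt h4.2 hη
    exact ⟨ξ, hξ, (h.functionalsWithin hε (fun t ht => hς.symm.abs_sub_le hε ht) hξ hsub).symm⟩
  · rw [two_mul, ENNReal.ofReal_add hε.le hε.le]
    exact ENNReal.add_lt_add_right ENNReal.ofReal_ne_top h2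

theorem spectralPropinquityStar_eq_zero_of_unitarilyEquivalent (hF : 1 ≤ F) (hK : 0 ≤ K)
    (hG : 1 ≤ G) (h : T₁.toSpectralTriple.UnitarilyEquivalent T₂.toSpectralTriple) :
    spectralPropinquityStar F K G H T₁ T₂ = 0 := by
  obtain ⟨V, π, h⟩ := SpectralTriple.unitarilyEquivalent_iff.1 h
  refine le_antisymm (le_of_forall_pos_le_add fun ε hε => ?_) (spectralPropinquityStar_nonneg _ _)
  rw [zero_add]
  refine spectralPropinquityStar_le hε (h.tunnel T₁.isMetric hF hK hG) ?_
  rw [h.dispersion_tunnel]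
  simpa using hε

end Propinquity

/-! ### Gluing quantum compact metric spaces -/

/-! ### States of a product algebra -/

section Prod

variable {A B : Type*} [CStarAlgebra A] [CStarAlgebra B]

/-- The first component of a self-adjoint element. -/
def selfAdjointFst (d : selfAdjoint (A × B)) : selfAdjoint A :=
  ⟨(d : A × B).1, congrArg Prod.fst d.2⟩

/-- The second component of a self-adjoint element. -/
def selfAdjointSnd (d : selfAdjoint (A × B)) : selfAdjoint B :=
  ⟨(d : A × B).2, congrArg Prod.snd d.2⟩

/-- The self-adjoint element with the given components. -/
def selfAdjointPair (a : selfAdjoint A) (b : selfAdjoint B) : selfAdjoint (A × B) :=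
  ⟨((a : A), (b : B)), Prod.ext a.2 b.2⟩

theorem selfAdjointFst_realPart (x : A × B) : selfAdjointFst (ℜ x) = ℜ x.1 :=
  Subtype.ext (by
    change ((ℜ x : A × B)).1 = (ℜ x.1 : A)
    rw [realPart_apply_coe, realPart_apply_coe]; rfl)

theorem selfAdjointSnd_realPart (x : A × B) : selfAdjointSnd (ℜ x) = ℜ x.2 :=
  Subtype.ext (by
    change ((ℜ x : A × B)).2 = (ℜ x.2 : B)
    rw [realPart_apply_coe, realPart_apply_coe]; rfl)

theorem selfAdjointFst_imaginaryPart (x : A × B) : selfAdjointFst (ℑ x) = ℑ x.1 :=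
  Subtype.ext (by
    change ((ℑ x : A × B)).1 = (ℑ x.1 : A)
    rw [imaginaryPart_apply_coe, imaginaryPart_apply_coe]; rfl)

theorem selfAdjointSnd_imaginaryPart (x : A × B) : selfAdjointSnd (ℑ x) = ℑ x.2 :=
  Subtype.ext (by
    change ((ℑ x : A × B)).2 = (ℑ x.2 : B)
    rw [imaginaryPart_apply_coe, imaginaryPart_apply_coe]; rfl)

theorem continuous_selfAdjointFst :
    Continuous (selfAdjointFst : selfAdjoint (A × B) → selfAdjoint A) :=
  Continuous.subtype_mk (continuous_fst.comp continuous_subtype_val) _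

theorem continuous_selfAdjointSnd :
    Continuous (selfAdjointSnd : selfAdjoint (A × B) → selfAdjoint B) :=
  Continuous.subtype_mk (continuous_snd.comp continuous_subtype_val) _

theorem continuous_selfAdjointPair :
    Continuous fun p : selfAdjoint A × selfAdjoint B => selfAdjointPair p.1 p.2 :=
  Continuous.subtype_mk ((continuous_subtype_val.comp continuous_fst).prodMk
    (continuous_subtype_val.comp continuous_snd)) _

theorem enorm_fst_le {E F : Type*} [SeminormedAddCommGroup E] [SeminormedAddCommGroup F]
    (x : E × F) : ‖x.1‖ₑ ≤ ‖x‖ₑ := by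
  rw [← ofReal_norm, ← ofReal_norm]; exact ENNReal.ofReal_le_ofReal (norm_fst_le x)

theorem enorm_snd_le {E F : Type*} [SeminormedAddCommGroup E] [SeminormedAddCommGroup F]
    (x : E × F) : ‖x.2‖ₑ ≤ ‖x‖ₑ := by
  rw [← ofReal_norm, ← ofReal_norm]; exact ENNReal.ofReal_le_ofReal (norm_snd_le x)

/-- A positive functional is a multiple of a state. -/
theorem exists_eq_smul_state [Nontrivial A] (f : WeakDual ℂ A) (hf : ∀ a, 0 ≤ f (star a * a)) :
    ∃ r : ℝ, 0 ≤ r ∧ ∃ ψ ∈ stateSpace A, ∀ a, f a = r * ψ a := by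
  have h1 : 0 ≤ f 1 := by simpa using hf 1
  have e1 : f 1 = ((f 1).re : ℂ) := Complex.ext (by simp) (by simpa using (Complex.nonneg_iff.1 h1).2.symm)
  rcases eq_or_ne (f 1) 0 with h0 | h0
  · obtain ⟨ψ, hψ⟩ := stateSpace_nonempty (A := A)
    refine ⟨0, le_rfl, ψ, hψ, fun a => ?_⟩
    have hsa : ∀ b : selfAdjoint A, f (b : A) = 0 := by
      intro b
      have hn : ∀ c : selfAdjoint A, 0 ≤ f (c : A) := fun c => by
        obtain ⟨x, hx⟩ := exists_star_mul_self_eq_norm_add c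
        have := hf x
        rwa [← hx, map_add, map_smul, h0, smul_zero, zero_add] at this
      have h2 := hn (-b)
      have e : f ((-b : selfAdjoint A) : A) = -f (b : A) := map_neg f _
      rw [e] at h2
      exact le_antisymm (neg_nonneg.1 h2) (hn b)
    rw [stateSpace_apply_decomp, hsa, hsa]; simp
  · refine ⟨(f 1).re, (Complex.nonneg_iff.1 h1).1, (f 1)⁻¹ • f, ⟨?_, fun a => ?_⟩, fun a => ?_⟩
    · exact inv_mul_cancel₀ h0
    · have h3 : (0 : ℂ) ≤ (f 1)⁻¹ := by
        rw [e1, ← Complex.ofReal_inv]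
        exact_mod_cast inv_nonneg.2 (Complex.nonneg_iff.1 h1).1
      exact mul_nonneg h3 (hf a)
    · rw [← e1]
      exact (mul_inv_cancel_left₀ h0 (f a)).symm

/-- A state of a product is a convex combination of states of the factors. -/
theorem exists_convex_combination [Nontrivial A] [Nontrivial B] {φ : WeakDual ℂ (A × B)}
    (hφ : φ ∈ stateSpace (A × B)) : ∃ t s : ℝ, 0 ≤ t ∧ 0 ≤ s ∧ t + s = 1 ∧
      ∃ φ₁ ∈ stateSpace A, ∃ φ₂ ∈ stateSpace B, ∀ d, φ d = t * φ₁ d.1 + s * φ₂ d.2 := by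
  let f₁ : WeakDual ℂ A := StrongDual.toWeakDual
    ((WeakDual.toStrongDual φ) ∘L ContinuousLinearMap.inl ℂ A B)
  let f₂ : WeakDual ℂ B := StrongDual.toWeakDual
    ((WeakDual.toStrongDual φ) ∘L ContinuousLinearMap.inr ℂ A B)
  have h₁ : ∀ a, f₁ a = φ (a, 0) := fun _ => rfl
  have h₂ : ∀ b, f₂ b = φ (0, b) := fun _ => rfl
  obtain ⟨t, ht, φ₁, hφ₁, e₁⟩ := exists_eq_smul_state f₁ fun a => by
    have := hφ.2 (a, 0)
    rw [h₁]
    convert this using 2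
    exact Prod.ext rfl (by simp)
  obtain ⟨s, hs, φ₂, hφ₂, e₂⟩ := exists_eq_smul_state f₂ fun b => by
    have := hφ.2 (0, b)
    rw [h₂]
    convert this using 2
    exact Prod.ext (by simp) rfl
  have key : ∀ d, φ d = t * φ₁ d.1 + s * φ₂ d.2 := fun d => by
    rw [← e₁, ← e₂, h₁, h₂, ← map_add]
    congr 1
    exact Prod.ext (by simp) (by simp)
  refine ⟨t, s, ht, hs, ?_, φ₁, hφ₁, φ₂, hφ₂, key⟩
  have := key 1
  rw [hφ.1, Prod.fst_one, Prod.snd_one, hφ₁.1, hφ₂.1, mul_one, mul_one] at this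
  exact_mod_cast this.symm

/-- The Monge-Kantorovich distance is jointly convex and states of a product are convex combinations
of states of the factors, so only the latter have to be approximated. -/
theorem statesWithin_prod [Nontrivial A] [Nontrivial B] {C : Type*} [CStarAlgebra C]
    {L : selfAdjoint (A × B) → ℝ≥0∞} {σ : (A × B) →⋆ₐ[ℂ] C} {r : ℝ≥0∞}
    (h₁ : ∀ φ ∈ stateSpace A, ∃ ψ ∈ stateSpace C,
      mongeKantorovich L (pullbackState (StarAlgHom.fst ℂ A B) φ) (pullbackState σ ψ) ≤ r)
    (h₂ : ∀ φ ∈ stateSpace B, ∃ ψ ∈ stateSpace C,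
      mongeKantorovich L (pullbackState (StarAlgHom.snd ℂ A B) φ) (pullbackState σ ψ) ≤ r) :
    StatesWithin L σ r := by
  intro φ hφ
  obtain ⟨t, s, ht, hs, hts, φ₁, hφ₁, φ₂, hφ₂, e⟩ := exists_convex_combination hφ
  obtain ⟨ψ₁, hψ₁, hr₁⟩ := h₁ φ₁ hφ₁
  obtain ⟨ψ₂, hψ₂, hr₂⟩ := h₂ φ₂ hφ₂
  let ψ : WeakDual ℂ C := (t : ℂ) • ψ₁ + (s : ℂ) • ψ₂
  have hψ : ∀ c, ψ c = t * ψ₁ c + s * ψ₂ c := fun _ => rfl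
  refine ⟨ψ, ⟨?_, fun a => ?_⟩, iSup₂_le fun d hd => ?_⟩
  · rw [hψ, hψ₁.1, hψ₂.1, mul_one, mul_one]; exact_mod_cast hts
  · rw [hψ]
    have h1 : (0 : ℂ) ≤ t := by exact_mod_cast ht
    have h2 : (0 : ℂ) ≤ s := by exact_mod_cast hs
    exact add_nonneg (mul_nonneg h1 (hψ₁.2 a)) (mul_nonneg h2 (hψ₂.2 a))
  · have g₁ : ‖φ₁ (d : A × B).1 - ψ₁ (σ d)‖ₑ ≤ r :=
      (le_iSup₂_of_le (f := fun (d : selfAdjoint (A × B)) (_ : L d ≤ 1) =>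
        ‖pullbackState (StarAlgHom.fst ℂ A B) φ₁ (d : A × B) - pullbackState σ ψ₁ (d : A × B)‖ₑ)
        d hd le_rfl).trans hr₁
    have g₂ : ‖φ₂ (d : A × B).2 - ψ₂ (σ d)‖ₑ ≤ r :=
      (le_iSup₂_of_le (f := fun (d : selfAdjoint (A × B)) (_ : L d ≤ 1) =>
        ‖pullbackState (StarAlgHom.snd ℂ A B) φ₂ (d : A × B) - pullbackState σ ψ₂ (d : A × B)‖ₑ)
        d hd le_rfl).trans hr₂
    have e' : φ (d : A × B) - pullbackState σ ψ (d : A × B) =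
        (t : ℂ) * (φ₁ (d : A × B).1 - ψ₁ (σ d)) + s * (φ₂ (d : A × B).2 - ψ₂ (σ d)) := by
      rw [pullbackState_apply, hψ, e]; ring
    rw [e']
    refine (enorm_add_le _ _).trans ?_
    rw [enorm_mul, enorm_mul, ← ofReal_norm, ← ofReal_norm (s : ℂ), Complex.norm_real,
      Complex.norm_real, Real.norm_of_nonneg ht, Real.norm_of_nonneg hs]
    calc _ ≤ ENNReal.ofReal t * r + ENNReal.ofReal s * r := by gcongr
      _ = r := by rw [← add_mul, ← ENNReal.ofReal_add ht hs, hts, ENNReal.ofReal_one, one_mul]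

end Prod

/-! ### The glued Lipschitz seminorm -/

section Glue

variable {D₁ D₂ A : Type*} [CStarAlgebra D₁] [CStarAlgebra D₂] [CStarAlgebra A]

/-- The seminorm on `D₁ × D₂` that glues `D₁` and `D₂` along quotient maps to `A`. -/
noncomputable def glueLip (ε : ℝ) (L₁ : selfAdjoint D₁ → ℝ≥0∞) (L₂ : selfAdjoint D₂ → ℝ≥0∞)
    (π₁ : D₁ →⋆ₐ[ℂ] A) (π₂ : D₂ →⋆ₐ[ℂ] A) (d : selfAdjoint (D₁ × D₂)) : ℝ≥0∞ :=
  max (max (L₁ (selfAdjointFst d)) (L₂ (selfAdjointSnd d)))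
    (ENNReal.ofReal ε⁻¹ * ‖π₁ (d : D₁ × D₂).1 - π₂ (d : D₁ × D₂).2‖ₑ)

variable {ε : ℝ} {L₁ : selfAdjoint D₁ → ℝ≥0∞} {L₂ : selfAdjoint D₂ → ℝ≥0∞}
  {π₁ : D₁ →⋆ₐ[ℂ] A} {π₂ : D₂ →⋆ₐ[ℂ] A} {F K : ℝ}

theorem le_glueLip_fst (d : selfAdjoint (D₁ × D₂)) :
    L₁ (selfAdjointFst d) ≤ glueLip ε L₁ L₂ π₁ π₂ d := (le_max_left _ _).trans (le_max_left _ _)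

theorem le_glueLip_snd (d : selfAdjoint (D₁ × D₂)) :
    L₂ (selfAdjointSnd d) ≤ glueLip ε L₁ L₂ π₁ π₂ d := (le_max_right _ _).trans (le_max_left _ _)

theorem le_glueLip_sub (d : selfAdjoint (D₁ × D₂)) :
    ENNReal.ofReal ε⁻¹ * ‖π₁ (d : D₁ × D₂).1 - π₂ (d : D₁ × D₂).2‖ₑ
      ≤ glueLip ε L₁ L₂ π₁ π₂ d := le_max_right _ _

theorem glueLip_lt_top_iff {d : selfAdjoint (D₁ × D₂)} :
    glueLip ε L₁ L₂ π₁ π₂ d < ∞ ↔ L₁ (selfAdjointFst d) < ∞ ∧ L₂ (selfAdjointSnd d) < ∞ := by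
  rw [glueLip, max_lt_iff, max_lt_iff]
  exact and_iff_left (ENNReal.mul_lt_top ENNReal.ofReal_lt_top enorm_lt_top)

theorem ofReal_inv_mul_le_one_iff (hε : 0 < ε) {x : ℝ≥0∞} :
    ENNReal.ofReal ε⁻¹ * x ≤ 1 ↔ x ≤ ENNReal.ofReal ε := by
  rw [ENNReal.ofReal_inv_of_pos hε, mul_comm, ← div_eq_mul_inv,
    ENNReal.div_le_iff (by simpa using hε) ENNReal.ofReal_ne_top, one_mul]

theorem glueLip_le_one_iff (hε : 0 < ε) {d : selfAdjoint (D₁ × D₂)} :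
    glueLip ε L₁ L₂ π₁ π₂ d ≤ 1 ↔ (L₁ (selfAdjointFst d) ≤ 1 ∧ L₂ (selfAdjointSnd d) ≤ 1) ∧
      ‖π₁ (d : D₁ × D₂).1 - π₂ (d : D₁ × D₂).2‖ ≤ ε := by
  rw [glueLip, max_le_iff, max_le_iff, ofReal_inv_mul_le_one_iff hε, enorm_le_ofReal_iff hε.le]

theorem enorm_starAlgHom_le {B C : Type*} [CStarAlgebra B] [CStarAlgebra C] (π : B →⋆ₐ[ℂ] C)
    (b : B) : ‖π b‖ₑ ≤ ‖b‖ₑ := by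
  rw [← ofReal_norm, ← ofReal_norm]
  exact ENNReal.ofReal_le_ofReal (NonUnitalStarAlgHom.norm_apply_le π b)

theorem continuous_starAlgHom {B C : Type*} [CStarAlgebra B] [CStarAlgebra C] (π : B →⋆ₐ[ℂ] C) :
    Continuous π :=
  AddMonoidHomClass.continuous_of_bound π 1 fun b => by
    rw [one_mul]; exact NonUnitalStarAlgHom.norm_apply_le π b

theorem starAlgHom_realPart {B C : Type*} [CStarAlgebra B] [CStarAlgebra C] (π : B →⋆ₐ[ℂ] C) (b : B) :
    π (ℜ b : B) = (ℜ (π b) : C) := by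
  rw [realPart_apply_coe, realPart_apply_coe, ← Complex.coe_smul, map_smul, map_add, map_star,
    Complex.coe_smul]

theorem starAlgHom_imaginaryPart {B C : Type*} [CStarAlgebra B] [CStarAlgebra C] (π : B →⋆ₐ[ℂ] C)
    (b : B) : π (ℑ b : B) = (ℑ (π b) : C) := by
  rw [imaginaryPart_apply_coe, imaginaryPart_apply_coe, map_smul, ← Complex.coe_smul, map_smul,
    map_sub, map_star, Complex.coe_smul]

/-- The map `(d₁, d₂) ↦ π₁ d₁ - π₂ d₂` is a derivation, with `d₂` acting on the left through `π₂`
and `d₁` on the right through `π₁`. The coupling term is therefore Leibniz with constant 1. -/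
theorem enorm_map_mul_sub_le (a b : D₁ × D₂) :
    ENNReal.ofReal ε⁻¹ * ‖π₁ (a * b).1 - π₂ (a * b).2‖ₑ ≤
      ENNReal.ofReal ε⁻¹ * ‖π₁ a.1 - π₂ a.2‖ₑ * ‖b‖ₑ
        + ‖a‖ₑ * (ENNReal.ofReal ε⁻¹ * ‖π₁ b.1 - π₂ b.2‖ₑ) := by
  have e : π₁ (a * b).1 - π₂ (a * b).2 =
      (π₁ a.1 - π₂ a.2) * π₁ b.1 + π₂ a.2 * (π₁ b.1 - π₂ b.2) := by
    rw [Prod.fst_mul, Prod.snd_mul, map_mul, map_mul]; noncomm_ring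
  have hmul : ∀ x y : A, ‖x * y‖ₑ ≤ ‖x‖ₑ * ‖y‖ₑ := fun x y => by
    simp only [enorm_eq_nnnorm]; exact_mod_cast nnnorm_mul_le x y
  have h1 : ‖π₁ b.1‖ₑ ≤ ‖b‖ₑ := (enorm_starAlgHom_le π₁ _).trans (enorm_fst_le b)
  have h2 : ‖π₂ a.2‖ₑ ≤ ‖a‖ₑ := (enorm_starAlgHom_le π₂ _).trans (enorm_snd_le a)
  rw [e]
  calc _ ≤ ENNReal.ofReal ε⁻¹ * (‖π₁ a.1 - π₂ a.2‖ₑ * ‖b‖ₑ + ‖a‖ₑ * ‖π₁ b.1 - π₂ b.2‖ₑ) := by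
        gcongr
        exact (enorm_add_le _ _).trans (add_le_add ((hmul _ _).trans (by gcongr))
          ((hmul _ _).trans (by gcongr)))
    _ = _ := by ring

/-- Rieffel's criterion applies once a single scalar `r`, subtracted from both components, brings
the Lipschitz ball into a compact set. The coupling term forces the scalars that suit the two
components to be close to each other. -/
theorem IsQuantumCompactMetricSpace.glue [Nontrivial A] (hF : 1 ≤ F) (hε : 0 < ε)
    (h₁ : IsQuantumCompactMetricSpace F K L₁) (h₂ : IsQuantumCompactMetricSpace F K L₂) :
    IsQuantumCompactMetricSpace F K (glueLip ε L₁ L₂ π₁ π₂) := by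
  obtain ⟨R₁, hR₁, hb₁⟩ := h₁.exists_norm_sub_le
  obtain ⟨R₂, hR₂, hb₂⟩ := h₂.exists_norm_sub_le
  have hc₁ := h₁.isCompact_lip_norm_le one_pos R₁
  -- The radius is `R₂` for `d₂ - s` plus the bound `R₁ + ε + R₂` for `|s - r|`.
  have hc₂ := h₂.isCompact_lip_norm_le one_pos (R₁ + ε + R₂ + R₂)
  -- Stated for an arbitrary `x`, so that it serves both the real and the imaginary part of the
  -- product.
  have hleib : ∀ (a b x : selfAdjoint (D₁ × D₂)),
      L₁ (selfAdjointFst x) ≤ ENNReal.ofReal F * (L₁ (selfAdjointFst a) * ‖(b : D₁ × D₂).1‖ₑ +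
        ‖(a : D₁ × D₂).1‖ₑ * L₁ (selfAdjointFst b)) +
        ENNReal.ofReal K * L₁ (selfAdjointFst a) * L₁ (selfAdjointFst b) →
      L₂ (selfAdjointSnd x) ≤ ENNReal.ofReal F * (L₂ (selfAdjointSnd a) * ‖(b : D₁ × D₂).2‖ₑ +
        ‖(a : D₁ × D₂).2‖ₑ * L₂ (selfAdjointSnd b)) +
        ENNReal.ofReal K * L₂ (selfAdjointSnd a) * L₂ (selfAdjointSnd b) →
      ‖π₁ (x : D₁ × D₂).1 - π₂ (x : D₁ × D₂).2‖ₑ ≤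
        ‖π₁ ((a : D₁ × D₂) * b).1 - π₂ ((a : D₁ × D₂) * b).2‖ₑ →
      glueLip ε L₁ L₂ π₁ π₂ x ≤ ENNReal.ofReal F * (glueLip ε L₁ L₂ π₁ π₂ a * ‖(b : D₁ × D₂)‖ₑ +
        ‖(a : D₁ × D₂)‖ₑ * glueLip ε L₁ L₂ π₁ π₂ b) +
        ENNReal.ofReal K * glueLip ε L₁ L₂ π₁ π₂ a * glueLip ε L₁ L₂ π₁ π₂ b := by
    intro a b x hx₁ hx₂ hx
    refine max_le (max_le (hx₁.trans ?_) (hx₂.trans ?_)) ?_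
    · gcongr
      exacts [le_glueLip_fst a, enorm_fst_le _, enorm_fst_le _, le_glueLip_fst b, le_glueLip_fst a,
        le_glueLip_fst b]
    · gcongr
      exacts [le_glueLip_snd a, enorm_snd_le _, enorm_snd_le _, le_glueLip_snd b, le_glueLip_snd a,
        le_glueLip_snd b]
    -- The coupling term uses only the constant `1 ≤ F`, and the summand with `K` is discarded.
    · refine le_trans (le_trans (by gcongr) (enorm_map_mul_sub_le (ε := ε) (a : D₁ × D₂) b)) ?_
      refine le_trans ?_ le_self_add
      rw [← one_mul (_ + _)]
      gcongr
      exacts [by simpa using hF, le_glueLip_sub a, le_glueLip_sub b]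
  refine of_isCompact (fun a b => ?_) (fun r a => ?_) ?_ ?_ (fun a b ha hb => ?_) ?_
    (C := (fun p : selfAdjoint D₁ × selfAdjoint D₂ => selfAdjointPair p.1 p.2) ''
      ({a | L₁ a ≤ ENNReal.ofReal 1 ∧ ‖(a : D₁)‖ ≤ R₁} ×ˢ
        {a | L₂ a ≤ ENNReal.ofReal 1 ∧ ‖(a : D₂)‖ ≤ R₁ + ε + R₂ + R₂}))
    ((hc₁.prod hc₂).image continuous_selfAdjointPair) (fun d hd => ?_)
  · refine max_le (max_le ?_ ?_) ?_
    · exact (h₁.add_le (selfAdjointFst a) (selfAdjointFst b)).trans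
        (add_le_add (le_glueLip_fst a) (le_glueLip_fst b))
    · exact (h₂.add_le (selfAdjointSnd a) (selfAdjointSnd b)).trans
        (add_le_add (le_glueLip_snd a) (le_glueLip_snd b))
    · refine le_trans ?_ (add_le_add (le_glueLip_sub a) (le_glueLip_sub b))
      rw [← mul_add]
      gcongr
      have e : π₁ ((a + b : selfAdjoint (D₁ × D₂)) : D₁ × D₂).1
          - π₂ ((a + b : selfAdjoint (D₁ × D₂)) : D₁ × D₂).2 =
          (π₁ (a : D₁ × D₂).1 - π₂ (a : D₁ × D₂).2) + (π₁ (b : D₁ × D₂).1 - π₂ (b : D₁ × D₂).2) := by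
        change π₁ ((a : D₁ × D₂).1 + (b : D₁ × D₂).1) - π₂ ((a : D₁ × D₂).2 + (b : D₁ × D₂).2) = _
        rw [map_add, map_add]; abel
      rw [e]
      exact enorm_add_le _ _
  · have e : π₁ ((r • a : selfAdjoint (D₁ × D₂)) : D₁ × D₂).1
        - π₂ ((r • a : selfAdjoint (D₁ × D₂)) : D₁ × D₂).2 =
        (r : ℂ) • (π₁ (a : D₁ × D₂).1 - π₂ (a : D₁ × D₂).2) := by
      change π₁ (r • (a : D₁ × D₂).1) - π₂ (r • (a : D₁ × D₂).2) = _
      rw [← Complex.coe_smul, ← Complex.coe_smul, map_smul, map_smul, smul_sub]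
    have hr : ‖(r : ℂ)‖ₑ = ‖r‖ₑ := by rw [← ofReal_norm, ← ofReal_norm, Complex.norm_real]
    have e₁ : L₁ (selfAdjointFst (r • a)) = ‖r‖ₑ * L₁ (selfAdjointFst a) := h₁.smul_eq r (selfAdjointFst a)
    have e₂ : L₂ (selfAdjointSnd (r • a)) = ‖r‖ₑ * L₂ (selfAdjointSnd a) := h₂.smul_eq r (selfAdjointSnd a)
    rw [glueLip, e₁, e₂, e, enorm_smul, hr, mul_left_comm, glueLip, mul_max, mul_max]
  · have hd := h₁.dense_dom.prod h₂.dense_dom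
    have hs : Function.Surjective
        (fun p : selfAdjoint D₁ × selfAdjoint D₂ => selfAdjointPair p.1 p.2) :=
      fun d => ⟨(selfAdjointFst d, selfAdjointSnd d), rfl⟩
    refine (hs.denseRange.dense_image continuous_selfAdjointPair hd).mono ?_
    rintro _ ⟨p, hp, rfl⟩
    exact glueLip_lt_top_iff.2 hp
  · have e₁ : L₁ (selfAdjointFst (1 : selfAdjoint (D₁ × D₂))) = 0 := h₁.lip_one
    have e₂ : L₂ (selfAdjointSnd (1 : selfAdjoint (D₁ × D₂))) = 0 := h₂.lip_one
    have e : π₁ ((1 : selfAdjoint (D₁ × D₂)) : D₁ × D₂).1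
        - π₂ ((1 : selfAdjoint (D₁ × D₂)) : D₁ × D₂).2 = 0 := by
      change π₁ 1 - π₂ 1 = 0
      rw [map_one, map_one, sub_self]
    rw [glueLip, e₁, e₂, e]; simp
  · obtain ⟨ha₁, ha₂⟩ := glueLip_lt_top_iff.1 ha
    obtain ⟨hb₁, hb₂⟩ := glueLip_lt_top_iff.1 hb
    have l₁ := max_le_iff.1 (h₁.leibniz _ _ ha₁ hb₁)
    have l₂ := max_le_iff.1 (h₂.leibniz _ _ ha₂ hb₂)
    refine max_le (hleib a b _ ?_ ?_ ?_) (hleib a b _ ?_ ?_ ?_)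
    · rw [selfAdjointFst_realPart]; exact l₁.1
    · rw [selfAdjointSnd_realPart]; exact l₂.1
    · have e : π₁ (ℜ ((a : D₁ × D₂) * b) : D₁ × D₂).1 - π₂ (ℜ ((a : D₁ × D₂) * b) : D₁ × D₂).2 =
          ((ℜ (π₁ ((a : D₁ × D₂) * b).1 - π₂ ((a : D₁ × D₂) * b).2) : selfAdjoint A) : A) := by
        rw [map_sub, AddSubgroupClass.coe_sub, ← starAlgHom_realPart, ← starAlgHom_realPart,
          ← selfAdjointFst_realPart, ← selfAdjointSnd_realPart]
        rfl
      rw [e, ← ofReal_norm, ← ofReal_norm]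
      exact ENNReal.ofReal_le_ofReal (realPart.norm_le _)
    · rw [selfAdjointFst_imaginaryPart]; exact l₁.2
    · rw [selfAdjointSnd_imaginaryPart]; exact l₂.2
    · have e : π₁ (ℑ ((a : D₁ × D₂) * b) : D₁ × D₂).1 - π₂ (ℑ ((a : D₁ × D₂) * b) : D₁ × D₂).2 =
          ((ℑ (π₁ ((a : D₁ × D₂) * b).1 - π₂ ((a : D₁ × D₂) * b).2) : selfAdjoint A) : A) := by
        rw [map_sub, AddSubgroupClass.coe_sub, ← starAlgHom_imaginaryPart, ← starAlgHom_imaginaryPart,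
          ← selfAdjointFst_imaginaryPart, ← selfAdjointSnd_imaginaryPart]
        rfl
      rw [e, ← ofReal_norm, ← ofReal_norm]
      exact ENNReal.ofReal_le_ofReal (imaginaryPart.norm_le _)
  · have : {d | glueLip ε L₁ L₂ π₁ π₂ d ≤ 1} = (selfAdjointFst ⁻¹' {a | L₁ a ≤ 1} ∩
        selfAdjointSnd ⁻¹' {a | L₂ a ≤ 1}) ∩
        {d | ‖π₁ (d : D₁ × D₂).1 - π₂ (d : D₁ × D₂).2‖ ≤ ε} := by
      ext d; exact glueLip_le_one_iff hε
    rw [this]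
    refine ((h₁.isClosed_ball.preimage continuous_selfAdjointFst).inter
      (h₂.isClosed_ball.preimage continuous_selfAdjointSnd)).inter (isClosed_le ?_ continuous_const)
    exact (((continuous_starAlgHom π₁).comp (continuous_fst.comp continuous_subtype_val)).sub
      ((continuous_starAlgHom π₂).comp (continuous_snd.comp continuous_subtype_val))).norm
  · obtain ⟨⟨hd₁, hd₂⟩, hd₃⟩ := (glueLip_le_one_iff hε).1 hd
    obtain ⟨r, hr⟩ := hb₁ _ hd₁
    obtain ⟨s, hs⟩ := hb₂ _ hd₂
    have hrs : |s - r| ≤ R₁ + ε + R₂ := by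
      -- In the middle algebra `s - r` is `π₁ (d₁ - r) - (π₁ d₁ - π₂ d₂) - π₂ (d₂ - s)`; the three
      -- terms are bounded by `R₁`, `ε` and `R₂`.
      have e : ((s - r : ℝ) : ℂ) • (1 : A) =
          π₁ ((selfAdjointFst d - r • 1 : selfAdjoint D₁) : D₁)
            - (π₁ (d : D₁ × D₂).1 - π₂ (d : D₁ × D₂).2)
            - π₂ ((selfAdjointSnd d - s • 1 : selfAdjoint D₂) : D₂) := by
        change _ = π₁ ((d : D₁ × D₂).1 - r • (1 : D₁)) - _ - π₂ ((d : D₁ × D₂).2 - s • (1 : D₂))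
        rw [← Complex.coe_smul, ← Complex.coe_smul, map_sub, map_sub, map_smul, map_smul, map_one,
          map_one, Complex.ofReal_sub, sub_smul]
        abel
      have h1 : ‖((s - r : ℝ) : ℂ) • (1 : A)‖ = |s - r| := by
        rw [norm_smul, Complex.norm_real, CStarRing.norm_one, mul_one, Real.norm_eq_abs]
      rw [← h1, e]
      refine (norm_sub_le _ _).trans (add_le_add ((norm_sub_le _ _).trans (add_le_add ?_ hd₃)) ?_)
      · exact (NonUnitalStarAlgHom.norm_apply_le π₁ _).trans hr
      · exact (NonUnitalStarAlgHom.norm_apply_le π₂ _).trans hs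
    refine ⟨r, ⟨(selfAdjointFst d - r • 1, selfAdjointSnd d - r • 1), ⟨⟨?_, hr⟩, ⟨?_, ?_⟩⟩, rfl⟩⟩
    · rw [ENNReal.ofReal_one]
      exact (h₁.lip_sub_smul_one_le _ _).trans hd₁
    · rw [ENNReal.ofReal_one]
      exact (h₂.lip_sub_smul_one_le _ _).trans hd₂
    · have e : ((selfAdjointSnd d - r • 1 : selfAdjoint D₂) : D₂) =
          ((selfAdjointSnd d - s • 1 : selfAdjoint D₂) : D₂) + (s - r) • (1 : D₂) := by
        change (d : D₁ × D₂).2 - r • (1 : D₂) = (d : D₁ × D₂).2 - s • (1 : D₂) + _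
        rw [sub_smul]; abel
      have h1 : ‖(s - r) • (1 : D₂)‖ ≤ |s - r| := by
        rw [norm_smul, Real.norm_eq_abs]
        refine mul_le_of_le_one_right (abs_nonneg _) ?_
        rcases subsingleton_or_nontrivial D₂ with h | h
        · rw [Subsingleton.elim (1 : D₂) 0, norm_zero]; exact zero_le_one
        · exact CStarRing.norm_one.le
      change ‖((selfAdjointSnd d - r • 1 : selfAdjoint D₂) : D₂)‖ ≤ _
      rw [e]
      refine (norm_add_le _ _).trans ?_
      linarith

theorem mongeKantorovich_fst_le (φ ψ : WeakDual ℂ D₁) :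
    mongeKantorovich (glueLip ε L₁ L₂ π₁ π₂) (pullbackState (StarAlgHom.fst ℂ D₁ D₂) φ)
      (pullbackState (StarAlgHom.fst ℂ D₁ D₂) ψ) ≤ mongeKantorovich L₁ φ ψ :=
  iSup₂_le fun d hd => le_iSup₂_of_le (selfAdjointFst d) ((le_glueLip_fst d).trans hd) le_rfl

theorem mongeKantorovich_snd_le (φ ψ : WeakDual ℂ D₂) :
    mongeKantorovich (glueLip ε L₁ L₂ π₁ π₂) (pullbackState (StarAlgHom.snd ℂ D₁ D₂) φ)
      (pullbackState (StarAlgHom.snd ℂ D₁ D₂) ψ) ≤ mongeKantorovich L₂ φ ψ :=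
  iSup₂_le fun d hd => le_iSup₂_of_le (selfAdjointSnd d) ((le_glueLip_snd d).trans hd) le_rfl

/-- The coupling term exists for this estimate: it makes the two pullbacks of a state of the common
quotient `ε`-close. -/
theorem mongeKantorovich_middle_le (hε : 0 < ε) {χ : WeakDual ℂ A} (hχ : χ ∈ stateSpace A) :
    mongeKantorovich (glueLip ε L₁ L₂ π₁ π₂)
      (pullbackState (StarAlgHom.fst ℂ D₁ D₂) (pullbackState π₁ χ))
      (pullbackState (StarAlgHom.snd ℂ D₁ D₂) (pullbackState π₂ χ)) ≤ ENNReal.ofReal ε := by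
  refine iSup₂_le fun d hd => ?_
  have h := ((glueLip_le_one_iff hε).1 hd).2
  have hs : IsSelfAdjoint (π₁ (d : D₁ × D₂).1 - π₂ (d : D₁ × D₂).2) := by
    refine IsSelfAdjoint.sub ?_ ?_
    · rw [IsSelfAdjoint, ← map_star]; exact congrArg π₁ (selfAdjointFst d).2
    · rw [IsSelfAdjoint, ← map_star]; exact congrArg π₂ (selfAdjointSnd d).2
  rw [enorm_le_ofReal_iff hε.le]
  change ‖χ (π₁ (d : D₁ × D₂).1) - χ (π₂ (d : D₁ × D₂).2)‖ ≤ ε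
  rw [← map_sub]
  exact (stateSpace_norm_apply_le hχ ⟨_, hs⟩).trans h

/-- A state of the far factor `D₂` moves by `r₂` to one that factors through `A`, by `ε` across the
coupling to a state of `D₁`, and by `r₁` to one that factors through `ρ`. -/
theorem statesWithin_glue_fst [Nontrivial D₁] [Nontrivial D₂] {C : Type*} [CStarAlgebra C]
    (hε : 0 < ε) {ρ : D₁ →⋆ₐ[ℂ] C} {r₁ r₂ : ℝ≥0∞}
    (h₁ : StatesWithin L₁ ρ r₁) (h₂ : StatesWithin L₂ π₂ r₂) :
    StatesWithin (glueLip ε L₁ L₂ π₁ π₂) (ρ.comp (StarAlgHom.fst ℂ D₁ D₂))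
      (r₁ + r₂ + ENNReal.ofReal ε) := by
  refine statesWithin_prod (fun φ hφ => ?_) (fun φ hφ => ?_)
  · obtain ⟨ψ, hψ, h⟩ := h₁ φ hφ
    refine ⟨ψ, hψ, ((mongeKantorovich_fst_le φ (pullbackState ρ ψ)).trans h).trans ?_⟩
    rw [add_assoc]; exact le_self_add
  · obtain ⟨χ, hχ, h⟩ := h₂ φ hφ
    obtain ⟨ψ, hψ, h'⟩ := h₁ (pullbackState π₁ χ) (pullbackState_mem π₁ hχ)
    refine ⟨ψ, hψ, (mongeKantorovich_triangle _
      (pullbackState (StarAlgHom.snd ℂ D₁ D₂) (pullbackState π₂ χ)) _).trans ?_⟩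
    have e : r₁ + r₂ + ENNReal.ofReal ε = r₂ + (ENNReal.ofReal ε + r₁) := by ring
    rw [e]
    refine add_le_add ((mongeKantorovich_snd_le _ _).trans h) ?_
    refine (mongeKantorovich_triangle _
      (pullbackState (StarAlgHom.fst ℂ D₁ D₂) (pullbackState π₁ χ)) _).trans (add_le_add ?_ ?_)
    · rw [mongeKantorovich_comm]; exact mongeKantorovich_middle_le hε hχ
    · exact (mongeKantorovich_fst_le _ (pullbackState ρ ψ)).trans h'

theorem statesWithin_glue_snd [Nontrivial D₁] [Nontrivial D₂] {C : Type*} [CStarAlgebra C]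
    (hε : 0 < ε) {ρ : D₂ →⋆ₐ[ℂ] C} {r₁ r₂ : ℝ≥0∞}
    (h₁ : StatesWithin L₁ π₁ r₁) (h₂ : StatesWithin L₂ ρ r₂) :
    StatesWithin (glueLip ε L₁ L₂ π₁ π₂) (ρ.comp (StarAlgHom.snd ℂ D₁ D₂))
      (r₁ + r₂ + ENNReal.ofReal ε) := by
  refine statesWithin_prod (fun φ hφ => ?_) (fun φ hφ => ?_)
  · obtain ⟨χ, hχ, h⟩ := h₁ φ hφ
    obtain ⟨ψ, hψ, h'⟩ := h₂ (pullbackState π₂ χ) (pullbackState_mem π₂ hχ)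
    refine ⟨ψ, hψ, (mongeKantorovich_triangle _
      (pullbackState (StarAlgHom.fst ℂ D₁ D₂) (pullbackState π₁ χ)) _).trans ?_⟩
    have e : r₁ + r₂ + ENNReal.ofReal ε = r₁ + (ENNReal.ofReal ε + r₂) := by ring
    rw [e]
    refine add_le_add ((mongeKantorovich_fst_le _ _).trans h) ?_
    exact (mongeKantorovich_triangle _
      (pullbackState (StarAlgHom.snd ℂ D₁ D₂) (pullbackState π₂ χ)) _).trans
      (add_le_add (mongeKantorovich_middle_le hε hχ)
        ((mongeKantorovich_snd_le _ (pullbackState ρ ψ)).trans h'))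
  · obtain ⟨ψ, hψ, h⟩ := h₂ φ hφ
    refine ⟨ψ, hψ, ((mongeKantorovich_snd_le φ (pullbackState ρ ψ)).trans h).trans ?_⟩
    rw [add_comm r₁, add_assoc]; exact le_self_add

end Glue

/-! ### Lifts along quantum isometries -/

theorem exists_lift_of_eq_iInf {X : Type*} {q : X → Prop} {L : X → ℝ≥0∞} {c δ : ℝ≥0∞}
    (hc : c < ∞) (hδ : δ ≠ 0) (h : c = ⨅ (x : X) (_ : q x), L x) : ∃ x, q x ∧ L x ≤ c + δ := by
  have h1 : ⨅ (x : X) (_ : q x), L x < c + δ := by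
    rw [← h]; exact ENNReal.lt_add_right hc.ne hδ
  simp only [iInf_lt_iff] at h1
  obtain ⟨x, hx, h2⟩ := h1
  exact ⟨x, hx, h2.le⟩

/-- Transitivity of quotient seminorms: `p` does not increase the seminorm, and elements lift along
`p` with arbitrarily small loss. -/
theorem iInf_eq_iInf_of_lift {X X₁ : Type*} {p : X → X₁} {q : X₁ → Prop} {L : X → ℝ≥0∞}
    {L₁ : X₁ → ℝ≥0∞} (h₁ : ∀ x, L₁ (p x) ≤ L x)
    (h₂ : ∀ x₁, L₁ x₁ < ∞ → ∀ δ : ℝ≥0∞, δ ≠ 0 → ∃ x, p x = x₁ ∧ L x ≤ L₁ x₁ + δ) :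
    ⨅ (x₁ : X₁) (_ : q x₁), L₁ x₁ = ⨅ (x : X) (_ : q (p x)), L x := by
  refine le_antisymm (le_iInf₂ fun x hx => iInf₂_le_of_le (p x) hx (h₁ x)) ?_
  refine le_iInf₂ fun x₁ hx₁ => ?_
  rcases eq_or_ne (L₁ x₁) ∞ with h | h
  · rw [h]; exact le_top
  refine ENNReal.le_of_forall_pos_le_add fun δ hδ _ => ?_
  obtain ⟨x, rfl, hx⟩ := h₂ x₁ (lt_top_iff_ne_top.2 h) δ (by exact_mod_cast hδ.ne')
  exact iInf₂_le_of_le x hx₁ hx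

namespace ModularQuantumIsometry

variable {P : PreMetricalCorrespondence.{u, v, w}} {Q : PreMetricalCorrespondence.{u', v', w'}}
  (f : ModularQuantumIsometry P Q)

/-- The restriction of a ⋆-morphism to self-adjoint elements. -/
def _root_.selfAdjointMap {A B : Type*} [CStarAlgebra A] [CStarAlgebra B] (π : A →⋆ₐ[ℂ] B)
    (a : selfAdjoint A) : selfAdjoint B :=
  ⟨π a, by rw [selfAdjoint.mem_iff, ← map_star]; exact congrArg π a.2⟩

/-- The quotient formula is available only on the domain, so that the domain is preserved has to be
used first. -/
theorem lipA_map_le {d : selfAdjoint P.A} (h : P.lipA d < ∞) :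
    Q.lipA (selfAdjointMap f.mapA d) ≤ P.lipA d := by
  rw [f.lipA_eq _ (f.map_domA d _ rfl h)]
  exact iInf₂_le_of_le d rfl le_rfl

theorem lipB_map_le {d : selfAdjoint P.B} (h : P.lipB d < ∞) :
    Q.lipB (selfAdjointMap f.mapB d) ≤ P.lipB d := by
  rw [f.lipB_eq _ (f.map_domB d _ rfl h)]
  exact iInf₂_le_of_le d rfl le_rfl

theorem dnorm_map_le {ω : P.M} (h : P.dnorm ω < ∞) : Q.dnorm (f.mapM ω) ≤ P.dnorm ω := by
  rw [f.dnorm_eq _ (f.map_domM ω h)]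
  exact iInf₂_le_of_le ω rfl le_rfl

theorem exists_liftA {a : selfAdjoint Q.A} (h : Q.lipA a < ∞) {δ : ℝ≥0∞} (hδ : δ ≠ 0) :
    ∃ d : selfAdjoint P.A, f.mapA d = a ∧ P.lipA d ≤ Q.lipA a + δ :=
  exists_lift_of_eq_iInf h hδ (f.lipA_eq a h)

theorem exists_liftB {a : selfAdjoint Q.B} (h : Q.lipB a < ∞) {δ : ℝ≥0∞} (hδ : δ ≠ 0) :
    ∃ d : selfAdjoint P.B, f.mapB d = a ∧ P.lipB d ≤ Q.lipB a + δ :=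
  exists_lift_of_eq_iInf h hδ (f.lipB_eq a h)

theorem exists_liftM {η : Q.M} (h : Q.dnorm η < ∞) {δ : ℝ≥0∞} (hδ : δ ≠ 0) :
    ∃ ω : P.M, f.mapM ω = η ∧ P.dnorm ω ≤ Q.dnorm η + δ :=
  exists_lift_of_eq_iInf h hδ (f.dnorm_eq η h)

end ModularQuantumIsometry

/-! ### Composition of tunnels -/

/-- The direct product of two C⋆-correspondences. -/
noncomputable def CStarCorrespondence.prod (C₁ C₂ : CStarCorrespondence.{u, v, w}) :
    CStarCorrespondence.{u, v, w} where
  A := C₁.A × C₂.A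
  M := C₁.M × C₂.M
  B := C₁.B × C₂.B
  ract ω b := (C₁.ract ω.1 b.1, C₂.ract ω.2 b.2)
  ract_add ω b c := Prod.ext (C₁.ract_add _ _ _) (C₂.ract_add _ _ _)
  add_ract ω η b := Prod.ext (C₁.add_ract _ _ _) (C₂.add_ract _ _ _)
  ract_mul ω b c := Prod.ext (C₁.ract_mul _ _ _) (C₂.ract_mul _ _ _)
  ract_one ω := Prod.ext (C₁.ract_one _) (C₂.ract_one _)
  ip ω η := (C₁.ip ω.1 η.1, C₂.ip ω.2 η.2)
  ip_add_right ω η ζ := Prod.ext (C₁.ip_add_right _ _ _) (C₂.ip_add_right _ _ _)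
  ip_smul_right ω z η := Prod.ext (C₁.ip_smul_right _ _ _) (C₂.ip_smul_right _ _ _)
  ip_ract ω η b := Prod.ext (C₁.ip_ract _ _ _) (C₂.ip_ract _ _ _)
  ip_star ω η := Prod.ext (C₁.ip_star _ _) (C₂.ip_star _ _)
  ip_nonneg ω := by
    obtain ⟨b₁, h₁⟩ := C₁.ip_nonneg ω.1
    obtain ⟨b₂, h₂⟩ := C₂.ip_nonneg ω.2
    exact ⟨(b₁, b₂), Prod.ext h₁ h₂⟩
  ip_self_eq_zero ω := by
    rw [Prod.ext_iff, Prod.ext_iff]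
    exact and_congr (C₁.ip_self_eq_zero ω.1) (C₂.ip_self_eq_zero ω.2)
  norm_eq ω := by
    rw [Prod.norm_def, Prod.norm_def, C₁.norm_eq, C₂.norm_eq, Real.sqrt_monotone.map_max]
  lact :=
    { toFun := fun a => (C₁.lact a.1).prodMap (C₂.lact a.2)
      map_one' := by ext ω <;> simp
      map_mul' := fun a b => by ext ω <;> simp
      map_zero' := by ext ω <;> simp
      map_add' := fun a b => by ext ω <;> simp
      commutes' := fun z => by
        ext ω <;> simp [Algebra.algebraMap_eq_smul_one] }
  lact_ract a ω b := Prod.ext (C₁.lact_ract _ _ _) (C₂.lact_ract _ _ _)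
  lact_adjoint a ω η := Prod.ext (C₁.lact_adjoint _ _ _) (C₂.lact_adjoint _ _ _)

namespace MetricalTunnel

variable {F K G H : ℝ} {M₁ M₂ M₃ : PreMetricalCorrespondence.{u, v, w}}

/-- The glued correspondence of two tunnels with a common end. -/
noncomputable def glue (ε : ℝ) (τ₁ : MetricalTunnel F K G H M₁ M₂)
    (τ₂ : MetricalTunnel F K G H M₂ M₃) : PreMetricalCorrespondence.{u, v, w} where
  toCStarCorrespondence := τ₁.P.toCStarCorrespondence.prod τ₂.P.toCStarCorrespondence
  lipA := glueLip ε τ₁.P.lipA τ₂.P.lipA τ₁.iso₂.mapA τ₂.iso₁.mapA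
  lipB := glueLip ε τ₁.P.lipB τ₂.P.lipB τ₁.iso₂.mapB τ₂.iso₁.mapB
  dnorm ω := max (max (τ₁.P.dnorm ω.1) (τ₂.P.dnorm ω.2))
    (ENNReal.ofReal ε⁻¹ * ‖τ₁.iso₂.mapM ω.1 - τ₂.iso₁.mapM ω.2‖ₑ)

/-- The D-norm of the glued correspondence. -/
noncomputable def glueNorm (ε : ℝ) (τ₁ : MetricalTunnel F K G H M₁ M₂)
    (τ₂ : MetricalTunnel F K G H M₂ M₃) (ω : τ₁.P.M × τ₂.P.M) : ℝ≥0∞ :=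
  max (max (τ₁.P.dnorm ω.1) (τ₂.P.dnorm ω.2))
    (ENNReal.ofReal ε⁻¹ * ‖τ₁.iso₂.mapM ω.1 - τ₂.iso₁.mapM ω.2‖ₑ)

variable {ε : ℝ} {τ₁ : MetricalTunnel F K G H M₁ M₂} {τ₂ : MetricalTunnel F K G H M₂ M₃}

theorem le_glueNorm_fst (ω : τ₁.P.M × τ₂.P.M) : τ₁.P.dnorm ω.1 ≤ glueNorm ε τ₁ τ₂ ω :=
  (le_max_left _ _).trans (le_max_left _ _)

theorem le_glueNorm_snd (ω : τ₁.P.M × τ₂.P.M) : τ₂.P.dnorm ω.2 ≤ glueNorm ε τ₁ τ₂ ω :=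
  (le_max_right _ _).trans (le_max_left _ _)

theorem le_glueNorm_sub (ω : τ₁.P.M × τ₂.P.M) :
    ENNReal.ofReal ε⁻¹ * ‖τ₁.iso₂.mapM ω.1 - τ₂.iso₁.mapM ω.2‖ₑ ≤ glueNorm ε τ₁ τ₂ ω :=
  le_max_right _ _

theorem glueNorm_lt_top_iff {ω : τ₁.P.M × τ₂.P.M} :
    glueNorm ε τ₁ τ₂ ω < ∞ ↔ τ₁.P.dnorm ω.1 < ∞ ∧ τ₂.P.dnorm ω.2 < ∞ := by
  rw [glueNorm, max_lt_iff, max_lt_iff]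
  exact and_iff_left (ENNReal.mul_lt_top ENNReal.ofReal_lt_top enorm_lt_top)

theorem glueNorm_le_one_iff (hε : 0 < ε) {ω : τ₁.P.M × τ₂.P.M} :
    glueNorm ε τ₁ τ₂ ω ≤ 1 ↔ (τ₁.P.dnorm ω.1 ≤ 1 ∧ τ₂.P.dnorm ω.2 ≤ 1) ∧
      ‖τ₁.iso₂.mapM ω.1 - τ₂.iso₁.mapM ω.2‖ ≤ ε := by
  rw [glueNorm, max_le_iff, max_le_iff, ofReal_inv_mul_le_one_iff hε, enorm_le_ofReal_iff hε.le]

theorem norm_fst_le_glueNorm (ω : τ₁.P.M × τ₂.P.M) : ‖ω.1‖ₑ ≤ glueNorm ε τ₁ τ₂ ω :=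
  (τ₁.isMetrical.norm_le_dnorm ω.1).trans (le_glueNorm_fst ω)

theorem norm_snd_le_glueNorm (ω : τ₁.P.M × τ₂.P.M) : ‖ω.2‖ₑ ≤ glueNorm ε τ₁ τ₂ ω :=
  (τ₂.isMetrical.norm_le_dnorm ω.2).trans (le_glueNorm_snd ω)

theorem glueNorm_add_le (ω η : τ₁.P.M × τ₂.P.M) :
    glueNorm ε τ₁ τ₂ (ω + η) ≤ glueNorm ε τ₁ τ₂ ω + glueNorm ε τ₁ τ₂ η := by
  refine max_le (max_le ?_ ?_) ?_
  · exact (τ₁.isMetrical.dnorm_add_le ω.1 η.1).trans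
      (add_le_add (le_glueNorm_fst ω) (le_glueNorm_fst η))
  · exact (τ₂.isMetrical.dnorm_add_le ω.2 η.2).trans
      (add_le_add (le_glueNorm_snd ω) (le_glueNorm_snd η))
  · refine le_trans ?_ (add_le_add (le_glueNorm_sub ω) (le_glueNorm_sub η))
    rw [← mul_add]
    gcongr
    rw [Prod.fst_add, Prod.snd_add, map_add, map_add, add_sub_add_comm]
    exact enorm_add_le _ _

theorem glueNorm_smul (z : ℂ) (ω : τ₁.P.M × τ₂.P.M) :
    glueNorm ε τ₁ τ₂ (z • ω) = ‖z‖ₑ * glueNorm ε τ₁ τ₂ ω := by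
  rw [glueNorm, glueNorm, Prod.smul_fst, Prod.smul_snd, τ₁.isMetrical.dnorm_smul,
    τ₂.isMetrical.dnorm_smul, map_smul, map_smul, ← smul_sub, enorm_smul, mul_left_comm, mul_max,
    mul_max]

theorem dense_glueNorm_lt_top : Dense {ω : τ₁.P.M × τ₂.P.M | glueNorm ε τ₁ τ₂ ω < ∞} := by
  simp_rw [glueNorm_lt_top_iff]
  exact τ₁.isMetrical.dense_dom.prod τ₂.isMetrical.dense_dom

theorem isCompact_glueNorm_le_one (hε : 0 < ε) :
    IsCompact {ω : τ₁.P.M × τ₂.P.M | glueNorm ε τ₁ τ₂ ω ≤ 1} := by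
  have h : {ω : τ₁.P.M × τ₂.P.M | glueNorm ε τ₁ τ₂ ω ≤ 1} =
      ({ω | τ₁.P.dnorm ω ≤ 1} ×ˢ {ω | τ₂.P.dnorm ω ≤ 1}) ∩
        {ω | ‖τ₁.iso₂.mapM ω.1 - τ₂.iso₁.mapM ω.2‖ ≤ ε} := by
    ext ω; exact glueNorm_le_one_iff hε
  rw [h]
  refine (τ₁.isMetrical.isCompact_ball.prod τ₂.isMetrical.isCompact_ball).inter_right
    (isClosed_le (by fun_prop) continuous_const)

theorem enorm_le_glueNorm (ω : τ₁.P.M × τ₂.P.M) : ‖ω‖ₑ ≤ glueNorm ε τ₁ τ₂ ω := by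
  have h : ‖ω‖ₑ = max ‖ω.1‖ₑ ‖ω.2‖ₑ := by
    rw [← ofReal_norm, ← ofReal_norm, ← ofReal_norm, Prod.norm_def, ENNReal.ofReal_max]
  rw [h]
  exact max_le (norm_fst_le_glueNorm ω) (norm_snd_le_glueNorm ω)

/-- In the common end, with `aᵢ` and `ωᵢ` denoting images there, `a₁ ω₁ - a₂ ω₂ = (a₁ - a₂) ω₁ + a₂
(ω₁ - ω₂)`. The first term yields `L a * T ω` and the second `‖a‖ * T ω`, so the constant is `1 ≤
G`. Contractivity of the left action at the common end is assumed here and verified later for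
spectral triples. -/
theorem glueNorm_lact_le (hG : 1 ≤ G)
    (hl : ∀ (a : M₂.A) (ξ : M₂.M), ‖M₂.lact a ξ‖ ≤ ‖a‖ * ‖ξ‖)
    (a : selfAdjoint (τ₁.P.A × τ₂.P.A)) (ω : τ₁.P.M × τ₂.P.M)
    (ha : glueLip ε τ₁.P.lipA τ₂.P.lipA τ₁.iso₂.mapA τ₂.iso₁.mapA a < ∞)
    (hω : glueNorm ε τ₁ τ₂ ω < ∞) :
    glueNorm ε τ₁ τ₂ (τ₁.P.lact (a : τ₁.P.A × τ₂.P.A).1 ω.1, τ₂.P.lact (a : τ₁.P.A × τ₂.P.A).2 ω.2)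
      ≤ ENNReal.ofReal G * (‖(a : τ₁.P.A × τ₂.P.A)‖ₑ
        + glueLip ε τ₁.P.lipA τ₂.P.lipA τ₁.iso₂.mapA τ₂.iso₁.mapA a) * glueNorm ε τ₁ τ₂ ω := by
  obtain ⟨ha₁, ha₂⟩ := glueLip_lt_top_iff.1 ha
  obtain ⟨hω₁, hω₂⟩ := glueNorm_lt_top_iff.1 hω
  set a₁ := (a : τ₁.P.A × τ₂.P.A).1 with ha₁def
  set a₂ := (a : τ₁.P.A × τ₂.P.A).2 with ha₂def
  have hle : ‖a₁‖ₑ ≤ ‖(a : τ₁.P.A × τ₂.P.A)‖ₑ := enorm_fst_le _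
  have hle' : ‖a₂‖ₑ ≤ ‖(a : τ₁.P.A × τ₂.P.A)‖ₑ := enorm_snd_le _
  refine max_le (max_le ?_ ?_) ?_
  · refine (τ₁.isMetrical.modular_leibniz (selfAdjointFst a) ω.1 ha₁ hω₁).trans ?_
    gcongr
    exacts [hle, le_glueLip_fst a, le_glueNorm_fst ω]
  · refine (τ₂.isMetrical.modular_leibniz (selfAdjointSnd a) ω.2 ha₂ hω₂).trans ?_
    gcongr
    exacts [hle', le_glueLip_snd a, le_glueNorm_snd ω]
  · have hl' : ∀ (a : M₂.A) (ξ : M₂.M), ‖M₂.lact a ξ‖ₑ ≤ ‖a‖ₑ * ‖ξ‖ₑ := fun a ξ => by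
      simp only [enorm_eq_nnnorm]; exact_mod_cast hl a ξ
    have e : τ₁.iso₂.mapM (τ₁.P.lact a₁ ω.1) - τ₂.iso₁.mapM (τ₂.P.lact a₂ ω.2) =
        M₂.lact (τ₁.iso₂.mapA a₁ - τ₂.iso₁.mapA a₂) (τ₁.iso₂.mapM ω.1) +
          M₂.lact (τ₂.iso₁.mapA a₂) (τ₁.iso₂.mapM ω.1 - τ₂.iso₁.mapM ω.2) := by
      rw [τ₁.iso₂.map_lact, τ₂.iso₁.map_lact, map_sub, map_sub, sub_apply]
      abel
    have h1 : ‖τ₁.iso₂.mapM ω.1‖ₑ ≤ glueNorm ε τ₁ τ₂ ω := by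
      refine le_trans ?_ (norm_fst_le_glueNorm ω)
      rw [← ofReal_norm, ← ofReal_norm]
      exact ENNReal.ofReal_le_ofReal (τ₁.iso₂.norm_mapM_le _)
    have h2 : ‖τ₂.iso₁.mapA a₂‖ₑ ≤ ‖(a : τ₁.P.A × τ₂.P.A)‖ₑ := (enorm_starAlgHom_le _ _).trans hle'
    have hG' : 1 ≤ ENNReal.ofReal G := by simpa using hG
    change ENNReal.ofReal ε⁻¹ *
      ‖τ₁.iso₂.mapM (τ₁.P.lact a₁ ω.1) - τ₂.iso₁.mapM (τ₂.P.lact a₂ ω.2)‖ₑ ≤ _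
    rw [e]
    calc _ ≤ ENNReal.ofReal ε⁻¹ * (‖τ₁.iso₂.mapA a₁ - τ₂.iso₁.mapA a₂‖ₑ * ‖τ₁.iso₂.mapM ω.1‖ₑ +
          ‖τ₂.iso₁.mapA a₂‖ₑ * ‖τ₁.iso₂.mapM ω.1 - τ₂.iso₁.mapM ω.2‖ₑ) := by
          gcongr
          exact (enorm_add_le _ _).trans (add_le_add (hl' _ _) (hl' _ _))
      _ = (ENNReal.ofReal ε⁻¹ * ‖τ₁.iso₂.mapA a₁ - τ₂.iso₁.mapA a₂‖ₑ) * ‖τ₁.iso₂.mapM ω.1‖ₑ +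
          ‖τ₂.iso₁.mapA a₂‖ₑ *
            (ENNReal.ofReal ε⁻¹ * ‖τ₁.iso₂.mapM ω.1 - τ₂.iso₁.mapM ω.2‖ₑ) := by ring
      _ ≤ glueLip ε τ₁.P.lipA τ₂.P.lipA τ₁.iso₂.mapA τ₂.iso₁.mapA a * glueNorm ε τ₁ τ₂ ω +
          ‖(a : τ₁.P.A × τ₂.P.A)‖ₑ * glueNorm ε τ₁ τ₂ ω := by
          gcongr
          exacts [le_glueLip_sub a, le_glueNorm_sub ω]
      _ = 1 * (‖(a : τ₁.P.A × τ₂.P.A)‖ₑ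
        + glueLip ε τ₁.P.lipA τ₂.P.lipA τ₁.iso₂.mapA τ₂.iso₁.mapA a) * glueNorm ε τ₁ τ₂ ω := by ring
      _ ≤ _ := by gcongr

theorem _root_.CStarCorrespondence.ip_add_left (C : CStarCorrespondence.{u, v, w})
    (ω η ζ : C.M) : C.ip (ω + η) ζ = C.ip ω ζ + C.ip η ζ := by
  rw [C.ip_star, C.ip_add_right, star_add, ← C.ip_star, ← C.ip_star]

theorem _root_.CStarCorrespondence.ip_sub_left (C : CStarCorrespondence.{u, v, w})
    (ω η ζ : C.M) : C.ip (ω - η) ζ = C.ip ω ζ - C.ip η ζ := by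
  rw [eq_sub_iff_add_eq, ← C.ip_add_left, sub_add_cancel]

theorem _root_.CStarCorrespondence.ip_sub_right (C : CStarCorrespondence.{u, v, w})
    (ω η ζ : C.M) : C.ip ω (η - ζ) = C.ip ω η - C.ip ω ζ := by
  rw [eq_sub_iff_add_eq, ← C.ip_add_right, sub_add_cancel]

/-- Changing one argument of the inner product at a time produces two terms, each at most the
product of the D-norms. This is the origin of the condition `2 ≤ H`. -/
theorem enorm_ip_sub_le (hcs : ∀ ξ η : M₂.M, ‖M₂.ip ξ η‖ ≤ ‖ξ‖ * ‖η‖)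
    (ω η : τ₁.P.M × τ₂.P.M) :
    ENNReal.ofReal ε⁻¹ * ‖τ₁.iso₂.mapB (τ₁.P.ip ω.1 η.1) - τ₂.iso₁.mapB (τ₂.P.ip ω.2 η.2)‖ₑ ≤
      2 * glueNorm ε τ₁ τ₂ ω * glueNorm ε τ₁ τ₂ η := by
  have hcs' : ∀ ξ η : M₂.M, ‖M₂.ip ξ η‖ₑ ≤ ‖ξ‖ₑ * ‖η‖ₑ := fun ξ η => by
    simp only [enorm_eq_nnnorm]; exact_mod_cast hcs ξ η
  have e : τ₁.iso₂.mapB (τ₁.P.ip ω.1 η.1) - τ₂.iso₁.mapB (τ₂.P.ip ω.2 η.2) =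
      M₂.ip (τ₁.iso₂.mapM ω.1 - τ₂.iso₁.mapM ω.2) (τ₁.iso₂.mapM η.1) +
        M₂.ip (τ₂.iso₁.mapM ω.2) (τ₁.iso₂.mapM η.1 - τ₂.iso₁.mapM η.2) := by
    rw [τ₁.iso₂.map_ip, τ₂.iso₁.map_ip, CStarCorrespondence.ip_sub_left,
      CStarCorrespondence.ip_sub_right]
    abel
  have h1 : ‖τ₁.iso₂.mapM η.1‖ₑ ≤ glueNorm ε τ₁ τ₂ η := by
    refine le_trans ?_ (norm_fst_le_glueNorm η)
    rw [← ofReal_norm, ← ofReal_norm]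
    exact ENNReal.ofReal_le_ofReal (τ₁.iso₂.norm_mapM_le _)
  have h2 : ‖τ₂.iso₁.mapM ω.2‖ₑ ≤ glueNorm ε τ₁ τ₂ ω := by
    refine le_trans ?_ (norm_snd_le_glueNorm ω)
    rw [← ofReal_norm, ← ofReal_norm]
    exact ENNReal.ofReal_le_ofReal (τ₂.iso₁.norm_mapM_le _)
  rw [e]
  calc _ ≤ ENNReal.ofReal ε⁻¹ *
        (‖τ₁.iso₂.mapM ω.1 - τ₂.iso₁.mapM ω.2‖ₑ * ‖τ₁.iso₂.mapM η.1‖ₑ +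
        ‖τ₂.iso₁.mapM ω.2‖ₑ * ‖τ₁.iso₂.mapM η.1 - τ₂.iso₁.mapM η.2‖ₑ) := by
        gcongr
        exact (enorm_add_le _ _).trans (add_le_add (hcs' _ _) (hcs' _ _))
    _ = (ENNReal.ofReal ε⁻¹ * ‖τ₁.iso₂.mapM ω.1 - τ₂.iso₁.mapM ω.2‖ₑ) * ‖τ₁.iso₂.mapM η.1‖ₑ +
        ‖τ₂.iso₁.mapM ω.2‖ₑ *
          (ENNReal.ofReal ε⁻¹ * ‖τ₁.iso₂.mapM η.1 - τ₂.iso₁.mapM η.2‖ₑ) := by ring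
    _ ≤ glueNorm ε τ₁ τ₂ ω * glueNorm ε τ₁ τ₂ η + glueNorm ε τ₁ τ₂ ω * glueNorm ε τ₁ τ₂ η := by
        gcongr
        exacts [le_glueNorm_sub ω, le_glueNorm_sub η]
    _ = _ := by ring

theorem glueLip_ip_le (hH : 2 ≤ H) (hcs : ∀ ξ η : M₂.M, ‖M₂.ip ξ η‖ ≤ ‖ξ‖ * ‖η‖)
    (ω η : τ₁.P.M × τ₂.P.M) (hω : glueNorm ε τ₁ τ₂ ω < ∞) (hη : glueNorm ε τ₁ τ₂ η < ∞) :
    max (glueLip ε τ₁.P.lipB τ₂.P.lipB τ₁.iso₂.mapB τ₂.iso₁.mapB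
        (ℜ ((τ₁.P.ip ω.1 η.1, τ₂.P.ip ω.2 η.2) : τ₁.P.B × τ₂.P.B)))
      (glueLip ε τ₁.P.lipB τ₂.P.lipB τ₁.iso₂.mapB τ₂.iso₁.mapB
        (ℑ ((τ₁.P.ip ω.1 η.1, τ₂.P.ip ω.2 η.2) : τ₁.P.B × τ₂.P.B)))
      ≤ ENNReal.ofReal H * glueNorm ε τ₁ τ₂ ω * glueNorm ε τ₁ τ₂ η := by
  obtain ⟨hω₁, hω₂⟩ := glueNorm_lt_top_iff.1 hω
  obtain ⟨hη₁, hη₂⟩ := glueNorm_lt_top_iff.1 hη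
  have l₁ := max_le_iff.1 (τ₁.isMetrical.inner_leibniz ω.1 η.1 hω₁ hη₁)
  have l₂ := max_le_iff.1 (τ₂.isMetrical.inner_leibniz ω.2 η.2 hω₂ hη₂)
  have b₁ : ENNReal.ofReal H * τ₁.P.dnorm ω.1 * τ₁.P.dnorm η.1 ≤
      ENNReal.ofReal H * glueNorm ε τ₁ τ₂ ω * glueNorm ε τ₁ τ₂ η := by
    gcongr
    exacts [le_glueNorm_fst ω, le_glueNorm_fst η]
  have b₂ : ENNReal.ofReal H * τ₂.P.dnorm ω.2 * τ₂.P.dnorm η.2 ≤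
      ENNReal.ofReal H * glueNorm ε τ₁ τ₂ ω * glueNorm ε τ₁ τ₂ η := by
    gcongr
    exacts [le_glueNorm_snd ω, le_glueNorm_snd η]
  have b₃ : 2 * glueNorm ε τ₁ τ₂ ω * glueNorm ε τ₁ τ₂ η ≤
      ENNReal.ofReal H * glueNorm ε τ₁ τ₂ ω * glueNorm ε τ₁ τ₂ η := by
    gcongr
    rw [← ENNReal.ofReal_ofNat]
    exact ENNReal.ofReal_le_ofReal hH
  set b : τ₁.P.B × τ₂.P.B := (τ₁.P.ip ω.1 η.1, τ₂.P.ip ω.2 η.2) with hb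
  have hsub := enorm_ip_sub_le (ε := ε) hcs ω η
  refine max_le (max_le (max_le ?_ ?_) ?_) (max_le (max_le ?_ ?_) ?_)
  · rw [selfAdjointFst_realPart]; exact l₁.1.trans b₁
  · rw [selfAdjointSnd_realPart]; exact l₂.1.trans b₂
  · refine le_trans (le_trans ?_ hsub) b₃
    gcongr
    have e : τ₁.iso₂.mapB (ℜ b : τ₁.P.B × τ₂.P.B).1 - τ₂.iso₁.mapB (ℜ b : τ₁.P.B × τ₂.P.B).2 =
        ((ℜ (τ₁.iso₂.mapB b.1 - τ₂.iso₁.mapB b.2) : selfAdjoint M₂.B) : M₂.B) := by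
      rw [map_sub, AddSubgroupClass.coe_sub, ← starAlgHom_realPart, ← starAlgHom_realPart,
        ← selfAdjointFst_realPart, ← selfAdjointSnd_realPart]
      rfl
    rw [e, ← ofReal_norm, ← ofReal_norm]
    exact ENNReal.ofReal_le_ofReal (realPart.norm_le _)
  · rw [selfAdjointFst_imaginaryPart]; exact l₁.2.trans b₁
  · rw [selfAdjointSnd_imaginaryPart]; exact l₂.2.trans b₂
  · refine le_trans (le_trans ?_ hsub) b₃
    gcongr
    have e : τ₁.iso₂.mapB (ℑ b : τ₁.P.B × τ₂.P.B).1 - τ₂.iso₁.mapB (ℑ b : τ₁.P.B × τ₂.P.B).2 =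
        ((ℑ (τ₁.iso₂.mapB b.1 - τ₂.iso₁.mapB b.2) : selfAdjoint M₂.B) : M₂.B) := by
      rw [map_sub, AddSubgroupClass.coe_sub, ← starAlgHom_imaginaryPart,
        ← starAlgHom_imaginaryPart, ← selfAdjointFst_imaginaryPart, ← selfAdjointSnd_imaginaryPart]
      rfl
    rw [e, ← ofReal_norm, ← ofReal_norm]
    exact ENNReal.ofReal_le_ofReal (imaginaryPart.norm_le _)

theorem isMetrical_glue [Nontrivial M₂.A] [Nontrivial M₂.B] (hF : 1 ≤ F) (hG : 1 ≤ G)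
    (hH : 2 ≤ H) (hl : ∀ (a : M₂.A) (ξ : M₂.M), ‖M₂.lact a ξ‖ ≤ ‖a‖ * ‖ξ‖)
    (hcs : ∀ ξ η : M₂.M, ‖M₂.ip ξ η‖ ≤ ‖ξ‖ * ‖η‖) (hε : 0 < ε) :
    (glue ε τ₁ τ₂).IsMetrical F K G H where
  qcmsA := τ₁.isMetrical.qcmsA.glue hF hε τ₂.isMetrical.qcmsA
  qcmsB := τ₁.isMetrical.qcmsB.glue hF hε τ₂.isMetrical.qcmsB
  dnorm_add_le := glueNorm_add_le (ε := ε) (τ₁ := τ₁) (τ₂ := τ₂)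
  dnorm_smul := glueNorm_smul (ε := ε) (τ₁ := τ₁) (τ₂ := τ₂)
  dense_dom := dense_glueNorm_lt_top (ε := ε) (τ₁ := τ₁) (τ₂ := τ₂)
  norm_le_dnorm := enorm_le_glueNorm (ε := ε) (τ₁ := τ₁) (τ₂ := τ₂)
  isCompact_ball := isCompact_glueNorm_le_one (τ₁ := τ₁) (τ₂ := τ₂) hε
  modular_leibniz := glueNorm_lact_le (ε := ε) (τ₁ := τ₁) (τ₂ := τ₂) hG hl
  inner_leibniz := glueLip_ip_le (ε := ε) (τ₁ := τ₁) (τ₂ := τ₂) hH hcs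

end MetricalTunnel

/-! ### Quotient seminorms of the glued correspondence -/

section GlueLift

variable {D₁ D₂ A C : Type*} [CStarAlgebra D₁] [CStarAlgebra D₂] [CStarAlgebra A] [CStarAlgebra C]
  {ε : ℝ} {L₁ : selfAdjoint D₁ → ℝ≥0∞} {L₂ : selfAdjoint D₂ → ℝ≥0∞}
  {π₁ : D₁ →⋆ₐ[ℂ] A} {π₂ : D₂ →⋆ₐ[ℂ] A}

theorem glueLip_pair_le {d₁ : selfAdjoint D₁} {d₂ : selfAdjoint D₂} (h : π₁ d₁ = π₂ d₂)
    {c : ℝ≥0∞} (h₁ : L₁ d₁ ≤ c) (h₂ : L₂ d₂ ≤ c) :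
    glueLip ε L₁ L₂ π₁ π₂ (selfAdjointPair d₁ d₂) ≤ c := by
  refine max_le (max_le h₁ h₂) ?_
  change ENNReal.ofReal ε⁻¹ * ‖π₁ (d₁ : D₁) - π₂ (d₂ : D₂)‖ₑ ≤ c
  rw [h, sub_self, enorm_zero, mul_zero]
  exact zero_le

/-- An element of `D₁` is pushed to `A` and lifted back to `D₂` with loss `δ`. The resulting pair
has equal images in `A`, so the coupling term does not contribute. -/
theorem iInf_glueLip_fst {N : selfAdjoint A → ℝ≥0∞} (ρ : D₁ →⋆ₐ[ℂ] C) (c : C)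
    (h₁ : ∀ d, L₁ d < ∞ → N (selfAdjointMap π₁ d) ≤ L₁ d)
    (h₂ : ∀ a, N a < ∞ → ∀ δ : ℝ≥0∞, δ ≠ 0 →
      ∃ d : selfAdjoint D₂, π₂ d = a ∧ L₂ d ≤ N a + δ) :
    ⨅ (d : selfAdjoint D₁) (_ : ρ d = c), L₁ d =
      ⨅ (d : selfAdjoint (D₁ × D₂)) (_ : ρ (d : D₁ × D₂).1 = c), glueLip ε L₁ L₂ π₁ π₂ d :=
  iInf_eq_iInf_of_lift (p := selfAdjointFst) (q := fun d : selfAdjoint D₁ => ρ d = c)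
    le_glueLip_fst fun d₁ hd₁ δ hδ => by
      obtain ⟨d₂, e, hd₂⟩ := h₂ _ ((h₁ d₁ hd₁).trans_lt hd₁) δ hδ
      exact ⟨selfAdjointPair d₁ d₂, rfl, glueLip_pair_le e.symm le_self_add
        (hd₂.trans (by gcongr; exact h₁ d₁ hd₁))⟩

theorem iInf_glueLip_snd {N : selfAdjoint A → ℝ≥0∞} (ρ : D₂ →⋆ₐ[ℂ] C) (c : C)
    (h₂ : ∀ d, L₂ d < ∞ → N (selfAdjointMap π₂ d) ≤ L₂ d)
    (h₁ : ∀ a, N a < ∞ → ∀ δ : ℝ≥0∞, δ ≠ 0 →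
      ∃ d : selfAdjoint D₁, π₁ d = a ∧ L₁ d ≤ N a + δ) :
    ⨅ (d : selfAdjoint D₂) (_ : ρ d = c), L₂ d =
      ⨅ (d : selfAdjoint (D₁ × D₂)) (_ : ρ (d : D₁ × D₂).2 = c), glueLip ε L₁ L₂ π₁ π₂ d :=
  iInf_eq_iInf_of_lift (p := selfAdjointSnd) (q := fun d : selfAdjoint D₂ => ρ d = c)
    le_glueLip_snd fun d₂ hd₂ δ hδ => by
      obtain ⟨d₁, e, hd₁⟩ := h₁ _ ((h₂ d₂ hd₂).trans_lt hd₂) δ hδ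
      exact ⟨selfAdjointPair d₁ d₂, rfl, glueLip_pair_le e
        (hd₁.trans (by gcongr; exact h₂ d₂ hd₂)) le_self_add⟩

end GlueLift

namespace MetricalTunnel

variable {F K G H : ℝ} {M₁ M₂ M₃ : PreMetricalCorrespondence.{u, v, w}}
  {ε : ℝ} {τ₁ : MetricalTunnel F K G H M₁ M₂} {τ₂ : MetricalTunnel F K G H M₂ M₃}

theorem glueNorm_pair_le {ω₁ : τ₁.P.M} {ω₂ : τ₂.P.M} (h : τ₁.iso₂.mapM ω₁ = τ₂.iso₁.mapM ω₂)
    {c : ℝ≥0∞} (h₁ : τ₁.P.dnorm ω₁ ≤ c) (h₂ : τ₂.P.dnorm ω₂ ≤ c) :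
    glueNorm ε τ₁ τ₂ (ω₁, ω₂) ≤ c := by
  refine max_le (max_le h₁ h₂) ?_
  change ENNReal.ofReal ε⁻¹ * ‖τ₁.iso₂.mapM ω₁ - τ₂.iso₁.mapM ω₂‖ₑ ≤ c
  rw [h, sub_self, enorm_zero, mul_zero]
  exact zero_le

theorem iInf_glueNorm_fst (η : M₁.M) :
    ⨅ (ω : τ₁.P.M) (_ : τ₁.iso₁.mapM ω = η), τ₁.P.dnorm ω =
      ⨅ (ω : τ₁.P.M × τ₂.P.M) (_ : τ₁.iso₁.mapM ω.1 = η), glueNorm ε τ₁ τ₂ ω :=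
  iInf_eq_iInf_of_lift (p := Prod.fst) (q := fun ω : τ₁.P.M => τ₁.iso₁.mapM ω = η)
    le_glueNorm_fst fun ω₁ hω₁ δ hδ => by
      have h := τ₁.iso₂.dnorm_map_le hω₁
      obtain ⟨ω₂, e, hω₂⟩ := τ₂.iso₁.exists_liftM (h.trans_lt hω₁) hδ
      exact ⟨(ω₁, ω₂), rfl, glueNorm_pair_le e.symm le_self_add (hω₂.trans (by gcongr))⟩

theorem iInf_glueNorm_snd (η : M₃.M) :
    ⨅ (ω : τ₂.P.M) (_ : τ₂.iso₂.mapM ω = η), τ₂.P.dnorm ω =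
      ⨅ (ω : τ₁.P.M × τ₂.P.M) (_ : τ₂.iso₂.mapM ω.2 = η), glueNorm ε τ₁ τ₂ ω :=
  iInf_eq_iInf_of_lift (p := Prod.snd) (q := fun ω : τ₂.P.M => τ₂.iso₂.mapM ω = η)
    le_glueNorm_snd fun ω₂ hω₂ δ hδ => by
      have h := τ₂.iso₁.dnorm_map_le hω₂
      obtain ⟨ω₁, e, hω₁⟩ := τ₁.iso₂.exists_liftM (h.trans_lt hω₂) hδ
      exact ⟨(ω₁, ω₂), rfl, glueNorm_pair_le e (hω₁.trans (by gcongr)) le_self_add⟩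

/-- The left quantum isometry of the glued correspondence. -/
noncomputable def glueIso₁ (ε : ℝ) (τ₁ : MetricalTunnel F K G H M₁ M₂)
    (τ₂ : MetricalTunnel F K G H M₂ M₃) : ModularQuantumIsometry (glue ε τ₁ τ₂) M₁ where
  mapM := τ₁.iso₁.mapM ∘L ContinuousLinearMap.fst ℂ τ₁.P.M τ₂.P.M
  mapA := τ₁.iso₁.mapA.comp (StarAlgHom.fst ℂ τ₁.P.A τ₂.P.A)
  mapB := τ₁.iso₁.mapB.comp (StarAlgHom.fst ℂ τ₁.P.B τ₂.P.B)
  map_lact a ω := τ₁.iso₁.map_lact a.1 ω.1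
  map_ract ω b := τ₁.iso₁.map_ract ω.1 b.1
  map_ip ω η := τ₁.iso₁.map_ip ω.1 η.1
  map_domA d a e h := τ₁.iso₁.map_domA (selfAdjointFst d) a e (glueLip_lt_top_iff.1 h).1
  map_domB d b e h := τ₁.iso₁.map_domB (selfAdjointFst d) b e (glueLip_lt_top_iff.1 h).1
  map_domM ω h := τ₁.iso₁.map_domM ω.1 (glueNorm_lt_top_iff.1 h).1
  lipA_eq a h := (τ₁.iso₁.lipA_eq a h).trans (iInf_glueLip_fst τ₁.iso₁.mapA (a : M₁.A)
    (fun _ hd => τ₁.iso₂.lipA_map_le hd) fun _ ha _ hδ => τ₂.iso₁.exists_liftA ha hδ)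
  lipB_eq a h := (τ₁.iso₁.lipB_eq a h).trans (iInf_glueLip_fst τ₁.iso₁.mapB (a : M₁.B)
    (fun _ hd => τ₁.iso₂.lipB_map_le hd) fun _ ha _ hδ => τ₂.iso₁.exists_liftB ha hδ)
  dnorm_eq η h := (τ₁.iso₁.dnorm_eq η h).trans (iInf_glueNorm_fst η)

/-- The right quantum isometry of the glued correspondence. -/
noncomputable def glueIso₂ (ε : ℝ) (τ₁ : MetricalTunnel F K G H M₁ M₂)
    (τ₂ : MetricalTunnel F K G H M₂ M₃) : ModularQuantumIsometry (glue ε τ₁ τ₂) M₃ where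
  mapM := τ₂.iso₂.mapM ∘L ContinuousLinearMap.snd ℂ τ₁.P.M τ₂.P.M
  mapA := τ₂.iso₂.mapA.comp (StarAlgHom.snd ℂ τ₁.P.A τ₂.P.A)
  mapB := τ₂.iso₂.mapB.comp (StarAlgHom.snd ℂ τ₁.P.B τ₂.P.B)
  map_lact a ω := τ₂.iso₂.map_lact a.2 ω.2
  map_ract ω b := τ₂.iso₂.map_ract ω.2 b.2
  map_ip ω η := τ₂.iso₂.map_ip ω.2 η.2
  map_domA d a e h := τ₂.iso₂.map_domA (selfAdjointSnd d) a e (glueLip_lt_top_iff.1 h).2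
  map_domB d b e h := τ₂.iso₂.map_domB (selfAdjointSnd d) b e (glueLip_lt_top_iff.1 h).2
  map_domM ω h := τ₂.iso₂.map_domM ω.2 (glueNorm_lt_top_iff.1 h).2
  lipA_eq a h := (τ₂.iso₂.lipA_eq a h).trans (iInf_glueLip_snd τ₂.iso₂.mapA (a : M₃.A)
    (fun _ hd => τ₂.iso₁.lipA_map_le hd) fun _ ha _ hδ => τ₁.iso₂.exists_liftA ha hδ)
  lipB_eq a h := (τ₂.iso₂.lipB_eq a h).trans (iInf_glueLip_snd τ₂.iso₂.mapB (a : M₃.B)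
    (fun _ hd => τ₂.iso₁.lipB_map_le hd) fun _ ha _ hδ => τ₁.iso₂.exists_liftB ha hδ)
  dnorm_eq η h := (τ₂.iso₂.dnorm_eq η h).trans (iInf_glueNorm_snd η)

/-- The composition of two tunnels. -/
noncomputable def comp [Nontrivial M₂.A] [Nontrivial M₂.B] (hF : 1 ≤ F) (hG : 1 ≤ G)
    (hH : 2 ≤ H) (hl : ∀ (a : M₂.A) (ξ : M₂.M), ‖M₂.lact a ξ‖ ≤ ‖a‖ * ‖ξ‖)
    (hcs : ∀ ξ η : M₂.M, ‖M₂.ip ξ η‖ ≤ ‖ξ‖ * ‖η‖) (hε : 0 < ε)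
    (τ₁ : MetricalTunnel F K G H M₁ M₂) (τ₂ : MetricalTunnel F K G H M₂ M₃) :
    MetricalTunnel F K G H M₁ M₃ :=
  ⟨glue ε τ₁ τ₂, isMetrical_glue hF hG hH hl hcs hε, glueIso₁ ε τ₁ τ₂, glueIso₂ ε τ₁ τ₂⟩

theorem ExtentWithin.comp [Nontrivial M₂.A] [Nontrivial M₂.B] (hF : 1 ≤ F) (hG : 1 ≤ G)
    (hH : 2 ≤ H) (hl : ∀ (a : M₂.A) (ξ : M₂.M), ‖M₂.lact a ξ‖ ≤ ‖a‖ * ‖ξ‖)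
    (hcs : ∀ ξ η : M₂.M, ‖M₂.ip ξ η‖ ≤ ‖ξ‖ * ‖η‖) (hε : 0 < ε) {r₁ r₂ : ℝ≥0∞}
    (h₁ : τ₁.ExtentWithin r₁) (h₂ : τ₂.ExtentWithin r₂) :
    (comp hF hG hH hl hcs hε τ₁ τ₂).ExtentWithin (r₁ + r₂ + ENNReal.ofReal ε) := by
  -- A unital morphism into a nonzero algebra has a nonzero source; decomposing states of the
  -- product requires nonzero factors.
  have : Nontrivial τ₁.P.A := τ₁.iso₂.mapA.toRingHom.domain_nontrivial
  have : Nontrivial τ₂.P.A := τ₂.iso₁.mapA.toRingHom.domain_nontrivial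
  have : Nontrivial τ₁.P.B := τ₁.iso₂.mapB.toRingHom.domain_nontrivial
  have : Nontrivial τ₂.P.B := τ₂.iso₁.mapB.toRingHom.domain_nontrivial
  exact ⟨statesWithin_glue_fst hε h₁.A₁ h₂.A₁, statesWithin_glue_snd hε h₁.A₂ h₂.A₂,
    statesWithin_glue_fst hε h₁.B₁ h₂.B₁, statesWithin_glue_snd hε h₁.B₂ h₂.B₂⟩

end MetricalTunnel

/-! ### Composition of tunnels between spectral triples -/

namespace SpectralTunnel

variable {F K G H : ℝ} {T₁ T₂ T₃ : SpectralTriple.{u, v}}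

theorem norm_lact_le (T : SpectralTriple.{u, v}) (a : T.A) (ξ : T.H) :
    ‖T.rep a ξ‖ ≤ ‖a‖ * ‖ξ‖ :=
  ContinuousLinearMap.le_of_opNorm_le _ (NonUnitalStarAlgHom.norm_apply_le T.rep a) ξ

/-- The composition of two tunnels between spectral triples. -/
noncomputable def comp (hF : 1 ≤ F) (hG : 1 ≤ G) (hH : 2 ≤ H) {ε : ℝ} (hε : 0 < ε)
    (τ₁ : SpectralTunnel F K G H T₁ T₂) (τ₂ : SpectralTunnel F K G H T₂ T₃) :
    SpectralTunnel F K G H T₁ T₃ :=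
  haveI : Nontrivial T₂.toMetrical.A := T₂.nontrivialA
  haveI : Nontrivial T₂.toMetrical.B := inferInstanceAs (Nontrivial ℂ)
  MetricalTunnel.comp hF hG hH (norm_lact_le T₂) (norm_inner_le_norm (𝕜 := ℂ) (E := T₂.H)) hε τ₁ τ₂

theorem extentWithin_comp (hF : 1 ≤ F) (hG : 1 ≤ G) (hH : 2 ≤ H) {ε : ℝ} (hε : 0 < ε)
    {τ₁ : SpectralTunnel F K G H T₁ T₂} {τ₂ : SpectralTunnel F K G H T₂ T₃} {r₁ r₂ : ℝ≥0∞}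
    (h₁ : MetricalTunnel.ExtentWithin τ₁ r₁) (h₂ : MetricalTunnel.ExtentWithin τ₂ r₂) :
    MetricalTunnel.ExtentWithin (comp hF hG hH hε τ₁ τ₂) (r₁ + r₂ + ENNReal.ofReal ε) :=
  haveI : Nontrivial T₂.toMetrical.A := T₂.nontrivialA
  haveI : Nontrivial T₂.toMetrical.B := inferInstanceAs (Nontrivial ℂ)
  MetricalTunnel.ExtentWithin.comp hF hG hH (norm_lact_le T₂)
    (norm_inner_le_norm (𝕜 := ℂ) (E := T₂.H)) hε h₁ h₂

/-- The two estimates telescope through the partner `η` in the middle. What remains is `⟨η, b (Π₂ ω₁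
- Π₁ ω₂)⟩`, at most `ε` because `‖η‖ ≤ 1`, `b` is contractive and the coupling bounds the
difference. The maps `i₁` and `i₂` restrict the families to a shorter time interval. -/
theorem FunctionalsWithin.comp (hF : 1 ≤ F) (hG : 1 ≤ G) (hH : 2 ≤ H) {ε : ℝ} (hε : 0 < ε)
    {τ₁ : SpectralTunnel F K G H T₁ T₂} {τ₂ : SpectralTunnel F K G H T₂ T₃}
    {J J₁ J₂ : Type*} {a : J → T₁.H →L[ℂ] T₁.H} {c : J → T₃.H →L[ℂ] T₃.H}
    {a₁ : J₁ → T₁.H →L[ℂ] T₁.H} {b₁ : J₁ → T₂.H →L[ℂ] T₂.H}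
    {b₂ : J₂ → T₂.H →L[ℂ] T₂.H} {c₂ : J₂ → T₃.H →L[ℂ] T₃.H} {i₁ : J → J₁} {i₂ : J → J₂}
    (ha : ∀ j, a j = a₁ (i₁ j)) (hb : ∀ j, b₁ (i₁ j) = b₂ (i₂ j)) (hc : ∀ j, c j = c₂ (i₂ j))
    (hb₁ : ∀ j η, ‖b₁ j η‖ ≤ ‖η‖) {r₁ r₂ : ℝ≥0∞} {ξ : T₁.H} {η : T₂.H} {ζ : T₃.H}
    (hη : graphNorm T₂.D η ≤ 1)
    (h₁ : τ₁.FunctionalsWithin a₁ b₁ r₁ ξ η) (h₂ : τ₂.FunctionalsWithin b₂ c₂ r₂ η ζ) :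
    (comp hF hG hH hε τ₁ τ₂).FunctionalsWithin a c (r₁ + r₂ + ENNReal.ofReal ε) ξ ζ := by
  intro j (ω : τ₁.P.M × τ₂.P.M) hω
  obtain ⟨⟨hω₁, hω₂⟩, hω₃⟩ := (MetricalTunnel.glueNorm_le_one_iff hε).1 hω
  have hω₃' : ‖τ₁.map₂ ω.1 - τ₂.map₁ ω.2‖ ≤ ε := hω₃
  change ‖(inner ℂ ξ (a j (τ₁.map₁ ω.1)) : ℂ) - inner ℂ ζ (c j (τ₂.map₂ ω.2))‖ₑ ≤ _
  have hη1 : ‖η‖ ≤ 1 := by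
    have := (enorm_le_graphNorm η).trans hη
    rwa [← ofReal_norm, ENNReal.ofReal_le_one] at this
  have e : (inner ℂ ξ (a j (τ₁.map₁ ω.1)) : ℂ) - inner ℂ ζ (c j (τ₂.map₂ ω.2)) =
      (inner ℂ ξ (a₁ (i₁ j) (τ₁.map₁ ω.1)) - inner ℂ η (b₁ (i₁ j) (τ₁.map₂ ω.1))) +
      (inner ℂ η (b₂ (i₂ j) (τ₂.map₁ ω.2)) - inner ℂ ζ (c₂ (i₂ j) (τ₂.map₂ ω.2))) +
      inner ℂ η (b₁ (i₁ j) (τ₁.map₂ ω.1 - τ₂.map₁ ω.2)) := by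
    rw [map_sub, inner_sub_right, ha, hc, hb]; ring
  rw [e]
  refine (enorm_add_le _ _).trans (add_le_add ((enorm_add_le _ _).trans
    (add_le_add (h₁ _ _ hω₁) (h₂ _ _ hω₂))) ?_)
  rw [enorm_le_ofReal_iff hε.le]
  calc _ ≤ ‖η‖ * ‖b₁ (i₁ j) (τ₁.map₂ ω.1 - τ₂.map₁ ω.2)‖ := norm_inner_le_norm _ _
    _ ≤ 1 * ε := mul_le_mul hη1 ((hb₁ _ _).trans hω₃') (norm_nonneg _) zero_le_one
    _ = ε := one_mul ε

theorem DispersionWithin.comp (hF : 1 ≤ F) (hG : 1 ≤ G) (hH : 2 ≤ H) {ε : ℝ} (hε : 0 < ε)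
    {τ₁ : SpectralTunnel F K G H T₁ T₂} {τ₂ : SpectralTunnel F K G H T₂ T₃}
    {J J₁ J₂ : Type*} {a : J → T₁.H →L[ℂ] T₁.H} {c : J → T₃.H →L[ℂ] T₃.H}
    {a₁ : J₁ → T₁.H →L[ℂ] T₁.H} {b₁ : J₁ → T₂.H →L[ℂ] T₂.H}
    {b₂ : J₂ → T₂.H →L[ℂ] T₂.H} {c₂ : J₂ → T₃.H →L[ℂ] T₃.H} {i₁ : J → J₁} {i₂ : J → J₂}
    (ha : ∀ j, a j = a₁ (i₁ j)) (hb : ∀ j, b₁ (i₁ j) = b₂ (i₂ j)) (hc : ∀ j, c j = c₂ (i₂ j))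
    (hb₁ : ∀ j η, ‖b₁ j η‖ ≤ ‖η‖) {r₁ r₂ : ℝ≥0∞}
    (h₁ : DispersionWithin τ₁ a₁ b₁ r₁) (h₂ : DispersionWithin τ₂ b₂ c₂ r₂) :
    DispersionWithin (comp hF hG hH hε τ₁ τ₂) a c (r₁ + r₂ + ENNReal.ofReal ε) where
  extent := extentWithin_comp hF hG hH hε h₁.extent h₂.extent
  left ξ hξ := by
    obtain ⟨η, hη, k₁⟩ := h₁.left ξ hξ
    obtain ⟨ζ, hζ, k₂⟩ := h₂.left η hη
    exact ⟨ζ, hζ, k₁.comp hF hG hH hε ha hb hc hb₁ hη k₂⟩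
  right ζ hζ := by
    obtain ⟨η, hη, k₂⟩ := h₂.right ζ hζ
    obtain ⟨ξ, hξ, k₁⟩ := h₁.right η hη
    exact ⟨ξ, hξ, k₁.comp hF hG hH hε ha hb hc hb₁ hη k₂⟩

end SpectralTunnel

/-! ### The triangle inequality -/

section Triangle

variable {F K G H : ℝ}

theorem spectralPropinquityStar_triangle (hF : 1 ≤ F) (hG : 1 ≤ G) (hH : 2 ≤ H)
    (T₁ T₂ T₃ : MetricSpectralTriple.{u, v}) :
    spectralPropinquityStar F K G H T₁ T₃ ≤
      spectralPropinquityStar F K G H T₁ T₂ + spectralPropinquityStar F K G H T₂ T₃ := by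
  have h13 := spectralPropinquityStar_le_sqrt (F := F) (K := K) (G := G) (H := H) T₁ T₃
  have h23 := spectralPropinquityStar_nonneg (F := F) (K := K) (G := G) (H := H) T₂ T₃
  rw [← sub_le_iff_le_add]
  refine le_csInf ⟨_, Or.inl rfl⟩ ?_
  -- If one of the two terms is `√2 / 2`, the bound holds because `Λ*` never exceeds that number.
  rintro ε₁ (rfl | ⟨hε₁, τ₁, hτ₁⟩)
  · linarith
  rw [sub_le_comm]
  refine le_csInf ⟨_, Or.inl rfl⟩ ?_
  rintro ε₂ (rfl | ⟨hε₂, τ₂, hτ₂⟩)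
  · linarith
  rw [sub_le_iff_le_add']
  obtain ⟨r₁, hr₁, hr₁'⟩ := exists_between hτ₁
  obtain ⟨r₂, hr₂, hr₂'⟩ := exists_between hτ₂
  have hlt : r₁ + r₂ < ENNReal.ofReal (ε₁ + ε₂) := by
    rw [ENNReal.ofReal_add hε₁.le hε₂.le]
    exact ENNReal.add_lt_add hr₁' hr₂'
  -- The gluing parameter is chosen inside the gap between `r₁ + r₂` and `ε₁ + ε₂`.
  obtain ⟨δ, hδ, hδlt⟩ : ∃ δ : ℝ, 0 < δ ∧ r₁ + r₂ + ENNReal.ofReal δ < ENNReal.ofReal (ε₁ + ε₂) := by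
    obtain ⟨c, hc, hc'⟩ := ENNReal.lt_iff_exists_add_pos_lt.1 hlt
    refine ⟨c, by exact_mod_cast hc, ?_⟩
    rwa [ENNReal.ofReal_coe_nnreal]
  have d₁ := SpectralTunnel.dispersionWithin_of_lt hr₁
  have d₂ := SpectralTunnel.dispersionWithin_of_lt hr₂
  have i₁ : ∀ t : timeInterval (ε₁ + ε₂), (t : ℝ≥0) ∈ timeInterval ε₁ := fun t =>
    (show ((t : ℝ≥0) : ℝ) ≤ 1 / (ε₁ + ε₂) from t.2).trans
      (one_div_le_one_div_of_le hε₁ (by linarith))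
  have i₂ : ∀ t : timeInterval (ε₁ + ε₂), (t : ℝ≥0) ∈ timeInterval ε₂ := fun t =>
    (show ((t : ℝ≥0) : ℝ) ≤ 1 / (ε₁ + ε₂) from t.2).trans
      (one_div_le_one_div_of_le hε₂ (by linarith))
  have d := SpectralTunnel.DispersionWithin.comp hF hG hH hδ
    (a := fun t : timeInterval (ε₁ + ε₂) => T₁.U (t : ℝ≥0))
    (c := fun t : timeInterval (ε₁ + ε₂) => T₃.U (t : ℝ≥0))
    (i₁ := fun t => ⟨t, i₁ t⟩) (i₂ := fun t => ⟨t, i₂ t⟩) (fun _ => rfl) (fun _ => rfl)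
    (fun _ => rfl) (fun _ _ => T₂.norm_U_le _ _) d₁ d₂
  exact spectralPropinquityStar_le (by positivity) _ (d.dispersion_le.trans_lt hδlt)

end Triangle

/-! ### Isometric relations -/

section Relation

variable {E F : Type*} [NormedAddCommGroup E] [NormedSpace ℂ E]
  [NormedAddCommGroup F] [NormedSpace ℂ F]

theorem surjective_of_dense_range {S : Type*} [NormedAddCommGroup S] [NormedSpace ℂ S]
    [CompleteSpace S] (f : S →ₗᵢ[ℂ] E) (h : DenseRange f) : Function.Surjective f := by
  rw [← Set.range_eq_univ, ← f.isometry.isClosedEmbedding.isClosed_range.closure_eq]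
  exact h.closure_range

/-- A linear relation that preserves norms and is dense on both sides is contained in the graph
of an isometric isomorphism. -/
theorem exists_linearIsometryEquiv_of_relation [CompleteSpace E] [CompleteSpace F]
    (S : Submodule ℂ (E × F))
    (hS : ∀ p ∈ S, ‖p.1‖ = ‖p.2‖) (h₁ : Dense (Prod.fst '' (S : Set (E × F))))
    (h₂ : Dense (Prod.snd '' (S : Set (E × F)))) :
    ∃ V : E ≃ₗᵢ[ℂ] F, ∀ p ∈ S, V p.1 = p.2 := by
  -- Equality of norms passes to the closure. On it both projections are isometric for the maximum
  -- norm, with dense and therefore full range; the isomorphism is the second projection after the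
  -- inverse of the first.
  let S' := S.topologicalClosure
  have hS' : ∀ p ∈ S', ‖p.1‖ = ‖p.2‖ := fun p hp =>
    closure_minimal (t := {p : E × F | ‖p.1‖ = ‖p.2‖}) hS
      (isClosed_eq (by fun_prop) (by fun_prop)) hp
  have hle : S ≤ S' := S.le_topologicalClosure
  have : CompleteSpace S' := S.isClosed_topologicalClosure.completeSpace_coe
  let f₁ : S' →ₗᵢ[ℂ] E :=
    ⟨LinearMap.fst ℂ E F ∘ₗ S'.subtype, fun p => by
      change ‖(p : E × F).1‖ = ‖(p : E × F)‖
      rw [Prod.norm_def, ← hS' p p.2, max_self]⟩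
  let f₂ : S' →ₗᵢ[ℂ] F :=
    ⟨LinearMap.snd ℂ E F ∘ₗ S'.subtype, fun p => by
      change ‖(p : E × F).2‖ = ‖(p : E × F)‖
      rw [Prod.norm_def, hS' p p.2, max_self]⟩
  have s₁ : Function.Surjective f₁ := surjective_of_dense_range f₁ <| h₁.mono <| by
    rintro _ ⟨p, hp, rfl⟩
    exact ⟨⟨p, hle hp⟩, rfl⟩
  have s₂ : Function.Surjective f₂ := surjective_of_dense_range f₂ <| h₂.mono <| by
    rintro _ ⟨p, hp, rfl⟩
    exact ⟨⟨p, hle hp⟩, rfl⟩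
  let e₁ := LinearIsometryEquiv.ofSurjective f₁ s₁
  let e₂ := LinearIsometryEquiv.ofSurjective f₂ s₂
  refine ⟨e₁.symm.trans e₂, fun p hp => ?_⟩
  have e : e₁.symm p.1 = ⟨p, hle hp⟩ := (LinearIsometryEquiv.symm_apply_eq _).2 rfl
  change e₂ (e₁.symm p.1) = p.2
  rw [e]
  rfl

end Relation

/-! ### Algebras of operators with a common dense part -/

/-- All states take the same value at `a` because their distances are finite, and states separate
self-adjoint elements. -/
theorem IsQuantumCompactMetricSpace.exists_eq_smul_one {A : Type*} [CStarAlgebra A]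
    [Nontrivial A] {lip : selfAdjoint A → ℝ≥0∞} {F K : ℝ} (h : IsQuantumCompactMetricSpace F K lip)
    {a : selfAdjoint A} (ha : lip a = 0) : ∃ c : ℝ, a = c • 1 := by
  obtain ⟨φ, hφ⟩ := stateSpace_nonempty (A := A)
  have hre : φ (a : A) = ((φ (a : A)).re : ℂ) :=
    Complex.ext rfl (by rw [stateSpace_apply_im hφ, Complex.ofReal_im])
  refine ⟨(φ (a : A)).re, ?_⟩
  have key : ‖((a - (φ (a : A)).re • 1 : selfAdjoint A) : A)‖ ≤ 0 := by
    refine norm_le_of_forall_state le_rfl fun ψ hψ => ?_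
    rw [apply_sub_smul_one hψ, ← hre]
    have hfin := h.finite ψ hψ φ hφ
    refine le_of_forall_pos_le_add fun δ hδ => ?_
    set m := (mongeKantorovich lip ψ φ).toReal
    have hm : 0 ≤ m := ENNReal.toReal_nonneg
    -- As `lip a = 0`, every positive number is an admissible Lipschitz bound; this one makes its
    -- product with the distance at most `δ`.
    have hl : 0 < δ / (m + 1) := by positivity
    have h1 := enorm_sub_le_mul_mongeKantorovich h.smul_eq hl (ha.trans_le zero_le) ψ φ
    rw [← ENNReal.ofReal_toReal hfin.ne, ← ENNReal.ofReal_mul hl.le,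
      enorm_le_ofReal_iff (by positivity)] at h1
    refine h1.trans ?_
    rw [zero_add, div_mul_eq_mul_div, div_le_iff₀ (by positivity)]
    nlinarith
  rw [norm_le_zero_iff] at key
  exact sub_eq_zero.1 (Subtype.ext key)

namespace SpectralTriple

theorem IsMetric.exists_eq_smul_one {T : SpectralTriple.{u, v}} (hT : T.IsMetric)
    {a : selfAdjoint T.A} (ha : T.rep (a : T.A) = 0) : ∃ c : ℝ, a = c • 1 := by
  refine IsQuantumCompactMetricSpace.exists_eq_smul_one hT (nonpos_iff_eq_zero.1 ?_)
  refine iInf₂_le_of_le 0 (fun ξ => ?_) (by simp)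
  have e : T.rep (a : T.A) ξ = 0 := by rw [ha]; rfl
  have hm : T.rep (a : T.A) ξ ∈ T.D.domain := by rw [e]; exact zero_mem _
  have e' : T.D ⟨T.rep (a : T.A) ξ, hm⟩ = 0 :=
    (congrArg (fun x : T.D.domain => T.D x) (Subtype.ext e : (⟨_, hm⟩ : T.D.domain) = 0)).trans T.D.map_zero
  exact ⟨hm, by rw [e', ha]; simp⟩

/-- An element of the kernel commutes with `D`, hence is scalar when self-adjoint, and a nonzero
scalar does not act as zero on a nonzero space. -/
theorem IsMetric.rep_injective {T : SpectralTriple.{u, v}} (hT : T.IsMetric) [Nontrivial T.H] :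
    Function.Injective T.rep := by
  have key : ∀ a : selfAdjoint T.A, T.rep (a : T.A) = 0 → (a : T.A) = 0 := by
    intro a ha
    obtain ⟨c, rfl⟩ := hT.exists_eq_smul_one ha
    have e : (((c • 1 : selfAdjoint T.A)) : T.A) = (c : ℂ) • (1 : T.A) := by
      rw [Complex.coe_smul]; rfl
    rw [e, map_smul, map_one, smul_eq_zero] at ha
    rw [e, ha.resolve_right one_ne_zero, zero_smul]
  refine (injective_iff_map_eq_zero T.rep).2 fun x hx => ?_
  rw [← realPart_add_I_smul_imaginaryPart x, key (ℜ x), key (ℑ x), smul_zero, add_zero]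
  · rw [starAlgHom_imaginaryPart, hx, map_zero]; rfl
  · rw [starAlgHom_realPart, hx, map_zero]; rfl

/-- On the zero Hilbert space all commutators vanish, so every self-adjoint element is scalar. This
settles the case in which the representation is not faithful. -/
theorem IsMetric.bijective_algebraMap {T : SpectralTriple.{u, v}} (hT : T.IsMetric)
    [Subsingleton T.H] : Function.Bijective (algebraMap ℂ T.A) := by
  refine ⟨(algebraMap ℂ T.A).injective, fun x => ?_⟩
  obtain ⟨r, hr⟩ := hT.exists_eq_smul_one (a := ℜ x) (Subsingleton.elim _ _)
  obtain ⟨s, hs⟩ := hT.exists_eq_smul_one (a := ℑ x) (Subsingleton.elim _ _)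
  refine ⟨r + Complex.I * s, ?_⟩
  have e : ∀ c : ℝ, (((c • 1 : selfAdjoint T.A)) : T.A) = (c : ℂ) • (1 : T.A) := fun c => by
    rw [Complex.coe_smul]; rfl
  rw [← realPart_add_I_smul_imaginaryPart x, hr, hs, e, e, Algebra.algebraMap_eq_smul_one,
    add_smul, mul_smul]

/-- A unitary that intertwines the Lipschitz elements of two metric spectral triples implements
an isomorphism of their algebras. -/
theorem IsMetric.exists_starAlgEquiv {T₁ T₂ : SpectralTriple.{u, v}} (hT₁ : T₁.IsMetric)
    (hT₂ : T₂.IsMetric) (V : T₁.H ≃ₗᵢ[ℂ] T₂.H)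
    (h₁ : ∀ a : selfAdjoint T₁.A, T₁.lip a < ∞ →
      ∃ b : T₂.A, ∀ ξ, T₂.rep b (V ξ) = V (T₁.rep (a : T₁.A) ξ))
    (h₂ : ∀ b : selfAdjoint T₂.A, T₂.lip b < ∞ →
      ∃ a : T₁.A, ∀ ξ, T₂.rep (b : T₂.A) (V ξ) = V (T₁.rep a ξ)) :
    ∃ π : T₁.A ≃⋆ₐ[ℂ] T₂.A, ∀ a ξ, T₂.rep (π a) (V ξ) = V (T₁.rep a ξ) := by
  -- If the Hilbert spaces are zero, both algebras are `ℂ` and there is nothing to intertwine.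
  rcases subsingleton_or_nontrivial T₁.H with hs | hn
  · have : Subsingleton T₂.H := V.symm.injective.subsingleton
    let e₁ := StarAlgEquiv.ofBijective (StarAlgHom.ofId ℂ T₁.A) hT₁.bijective_algebraMap
    let e₂ := StarAlgEquiv.ofBijective (StarAlgHom.ofId ℂ T₂.A) hT₂.bijective_algebraMap
    exact ⟨e₁.symm.trans e₂, fun a ξ => Subsingleton.elim _ _⟩
  have : Nontrivial T₂.H := V.symm.surjective.nontrivial
  let f : T₁.A →⋆ₐ[ℂ] (T₂.H →L[ℂ] T₂.H) := (StarAlgHomClass.toStarAlgHom V.conjStarAlgEquiv).comp T₁.rep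
  let g : T₂.A →⋆ₐ[ℂ] (T₂.H →L[ℂ] T₂.H) := T₂.rep
  have hfg : ∀ {a b}, f a = g b ↔ ∀ ξ, T₂.rep b (V ξ) = V (T₁.rep a ξ) := by
    intro a b
    constructor
    · intro h ξ
      have := DFunLike.congr_fun h (V ξ)
      change V (T₁.rep a (V.symm (V ξ))) = T₂.rep b (V ξ) at this
      rw [V.symm_apply_apply] at this
      exact this.symm
    · intro h
      refine ContinuousLinearMap.ext fun η => ?_
      change V (T₁.rep a (V.symm η)) = T₂.rep b η
      rw [← h, V.apply_symm_apply]
  have hf : Function.Injective f := V.conjStarAlgEquiv.injective.comp hT₁.rep_injective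
  have hg : Function.Injective g := hT₂.rep_injective
  -- Injective ⋆-morphisms are isometric and so have closed range; an inclusion of images known on a
  -- dense set of self-adjoint elements therefore holds everywhere.
  have incl : ∀ {A B : Type u} [CStarAlgebra A] [CStarAlgebra B]
      (f : A →⋆ₐ[ℂ] (T₂.H →L[ℂ] T₂.H)) (g : B →⋆ₐ[ℂ] (T₂.H →L[ℂ] T₂.H))
      (s : Set (selfAdjoint A)), Function.Injective g → Dense s →
      (∀ a ∈ s, ∃ b, f a = g b) → ∀ a, ∃ b, f a = g b := by
    intro A B _ _ f g s hg hs h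
    have hc : IsClosed (Set.range g) :=
      (NonUnitalStarAlgHom.isometry g hg).isClosedEmbedding.isClosed_range
    have key : ∀ a : selfAdjoint A, f a ∈ Set.range g := fun a =>
      hs.induction (P := fun a : selfAdjoint A => f a ∈ Set.range g)
        (fun a ha => by obtain ⟨b, hb⟩ := h a ha; exact ⟨b, hb.symm⟩)
        (hc.preimage ((continuous_starAlgHom f).comp continuous_subtype_val)) a
    intro a
    obtain ⟨b, hb⟩ := key (ℜ a)
    obtain ⟨c, hc⟩ := key (ℑ a)
    refine ⟨b + Complex.I • c, ?_⟩
    rw [map_add, map_smul, hb, hc, ← map_smul, ← map_add, realPart_add_I_smul_imaginaryPart]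
  have r₁ : ∀ a, ∃ b, f a = g b := incl f g _ hg T₁.dense_smooth fun a ha => by
    obtain ⟨b, hb⟩ := h₁ a ha
    exact ⟨b, hfg.2 hb⟩
  have r₂ : ∀ b, ∃ a, g b = f a := incl g f _ hf T₂.dense_smooth fun b hb => by
    obtain ⟨a, ha⟩ := h₂ b hb
    exact ⟨a, (hfg.2 ha).symm⟩
  choose p hp using r₁
  let π : T₁.A →⋆ₐ[ℂ] T₂.A :=
    { toFun := p
      map_one' := hg (by rw [← hp, map_one, map_one])
      map_mul' := fun x y => hg (by rw [← hp, map_mul, map_mul, ← hp, ← hp])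
      map_zero' := hg (by rw [← hp, map_zero, map_zero])
      map_add' := fun x y => hg (by rw [← hp, map_add, map_add, ← hp, ← hp])
      commutes' := fun z => hg (by rw [← hp, AlgHomClass.commutes, AlgHomClass.commutes])
      map_star' := fun x => hg (by rw [← hp, map_star, map_star, ← hp]) }
  have hπ : Function.Bijective π := by
    refine ⟨fun x y h => hf ?_, fun b => ?_⟩
    · rw [hp, hp]; exact congrArg g h
    · obtain ⟨a, ha⟩ := r₂ b
      exact ⟨a, hg ((hp a).symm.trans ha.symm)⟩
  exact ⟨StarAlgEquiv.ofBijective π hπ, fun a => hfg.1 (hp a)⟩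

/-- A unitary that commutes with the unitary groups is an equivalence of the operators. -/
theorem isUnitaryEquivalence_of_U {T₁ T₂ : SpectralTriple.{u, v}} {V : T₁.H ≃ₗᵢ[ℂ] T₂.H}
    {π : T₁.A ≃⋆ₐ[ℂ] T₂.A} (hπ : ∀ a ξ, T₂.rep (π a) (V ξ) = V (T₁.rep a ξ))
    (hU : ∀ t : ℝ, 0 ≤ t → ∀ ξ, T₂.U t (V ξ) = V (T₁.U t ξ)) :
    IsUnitaryEquivalence T₁ T₂ V π := by
  obtain ⟨R₁, hR₁, hc₁⟩ := T₁.exists_isResolvent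
  obtain ⟨R₂, hR₂, hc₂⟩ := T₂.exists_isResolvent
  -- It suffices to intertwine the resolvents, and only on eigenvectors `ζ` of the first operator;
  -- `V ζ` is an eigenvector of the second because the group multiplies it by the same phases.
  have hR : ∀ ξ, R₂ (V ξ) = V (R₁ ξ) := by
    have : R₂ ∘L (V.toContinuousLinearEquiv : T₁.H →L[ℂ] T₂.H) =
        (V.toContinuousLinearEquiv : T₁.H →L[ℂ] T₂.H) ∘L R₁ := by
      refine hR₁.clm_ext T₁.isSelfAdjoint hc₁ fun s ζ hζ => ?_
      change R₂ (V ζ) = V (R₁ ζ)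
      have hVζ : V ζ ∈ diracEigenspace T₂.D s := by
        refine hR₂.mem_diracEigenspace_of_diracGroup T₂.isSelfAdjoint hc₂ fun t ht => ?_
        refine (hU t ht ζ).trans ?_
        rw [← map_smul]
        exact congrArg V (diracGroup_apply_of_mem T₁.isSelfAdjoint t hζ)
      refine smul_right_injective _ (ofReal_add_I_ne_zero s) ?_
      change ((s : ℂ) + Complex.I) • R₂ (V ζ) = ((s : ℂ) + Complex.I) • V (R₁ ζ)
      rw [hR₂.smul_apply_of_mem_diracEigenspace hVζ, ← map_smul,
        hR₁.smul_apply_of_mem_diracEigenspace hζ]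
    exact DFunLike.congr_fun this
  refine ⟨fun ξ => ⟨fun h => ?_, fun h => ?_⟩, fun ξ h h' => ?_, hπ⟩
  · obtain ⟨η, hη⟩ := hR₂.exists_apply_eq h
    obtain ⟨ζ, rfl⟩ := V.surjective η
    rw [← V.injective ((hR ζ).symm.trans hη)]
    exact hR₁.mem ζ
  · obtain ⟨η, rfl⟩ := hR₁.exists_apply_eq h
    rw [← hR]
    exact hR₂.mem _
  · obtain ⟨η, rfl⟩ := hR₁.exists_apply_eq h
    have e : T₂.D ⟨V (R₁ η), h'⟩ = T₂.D ⟨R₂ (V η), hR₂.mem _⟩ :=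
      congrArg (fun x : T₂.D.domain => T₂.D x) (Subtype.ext (hR η).symm)
    rw [e, hR₂.apply_eq, hR₁.apply_eq, hR, map_sub, map_smul]

end SpectralTriple

/-! ### Limits of tunnels -/

/-- Limits along one fixed ultrafilter exist simultaneously for all sequences in compact sets, so no
subsequences have to be extracted, and they respect the algebraic operations. -/
theorem Ultrafilter.exists_tendsto_of_isCompact {ι X : Type*} [TopologicalSpace X] {s : Set X}
    (hs : IsCompact s) (𝒰 : Ultrafilter ι) {x : ι → X} (h : ∀ i, x i ∈ s) :
    ∃ a ∈ s, Filter.Tendsto x 𝒰 (𝓝 a) :=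
  hs.ultrafilter_le_nhds (𝒰.map x)
    (Filter.le_principal_iff.2 (Filter.Eventually.of_forall (f := (𝒰 : Filter ι)) h))

theorem apply_inv_smul_le_one {E : Type*} [NormedAddCommGroup E] [NormedSpace ℂ E] {N : E → ℝ≥0∞}
    (hN : ∀ (z : ℂ) (x), N (z • x) = ‖z‖ₑ * N x) {l : ℝ} (hl : 0 < l) {x : E}
    (hx : N x ≤ ENNReal.ofReal l) : N ((l : ℂ)⁻¹ • x) ≤ 1 := by
  have e : ‖(l : ℂ)⁻¹‖ₑ = ENNReal.ofReal l⁻¹ := by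
    rw [← ofReal_norm, norm_inv, Complex.norm_real, Real.norm_of_nonneg hl.le]
  rw [hN, e]
  calc _ ≤ ENNReal.ofReal l⁻¹ * ENNReal.ofReal l := mul_le_mul_right hx _
    _ = 1 := by rw [← ENNReal.ofReal_mul (inv_nonneg.2 hl.le), inv_mul_cancel₀ hl.ne',
                  ENNReal.ofReal_one]

/-- Every state is `r`-close to one that factors through `π`, where the value is at most `‖π a‖`.
Lifts with bounded seminorm are thus bounded in norm. -/
theorem StatesWithin.norm_le {A B : Type*} [CStarAlgebra A] [CStarAlgebra B]
    {lip : selfAdjoint A → ℝ≥0∞} {F K : ℝ} (h : IsQuantumCompactMetricSpace F K lip)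
    {π : A →⋆ₐ[ℂ] B} {r l : ℝ} (hπ : StatesWithin lip π (ENNReal.ofReal r)) (hr : 0 ≤ r)
    (hl : 0 < l) {a : selfAdjoint A} (ha : lip a ≤ ENNReal.ofReal l) :
    ‖(a : A)‖ ≤ ‖π a‖ + l * r := by
  refine norm_le_of_forall_state (by positivity) fun φ hφ => ?_
  obtain ⟨ψ, hψ, hφψ⟩ := hπ φ hφ
  have h1 := (enorm_sub_le_mul_mongeKantorovich h.smul_eq hl ha φ (pullbackState π ψ)).trans
    (mul_le_mul_right hφψ _)
  rw [← ENNReal.ofReal_mul hl.le, enorm_le_ofReal_iff (by positivity)] at h1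
  have h2 : ‖pullbackState π ψ (a : A)‖ ≤ ‖π a‖ :=
    stateSpace_norm_apply_le hψ (selfAdjointMap π a)
  have h3 := norm_sub_norm_le (φ (a : A)) (pullbackState π ψ (a : A))
  linarith

namespace SpectralTunnel

variable {F K G H : ℝ} {T₁ T₂ : SpectralTriple.{u, v}}

/-- Each end supplies a character of the base algebra, the pullback of the only state of `ℂ`, with
value `‖Πⱼ ω‖²` at `⟨ω, ω⟩`. The extent puts the two within `r` of each other, and the inner Leibniz
inequality bounds the seminorm of `⟨ω, ω⟩` by `H l²`. -/
theorem abs_norm_sq_sub_le (hH : 0 < H) {τ : SpectralTunnel F K G H T₁ T₂} {r l : ℝ}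
    (hτ : MetricalTunnel.ExtentWithin τ (ENNReal.ofReal r)) (hr : 0 ≤ r) (hl : 0 < l) {ω : τ.P.M}
    (hω : τ.P.dnorm ω ≤ ENNReal.ofReal l) :
    |‖τ.map₂ ω‖ ^ 2 - ‖τ.map₁ ω‖ ^ 2| ≤ H * l * l * r := by
  set b := τ.P.ip ω ω with hb
  have hs : IsSelfAdjoint b := (τ.P.ip_star ω ω).symm
  have hre : ((ℜ b : selfAdjoint τ.P.B) : τ.P.B) = b := hs.coe_realPart
  have hfin : τ.P.dnorm ω < ∞ := hω.trans_lt ENNReal.ofReal_lt_top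
  have hlip : τ.P.lipB (ℜ b) ≤ ENNReal.ofReal (H * l * l) := by
    refine ((le_max_left _ _).trans (τ.isMetrical.inner_leibniz ω ω hfin hfin)).trans ?_
    rw [ENNReal.ofReal_mul (by positivity), ENNReal.ofReal_mul hH.le]
    gcongr
  obtain ⟨φ, hφ⟩ := stateSpace_nonempty (A := ℂ)
  obtain ⟨ψ, hψ, h⟩ := hτ.B₁ _ (pullbackState_mem τ.iso₂.mapB hφ)
  have h1 := (enorm_sub_le_mul_mongeKantorovich τ.isMetrical.qcmsB.smul_eq (by positivity) hlip
    _ _).trans (mul_le_mul_right h _)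
  rw [← ENNReal.ofReal_mul (by positivity), enorm_le_ofReal_iff (by positivity), hre] at h1
  have e₁ : pullbackState τ.iso₁.mapB ψ b = ((‖τ.map₁ ω‖ ^ 2 : ℝ) : ℂ) := by
    refine (stateSpace_complex hψ _).trans ((τ.iso₁.map_ip ω ω).trans ?_)
    exact (inner_self_eq_norm_sq_to_K (𝕜 := ℂ) (τ.map₁ ω)).trans (by simp)
  have e₂ : pullbackState τ.iso₂.mapB φ b = ((‖τ.map₂ ω‖ ^ 2 : ℝ) : ℂ) := by
    refine (stateSpace_complex hφ _).trans ((τ.iso₂.map_ip ω ω).trans ?_)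
    exact (inner_self_eq_norm_sq_to_K (𝕜 := ℂ) (τ.map₂ ω)).trans (by simp)
  rwa [e₁, e₂, ← Complex.ofReal_sub, Complex.norm_real] at h1

theorem dnorm_zero (τ : SpectralTunnel F K G H T₁ T₂) : τ.P.dnorm 0 = 0 := by
  have := τ.isMetrical.dnorm_smul 0 0
  rwa [zero_smul, enorm_zero, zero_mul] at this

/-- The limits of the pairs `(Π₁ ωₙ, Π₂ ωₙ)` for sequences with bounded D-norms. -/
def limitRelation (τ : ℕ → SpectralTunnel F K G H T₁ T₂) (𝒰 : Filter ℕ) :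
    Submodule ℂ (T₁.H × T₂.H) where
  carrier := {p | ∃ l : ℝ, 0 < l ∧ ∃ ω : ∀ n, (τ n).P.M,
    (∀ n, (τ n).P.dnorm (ω n) ≤ ENNReal.ofReal l) ∧
    Filter.Tendsto (fun n => (τ n).map₁ (ω n)) 𝒰 (𝓝 p.1) ∧
    Filter.Tendsto (fun n => (τ n).map₂ (ω n)) 𝒰 (𝓝 p.2)}
  add_mem' := by
    rintro p q ⟨l, hl, ω, hω, h₁, h₂⟩ ⟨l', hl', ω', hω', h₁', h₂'⟩
    refine ⟨l + l', add_pos hl hl', fun n => ω n + ω' n, fun n => ?_, ?_, ?_⟩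
    · rw [ENNReal.ofReal_add hl.le hl'.le]
      exact ((τ n).isMetrical.dnorm_add_le _ _).trans (add_le_add (hω n) (hω' n))
    · simp only [map_add]; exact h₁.add h₁'
    · simp only [map_add]; exact h₂.add h₂'
  zero_mem' := ⟨1, one_pos, fun n => 0, fun n => by rw [dnorm_zero]; exact zero_le,
    by simp only [map_zero]; exact tendsto_const_nhds,
    by simp only [map_zero]; exact tendsto_const_nhds⟩
  smul_mem' := by
    rintro z p ⟨l, hl, ω, hω, h₁, h₂⟩
    refine ⟨(‖z‖ + 1) * l, by positivity, fun n => z • ω n, fun n => ?_, ?_, ?_⟩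
    · rw [(τ n).isMetrical.dnorm_smul, ENNReal.ofReal_mul (by positivity)]
      refine mul_le_mul' ?_ (hω n)
      rw [enorm_le_ofReal_iff (by positivity)]
      linarith
    · simp only [map_smul]; exact h₁.const_smul z
    · simp only [map_smul]; exact h₂.const_smul z

variable {τ : ℕ → SpectralTunnel F K G H T₁ T₂} {𝒰 : Ultrafilter ℕ} {ε : ℕ → ℝ}

theorem mem_limitRelation_symm {p : T₁.H × T₂.H} (h : p ∈ limitRelation τ 𝒰) :
    p.swap ∈ limitRelation (fun n => MetricalTunnel.symm (τ n)) 𝒰 := by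
  obtain ⟨l, hl, ω, hω, h₁, h₂⟩ := h
  exact ⟨l, hl, ω, hω, h₂, h₁⟩

theorem norm_eq_of_mem_limitRelation (hH : 0 < H) (hε₀ : ∀ n, 0 ≤ ε n)
    (hε : Filter.Tendsto ε 𝒰 (𝓝 0))
    (hτ : ∀ n, MetricalTunnel.ExtentWithin (τ n) (ENNReal.ofReal (ε n)))
    {p : T₁.H × T₂.H} (h : p ∈ limitRelation τ 𝒰) : ‖p.1‖ = ‖p.2‖ := by
  obtain ⟨l, hl, ω, hω, h₁, h₂⟩ := h
  have h3 := (h₂.norm.pow 2).sub (h₁.norm.pow 2)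
  have h4 : Filter.Tendsto (fun n => ‖(τ n).map₂ (ω n)‖ ^ 2 - ‖(τ n).map₁ (ω n)‖ ^ 2) 𝒰 (𝓝 0) :=
    squeeze_zero_norm (fun n => abs_norm_sq_sub_le hH (hτ n) (hε₀ n) hl (hω n))
      (by simpa using hε.const_mul (H * l * l))
  have h5 := sub_eq_zero.1 (tendsto_nhds_unique h3 h4)
  exact ((sq_eq_sq₀ (norm_nonneg _) (norm_nonneg _)).1 h5).symm

/-- Lifts of `ξ` with bounded D-norm have their images at the other end in a multiple of the compact
graph norm ball. -/
theorem exists_mem_limitRelation (τ : ℕ → SpectralTunnel F K G H T₁ T₂) (𝒰 : Ultrafilter ℕ)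
    {ξ : T₁.H} (hξ : graphNorm T₁.D ξ < ∞) : ∃ η, (ξ, η) ∈ limitRelation τ 𝒰 := by
  -- The inner 1 is the loss allowed in lifting, and the outer one makes `l` positive.
  set l : ℝ := (graphNorm T₁.D ξ + 1).toReal + 1 with hl'
  have hl : 0 < l := by positivity
  have hle : graphNorm T₁.D ξ + 1 ≤ ENNReal.ofReal l := by
    refine (ENNReal.le_ofReal_iff_toReal_le ?_ hl.le).2 (by linarith)
    exact (ENNReal.add_lt_top.2 ⟨hξ, ENNReal.one_lt_top⟩).ne
  have key : ∀ n, ∃ ω : (τ n).P.M, (τ n).map₁ ω = ξ ∧ (τ n).P.dnorm ω ≤ ENNReal.ofReal l := by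
    intro n
    obtain ⟨ω, h1, h2⟩ := (τ n).iso₁.exists_liftM hξ one_ne_zero
    exact ⟨ω, h1, h2.trans hle⟩
  choose ω hω₁ hω using key
  have hc : IsCompact ((fun η : T₂.H => (l : ℂ) • η) '' {η | graphNorm T₂.D η ≤ 1}) :=
    T₂.isCompact_ball.image (by fun_prop)
  obtain ⟨η, -, hη⟩ := Ultrafilter.exists_tendsto_of_isCompact hc 𝒰
    (x := fun n => (τ n).map₂ (ω n)) fun n => by
      refine ⟨(l : ℂ)⁻¹ • (τ n).map₂ (ω n), ?_, ?_⟩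
      · have h1 : graphNorm T₂.D ((τ n).map₂ (ω n)) ≤ ENNReal.ofReal l :=
          ((τ n).iso₂.dnorm_map_le ((hω n).trans_lt ENNReal.ofReal_lt_top)).trans (hω n)
        exact apply_inv_smul_le_one graphNorm_smul hl h1
      · exact smul_inv_smul₀ (by exact_mod_cast hl.ne') _
  exact ⟨η, l, hl, ω, hω, by simpa only [hω₁] using tendsto_const_nhds, hη⟩

theorem dense_fst_limitRelation (τ : ℕ → SpectralTunnel F K G H T₁ T₂) (𝒰 : Ultrafilter ℕ) :
    Dense (Prod.fst '' (limitRelation τ 𝒰 : Set (T₁.H × T₂.H))) :=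
  T₁.dense_graphNorm_lt_top.mono fun ξ hξ => by
    obtain ⟨η, h⟩ := exists_mem_limitRelation τ 𝒰 hξ
    exact ⟨_, h, rfl⟩

theorem dense_snd_limitRelation (τ : ℕ → SpectralTunnel F K G H T₁ T₂) (𝒰 : Ultrafilter ℕ) :
    Dense (Prod.snd '' (limitRelation τ 𝒰 : Set (T₁.H × T₂.H))) :=
  (dense_fst_limitRelation (fun n => MetricalTunnel.symm (τ n)) 𝒰).mono <| by
    rintro _ ⟨p, h, rfl⟩
    exact ⟨_, mem_limitRelation_symm h, rfl⟩

/-- Lipschitz elements act on the limit relation. -/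
theorem exists_rep_mem_limitRelation (hT₂ : T₂.IsMetric) (hG : 0 < G)
    (hε₀ : ∀ n, 0 ≤ ε n) (hε₁ : ∀ n, ε n ≤ 1)
    (hτ : ∀ n, MetricalTunnel.ExtentWithin (τ n) (ENNReal.ofReal (ε n)))
    {a : selfAdjoint T₁.A} (ha : T₁.lip a < ∞) :
    ∃ b : T₂.A, ∀ p ∈ limitRelation τ 𝒰,
      (T₁.rep (a : T₁.A) p.1, T₂.rep b p.2) ∈ limitRelation τ 𝒰 := by
  set l : ℝ := (T₁.lip a + 1).toReal + 1 with hl'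
  have hl : 0 < l := by positivity
  have hle : T₁.lip a + 1 ≤ ENNReal.ofReal l := by
    refine (ENNReal.le_ofReal_iff_toReal_le ?_ hl.le).2 (by linarith)
    exact (ENNReal.add_lt_top.2 ⟨ha, ENNReal.one_lt_top⟩).ne
  have key : ∀ n, ∃ d : selfAdjoint (τ n).P.A, (τ n).iso₁.mapA d = (a : T₁.A) ∧
      (τ n).P.lipA d ≤ ENNReal.ofReal l := by
    intro n
    obtain ⟨d, h1, h2⟩ := (τ n).iso₁.exists_liftA ha one_ne_zero
    exact ⟨d, h1, h2.trans hle⟩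
  choose d hd₁ hd using key
  -- The lifts are bounded uniformly in `n`, because their seminorms are and the extents are at most
  -- one.
  set R : ℝ := ‖(a : T₁.A)‖ + l
  have hR : ∀ n, ‖(d n : (τ n).P.A)‖ ≤ R := by
    intro n
    have h1 := StatesWithin.norm_le (τ n).isMetrical.qcmsA (hτ n).A₁ (hε₀ n) hl (hd n)
    have h2 : ‖(τ n).iso₁.mapA (d n)‖ = ‖(a : T₁.A)‖ := congrArg norm (hd₁ n)
    have h3 : l * ε n ≤ l * 1 := mul_le_mul_of_nonneg_left (hε₁ n) hl.le
    linarith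
  -- The images of the lifts at the other end lie in one norm-compact set. Their limit `b` is chosen
  -- before `p` and serves the whole relation.
  have hc := IsQuantumCompactMetricSpace.isCompact_lip_norm_le hT₂ hl R
  let d' : ℕ → selfAdjoint T₂.A := fun n => selfAdjointMap (τ n).iso₂.mapA (d n)
  obtain ⟨b, -, hb⟩ := Ultrafilter.exists_tendsto_of_isCompact hc 𝒰
    (x := d') fun n =>
      ⟨((τ n).iso₂.lipA_map_le ((hd n).trans_lt ENNReal.ofReal_lt_top)).trans (hd n),
        (NonUnitalStarAlgHom.norm_apply_le (τ n).iso₂.mapA _).trans (hR n)⟩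
  refine ⟨b, fun p hp => ?_⟩
  obtain ⟨m, hm, ω, hω, h₁, h₂⟩ := hp
  refine ⟨G * (R + l) * m, by positivity, fun n => (τ n).P.lact (d n : (τ n).P.A) (ω n),
    fun n => ?_, ?_, ?_⟩
  · refine ((τ n).isMetrical.modular_leibniz _ _ ((hd n).trans_lt ENNReal.ofReal_lt_top)
      ((hω n).trans_lt ENNReal.ofReal_lt_top)).trans ?_
    rw [ENNReal.ofReal_mul (by positivity), ENNReal.ofReal_mul hG.le,
      ENNReal.ofReal_add (by positivity) hl.le]
    gcongr
    · exact (enorm_le_ofReal_iff (by positivity)).2 (hR n)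
    · exact hd n
    · exact hω n
  · have e : ∀ n, (τ n).map₁ ((τ n).P.lact (d n : (τ n).P.A) (ω n)) =
        T₁.rep (a : T₁.A) ((τ n).map₁ (ω n)) := fun n => by
      rw [← hd₁ n]
      exact (τ n).iso₁.map_lact _ _
    simp only [e]
    exact ((T₁.rep (a : T₁.A)).continuous.tendsto _).comp h₁
  · have e : ∀ n, (τ n).map₂ ((τ n).P.lact (d n : (τ n).P.A) (ω n)) =
        T₂.rep (d' n : T₂.A) ((τ n).map₂ (ω n)) :=
      fun n => (τ n).iso₂.map_lact _ _
    simp only [e]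
    have hb' : Filter.Tendsto (fun n => T₂.rep (d' n : T₂.A)) 𝒰
        (𝓝 (T₂.rep (b : T₂.A))) :=
      (((continuous_starAlgHom T₂.rep).comp continuous_subtype_val).tendsto b).comp hb
    exact ((isBoundedBilinearMap_apply (𝕜 := ℂ)).continuous.tendsto
      (T₂.rep (b : T₂.A), p.2)).comp (hb'.prodMk_nhds h₂)

/-- The partner of `ξ` in the `n`-th tunnel serves all times in `[0, 1/εₙ]` at once, so its limit
`η` in the compact graph norm ball does not depend on `t`. -/
theorem exists_inner_U_eq (h𝒰 : (𝒰 : Filter ℕ) ≤ Filter.atTop) (hε₀ : ∀ n, 0 < ε n)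
    (hε : Filter.Tendsto ε Filter.atTop (𝓝 0))
    (hτ : ∀ n, DispersionWithin (τ n) (fun t : timeInterval (ε n) => T₁.U (t : ℝ≥0))
      (fun t : timeInterval (ε n) => T₂.U (t : ℝ≥0)) (ENNReal.ofReal (ε n)))
    {ξ : T₁.H} (hξ : graphNorm T₁.D ξ ≤ 1) :
    ∃ η : T₂.H, ∀ p ∈ limitRelation τ 𝒰, ∀ t : ℝ≥0,
      (inner ℂ ξ (T₁.U t p.1) : ℂ) = inner ℂ η (T₂.U t p.2) := by
  choose ζ hζ h using fun n => (hτ n).left ξ hξ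
  obtain ⟨η, -, hη⟩ := Ultrafilter.exists_tendsto_of_isCompact T₂.isCompact_ball 𝒰 hζ
  refine ⟨η, fun p hp t => ?_⟩
  obtain ⟨l, hl, ω, hω, h₁, h₂⟩ := hp
  have hbound : ∀ᶠ n in (𝒰 : Filter ℕ), ‖(inner ℂ ξ (T₁.U t ((τ n).map₁ (ω n))) : ℂ) -
      inner ℂ (ζ n) (T₂.U t ((τ n).map₂ (ω n)))‖ ≤ l * ε n := by
    -- Each fixed time eventually belongs to the interval `[0, 1/εₙ]`.
    have hev : ∀ᶠ n in Filter.atTop, ε n < 1 / ((t : ℝ) + 1) :=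
      hε.eventually (gt_mem_nhds (by positivity))
    filter_upwards [h𝒰 hev] with n hn
    have ht : t ∈ timeInterval (ε n) := by
      change (t : ℝ) ≤ 1 / ε n
      rw [lt_one_div (hε₀ n) (by positivity)] at hn
      linarith
    have hω' := apply_inv_smul_le_one (τ n).isMetrical.dnorm_smul hl (hω n)
    have h3 := h n ⟨t, ht⟩ _ hω'
    rw [enorm_le_ofReal_iff (hε₀ n).le, map_smul, map_smul, map_smul, map_smul, inner_smul_right,
      inner_smul_right, ← mul_sub, norm_mul, norm_inv, Complex.norm_real,
      Real.norm_of_nonneg hl.le, inv_mul_le_iff₀ hl] at h3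
    exact h3
  have l₁ : Filter.Tendsto (fun n => (inner ℂ ξ (T₁.U t ((τ n).map₁ (ω n))) : ℂ)) 𝒰
      (𝓝 (inner ℂ ξ (T₁.U t p.1))) :=
    tendsto_const_nhds.inner (((T₁.U t).continuous.tendsto _).comp h₁)
  have l₂ : Filter.Tendsto (fun n => (inner ℂ (ζ n) (T₂.U t ((τ n).map₂ (ω n))) : ℂ)) 𝒰
      (𝓝 (inner ℂ η (T₂.U t p.2))) :=
    hη.inner (((T₂.U t).continuous.tendsto _).comp h₂)
  have l₃ : Filter.Tendsto (fun n => (inner ℂ ξ (T₁.U t ((τ n).map₁ (ω n))) : ℂ) -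
      inner ℂ (ζ n) (T₂.U t ((τ n).map₂ (ω n)))) 𝒰 (𝓝 0) :=
    squeeze_zero_norm' hbound (by simpa using (hε.mono_left h𝒰).const_mul l)
  exact sub_eq_zero.1 (tendsto_nhds_unique (l₁.sub l₂) l₃)

end SpectralTunnel

namespace SpectralTunnel

variable {F K G H : ℝ} {T₁ T₂ : SpectralTriple.{u, v}}
  {τ : ℕ → SpectralTunnel F K G H T₁ T₂} {𝒰 : Ultrafilter ℕ} {ε : ℕ → ℝ}

/-- The identity of matrix coefficients at `t = 0` shows that the partner of `ζ` is `V ζ`; at any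
other time it then says that `V` intertwines the groups, tested against a dense set of vectors `ζ`.
-/
theorem U_comm_of_mem_limitRelation (h𝒰 : (𝒰 : Filter ℕ) ≤ Filter.atTop) (hε₀ : ∀ n, 0 < ε n)
    (hε : Filter.Tendsto ε Filter.atTop (𝓝 0))
    (hτ : ∀ n, DispersionWithin (τ n) (fun t : timeInterval (ε n) => T₁.U (t : ℝ≥0))
      (fun t : timeInterval (ε n) => T₂.U (t : ℝ≥0)) (ENNReal.ofReal (ε n)))
    {V : T₁.H ≃ₗᵢ[ℂ] T₂.H} (hV : ∀ p ∈ limitRelation τ 𝒰, V p.1 = p.2) (t : ℝ≥0) (ξ : T₁.H) :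
    T₂.U t (V ξ) = V (T₁.U t ξ) := by
  have key : ∀ ζ, graphNorm T₁.D ζ ≤ 1 → inner ℂ ζ (V.symm (T₂.U t (V ξ)) - T₁.U t ξ) = 0 := by
    intro ζ hζ
    obtain ⟨η, hη⟩ := exists_inner_U_eq h𝒰 hε₀ hε hτ hζ
    have h : ∀ (t : ℝ≥0) (x : T₁.H),
        (inner ℂ ζ (T₁.U t x) : ℂ) = inner ℂ η (T₂.U t (V x)) := fun t =>
      congrFun <| Continuous.ext_on (dense_fst_limitRelation τ 𝒰) (by fun_prop) (by fun_prop) <| by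
        rintro _ ⟨p, hp, rfl⟩
        change (inner ℂ ζ (T₁.U t p.1) : ℂ) = inner ℂ η (T₂.U t (V p.1))
        rw [hV p hp, hη p hp]
    have e : V ζ = η := by
      refine ext_inner_right ℂ fun y => ?_
      obtain ⟨x, rfl⟩ := V.surjective y
      have h0 := h 0 x
      rw [NNReal.coe_zero, T₁.U_zero, T₂.U_zero] at h0
      rw [V.inner_map_map]
      exact h0
    rw [inner_sub_right, h, ← e, ← V.inner_map_map, V.apply_symm_apply, sub_self]
  refine (V.symm_apply_eq).1 (sub_eq_zero.1 ?_)
  refine T₁.dense_graphNorm_lt_top.eq_zero_of_inner_right (𝕜 := ℂ) fun ζ hζ => ?_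
  set l : ℝ := (graphNorm T₁.D ζ).toReal + 1
  have hl : 0 < l := by positivity
  have hle : graphNorm T₁.D ζ ≤ ENNReal.ofReal l :=
    (ENNReal.le_ofReal_iff_toReal_le (ne_of_lt hζ) hl.le).2 (le_add_of_nonneg_right zero_le_one)
  have h := key _ (apply_inv_smul_le_one graphNorm_smul hl hle)
  rw [inner_smul_left, mul_eq_zero] at h
  refine h.resolve_left ?_
  refine (map_ne_zero _).2 ?_
  exact inv_ne_zero (by exact_mod_cast hl.ne')

theorem exists_rep_apply_eq (hT₂ : T₂.IsMetric) (hG : 0 < G)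
    (hε₀ : ∀ n, 0 ≤ ε n) (hε₁ : ∀ n, ε n ≤ 1)
    (hτ : ∀ n, MetricalTunnel.ExtentWithin (τ n) (ENNReal.ofReal (ε n)))
    {V : T₁.H ≃ₗᵢ[ℂ] T₂.H} (hV : ∀ p ∈ limitRelation τ 𝒰, V p.1 = p.2)
    {a : selfAdjoint T₁.A} (ha : T₁.lip a < ∞) :
    ∃ b : T₂.A, ∀ ξ, T₂.rep b (V ξ) = V (T₁.rep (a : T₁.A) ξ) := by
  obtain ⟨b, hb⟩ := exists_rep_mem_limitRelation (𝒰 := 𝒰) hT₂ hG hε₀ hε₁ hτ ha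
  refine ⟨b, congrFun <| Continuous.ext_on (dense_fst_limitRelation τ 𝒰) (by fun_prop)
    (by fun_prop) ?_⟩
  rintro _ ⟨p, hp, rfl⟩
  change T₂.rep b (V p.1) = V (T₁.rep (a : T₁.A) p.1)
  rw [hV p hp, hV _ (hb p hp)]

/-- Two metric spectral triples with tunnels of arbitrarily small dispersion are unitarily
equivalent. -/
theorem unitarilyEquivalent_of_dispersionWithin (hG : 0 < G) (hH : 0 < H) (hT₁ : T₁.IsMetric)
    (hT₂ : T₂.IsMetric) (hε₀ : ∀ n, 0 < ε n) (hε₁ : ∀ n, ε n ≤ 1)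
    (hε : Filter.Tendsto ε Filter.atTop (𝓝 0))
    (hτ : ∀ n, DispersionWithin (τ n) (fun t : timeInterval (ε n) => T₁.U (t : ℝ≥0))
      (fun t : timeInterval (ε n) => T₂.U (t : ℝ≥0)) (ENNReal.ofReal (ε n))) :
    T₁.UnitarilyEquivalent T₂ := by
  let 𝒰 := Filter.hyperfilter ℕ
  have h𝒰 : (𝒰 : Filter ℕ) ≤ Filter.atTop := Nat.hyperfilter_le_atTop
  obtain ⟨V, hV⟩ := exists_linearIsometryEquiv_of_relation (limitRelation τ 𝒰)
    (fun p hp => norm_eq_of_mem_limitRelation hH (fun n => (hε₀ n).le) (hε.mono_left h𝒰)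
      (fun n => (hτ n).extent) hp)
    (dense_fst_limitRelation τ 𝒰) (dense_snd_limitRelation τ 𝒰)
  -- The reversed tunnels produce the inverse relation, so the inclusion of algebras in the other
  -- direction follows by symmetry.
  have hV' : ∀ p ∈ limitRelation (fun n => MetricalTunnel.symm (τ n)) 𝒰, V.symm p.1 = p.2 :=
    fun p hp => V.symm_apply_eq.2 (hV _ (mem_limitRelation_symm hp)).symm
  obtain ⟨π, hπ⟩ := SpectralTriple.IsMetric.exists_starAlgEquiv hT₁ hT₂ V
    (fun a ha => exists_rep_apply_eq hT₂ hG (fun n => (hε₀ n).le) hε₁ (fun n => (hτ n).extent) hV ha)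
    (fun b hb => by
      obtain ⟨a, ha⟩ := exists_rep_apply_eq hT₁ hG (fun n => (hε₀ n).le) hε₁
        (fun n => (hτ n).symm.extent) hV' hb
      refine ⟨a, fun ξ => ?_⟩
      have := ha (V ξ)
      rw [V.symm_apply_apply] at this
      rw [this, V.apply_symm_apply])
  refine SpectralTriple.unitarilyEquivalent_iff.2
    ⟨V, π, SpectralTriple.isUnitaryEquivalence_of_U hπ fun t ht ξ => ?_⟩
  exact U_comm_of_mem_limitRelation h𝒰 hε₀ hε hτ hV ⟨t, ht⟩ ξ

end SpectralTunnel

/-- Below `√2 / 2` the infimum is approached only by numbers that come from tunnels, which gives a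
sequence of tunnels with dispersion tending to zero. -/
theorem unitarilyEquivalent_of_spectralPropinquityStar_eq_zero {F K G H : ℝ} (hG : 0 < G)
    (hH : 0 < H) {T₁ T₂ : MetricSpectralTriple.{u, v}}
    (h : spectralPropinquityStar F K G H T₁ T₂ = 0) :
    T₁.toSpectralTriple.UnitarilyEquivalent T₂.toSpectralTriple := by
  have key : ∀ δ : ℝ, 0 < δ → δ ≤ √2 / 2 → ∃ ε : ℝ, 0 < ε ∧ ε < δ ∧
      ∃ τ : SpectralTunnel F K G H T₁.toSpectralTriple T₂.toSpectralTriple,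
        SpectralTunnel.DispersionWithin τ (fun t : timeInterval ε => T₁.U (t : ℝ≥0))
          (fun t : timeInterval ε => T₂.U (t : ℝ≥0)) (ENNReal.ofReal ε) := by
    intro δ hδ hδ'
    have h' := h.trans_lt hδ
    rw [spectralPropinquityStar] at h'
    obtain ⟨ε, hε, hlt⟩ := exists_lt_of_csInf_lt ⟨√2 / 2, Or.inl rfl⟩ h'
    rcases hε with rfl | ⟨hε, τ, hτ⟩
    · exact absurd hlt (not_lt.2 hδ')
    · exact ⟨ε, hε, hlt, τ, SpectralTunnel.dispersionWithin_of_lt hτ⟩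
  have hpos : (0 : ℝ) < √2 / 2 := by positivity
  have hle : √2 / 2 ≤ 1 := by
    have : √2 ≤ 2 := Real.sqrt_le_left two_pos.le |>.2 (by norm_num)
    linarith
  have hδ : ∀ n : ℕ, √2 / 2 / ((n : ℝ) + 1) ≤ √2 / 2 := fun n =>
    div_le_self hpos.le (by linarith [n.cast_nonneg (α := ℝ)])
  choose ε hε₀ hlt τ hτ using fun n : ℕ =>
    key (√2 / 2 / ((n : ℝ) + 1)) (by positivity) (hδ n)
  refine SpectralTunnel.unitarilyEquivalent_of_dispersionWithin hG hH T₁.isMetric T₂.isMetric hε₀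
    (fun n => (hlt n).le.trans ((hδ n).trans hle)) ?_ hτ
  refine squeeze_zero (fun n => (hε₀ n).le) (fun n => (hlt n).le) ?_
  simpa [div_eq_mul_inv] using tendsto_one_div_add_atTop_nhds_zero_nat.const_mul (√2 / 2)

theorem mainTheorem8 (F K G H : ℝ) (hF : 1 ≤ F) (hK : 0 ≤ K) (hG : 1 ≤ G) (hH : 2 ≤ H) :
    (∀ T₁ T₂ : MetricSpectralTriple.{u, v}, 0 ≤ spectralPropinquityStar F K G H T₁ T₂) ∧
    (∀ T₁ T₂ : MetricSpectralTriple.{u, v},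
      spectralPropinquityStar F K G H T₁ T₂ = spectralPropinquityStar F K G H T₂ T₁) ∧
    (∀ T₁ T₂ T₃ : MetricSpectralTriple.{u, v}, spectralPropinquityStar F K G H T₁ T₃ ≤
      spectralPropinquityStar F K G H T₁ T₂ + spectralPropinquityStar F K G H T₂ T₃) ∧
    (∀ T₁ T₂ : MetricSpectralTriple.{u, v}, spectralPropinquityStar F K G H T₁ T₂ = 0 ↔
      T₁.toSpectralTriple.UnitarilyEquivalent T₂.toSpectralTriple) ∧
    (∀ T₁ T₂ : MetricSpectralTriple.{u, v},
      spectralPropinquity F K G H T₁ T₂ ≤ spectralPropinquityStar F K G H T₁ T₂ ∧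
      spectralPropinquityStar F K G H T₁ T₂ ≤ 2 * spectralPropinquity F K G H T₁ T₂) := by
  exact ⟨spectralPropinquityStar_nonneg, fun _ _ => spectralPropinquityStar_comm,
    spectralPropinquityStar_triangle hF hG hH,
    fun _ _ => ⟨unitarilyEquivalent_of_spectralPropinquityStar_eq_zero (by linarith) (by linarith),
      spectralPropinquityStar_eq_zero_of_unitarilyEquivalent hF hK hG⟩,
    fun _ _ => ⟨spectralPropinquity_le_spectralPropinquityStar,
      spectralPropinquityStar_le_two_mul⟩⟩
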